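/- Let $\phi_0\in C^2(\mathbb R^2)$ and $c_0\in\mathbb R$ be such that $D=\{\phi_0<c_0\}$ is nonempty, bounded and connected and $\nabla\phi_0\neq0$ on $\{\phi_0=c_0\}$. Let $a,\varkappa>0$ and put $\Omega=D\times(-a,a)\subset\mathbb R^3$, with boundary consisting of the lateral part $S_1=\partial D\times(-a,a)$ and the ends $S_2(\pm a)=D\times\{\pm a\}$; let $\bar n$ be the outward unit normal. There is a constant $c>0$, depending only on $\Omega$ and $\varkappa$, with the following property. Let $t>0$, $\theta^*>0$, let $d_1,d_2\ge0$ be measurable with $$d_1\in L_6(0,t;L_3(S_2(-a)))\cap L_2(0,t;L_\infty(S_2(-a))),\qquad d_2\in L_1(0,t;L_1(S_2(a))),$$ and let $\theta_0\in L_2(\Omega)$ satisfy $0\le\theta_0\le\theta^*$ a.e. in $\Omega$. Let $v\in L_2(\Omega\times(0,t);\mathbb R^3)$ satisfy, for a.e. time, $\operatorname{div}v=0$ in $\Omega$, $v\cdot\bar n=0$ on $S_1$, $v\cdot\bar n=-d_1$ on $S_2(-a)$ and $v\cdot\bar n=d_2$ on $S_2(a)$ in the weak sense, that is, $\int_\Omega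 v\cdot\nabla\psi\,dx=\int_{S_2(a)}d_2\psi\,dS-\int_{S_2(-a)}d_1\psi\,dS$ for all $\psi\in C_c^\infty(\mathbb R^3)$. Let $\theta\in L_\infty(0,t;L_2(\Omega))\cap L_2(0,t;H^1(\Omega))$ be a weak solution of $$\theta_t+v\cdot\nabla\theta-\varkappa\Delta\theta=0\ \text{ in }\Omega\times(0,t),\qquad \bar n\cdot\nabla\theta=0\ \text{ on }\partial\Omega,\qquad \theta|_{t=0}=\theta_0,$$ that is, for every $\psi\in C_c^\infty(\mathbb R^3)$ and a.e. $s\in(0,t)$, $$\int_\Omega\theta(s)\psi\,dx=\int_\Omega\theta_0\psi\,dx-\int_0^s\!\int_\Omega\big(v\cdot\nabla\theta\,\psi+\varkappa\nabla\theta\cdot\nabla\psi\big)\,dx\,dr .$$ Then $\theta\le\theta^*$ a.e. in $\Omega\times(0,t)$, and $$\|\theta\|_{V(\Omega^t)}^2\le c\exp\!\big(c\,\|d_1\|_{L_6(0,t;L_3(S_2(-a)))}^6\big)\|\theta_0\|_{L_2(\Omega)}^2+\|d_1\|_{L_1(S_2(-a)\times(0,t))}^2\,\theta^{*2}+\|\theta_0\|_{L_1(\Omega)}^2,$$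 where $\|\theta\|_{V(\Omega^t)}=\operatorname{ess\,sup}_{s\in(0,t)}\|\theta(s)\|_{L_2(\Omega)}+\big(\int_0^t\|\nabla\theta\|_{L_2(\Omega)}^2ds\big)^{1/2}$. -/

import Mathlib

open MeasureTheory Set
open scoped ENNReal

noncomputable section

namespace HeatCylinder

/-- The plane of the cross-section. -/
abbrev E2 : Type := EuclideanSpace ℝ (Fin 2)

/-- Physical space. -/
abbrev E3 : Type := EuclideanSpace ℝ (Fin 3)

/-- The point `(y₁, y₂, z)` of space. -/
def lift (y : E2) (z : ℝ) : E3 := !₂[y 0, y 1, z]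

/-- The planar domain `{φ₀ < c₀}`; both ends `S₂(-a)` and `S₂(a)` of the cylinder are copies of
it, and, being flat, carry the planar Lebesgue measure. -/
def crossSection (φ₀ : E2 → ℝ) (c₀ : ℝ) : Set E2 := {y | φ₀ y < c₀}

/-- The cylinder `{φ₀(x₁, x₂) < c₀, -a < x₃ < a}`. -/
def cylinder (φ₀ : E2 → ℝ) (c₀ a : ℝ) : Set E3 :=
  {x | φ₀ !₂[x 0, x 1] < c₀ ∧ -a < x 2 ∧ x 2 < a}

/-- `{φ₀ = c₀}` is a regular level of a `C²` function, bounding a bounded, nonempty, connected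
planar domain `{φ₀ < c₀}`. -/
structure IsRegularSection (φ₀ : E2 → ℝ) (c₀ : ℝ) : Prop where
  smooth : ContDiff ℝ 2 φ₀
  regular : ∀ y, φ₀ y = c₀ → fderiv ℝ φ₀ y ≠ 0
  bounded : Bornology.IsBounded (crossSection φ₀ c₀)
  connected : IsConnected (crossSection φ₀ c₀)

/-- Smooth compactly supported functions on the whole space (not required to vanish on the
boundary of the cylinder). -/
def IsTest (ψ : E3 → ℝ) : Prop :=
  ContDiff ℝ ((⊤ : ℕ∞) : WithTop ℕ∞) ψ ∧ HasCompactSupport ψ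

/-- `g` is the weak (distributional) gradient of `u` in the open set `Ω`, both square
integrable; that is, `u ∈ H¹(Ω)` and `∇u = g`. -/
def HasWeakGradient (Ω : Set E3) (u : E3 → ℝ) (g : E3 → E3) : Prop :=
  MemLp u 2 (volume.restrict Ω) ∧ MemLp g 2 (volume.restrict Ω) ∧
    ∀ ψ : E3 → ℝ, IsTest ψ → tsupport ψ ⊆ Ω →
      ∫ x in Ω, u x • gradient ψ x = -∫ x in Ω, ψ x • g x

/-- Joint measurability (up to null sets) of a time dependent function on `(0, t) × Q`. -/
def JointlyMeasurable {n : ℕ} {F : Type*} [TopologicalSpace F] (t : ℝ)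
    (Q : Set (EuclideanSpace ℝ (Fin n))) (f : ℝ → EuclideanSpace ℝ (Fin n) → F) : Prop :=
  AEStronglyMeasurable (Function.uncurry f)
    ((volume.restrict (Ioo 0 t)).prod (volume.restrict Q))

/-- The norm of `L_q(0, t; L_p(Q))`. -/
def mixedNorm {n : ℕ} {F : Type*} [NormedAddCommGroup F] (q p : ℝ≥0∞) (t : ℝ)
    (Q : Set (EuclideanSpace ℝ (Fin n))) (f : ℝ → EuclideanSpace ℝ (Fin n) → F) : ℝ≥0∞ :=
  eLpNorm (fun s => eLpNorm (f s) p (volume.restrict Q)) q (volume.restrict (Ioo 0 t))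

/-- The norm of `V(Ω^t)`, i.e. `ess sup_{(0,t)} ‖θ‖_{L₂(Ω)} + (∫₀ᵗ ‖∇θ‖²_{L₂(Ω)})^{1/2}`, of a
function `θ` whose weak gradient is `g`. -/
def energyNorm (t : ℝ) (Ω : Set E3) (θ : ℝ → E3 → ℝ) (g : ℝ → E3 → E3) : ℝ≥0∞ :=
  mixedNorm ∞ 2 t Ω θ + mixedNorm 2 2 t Ω g

/-- `v ∈ L₂(Ω^t)` satisfies, for almost every time, `div v = 0` in the cylinder, `v·n = 0` on the
lateral boundary, `v·n = -d₁` on the bottom `S₂(-a)`, and `v·n = d₂` on the top `S₂(a)`. The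
equation and the normal components on the boundary are taken in the weak sense, through Green's
formula `∫_Ω v·∇ψ = ∫_{∂Ω} (v·n) ψ`. -/
structure IsVelocity (φ₀ : E2 → ℝ) (c₀ a t : ℝ) (d₁ d₂ : ℝ → E2 → ℝ) (v : ℝ → E3 → E3) :
    Prop where
  measurable : JointlyMeasurable t (cylinder φ₀ c₀ a) v
  square_integrable : mixedNorm 2 2 t (cylinder φ₀ c₀ a) v < ∞
  flux : ∀ᵐ s ∂(volume.restrict (Ioo 0 t)), ∀ ψ : E3 → ℝ, IsTest ψ →
    ∫ x in cylinder φ₀ c₀ a, inner ℝ (v s x) (gradient ψ x) =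
      (∫ y in crossSection φ₀ c₀, d₂ s y * ψ (lift y a)) -
        ∫ y in crossSection φ₀ c₀, d₁ s y * ψ (lift y (-a))

/-- `θ`, with weak gradient `g`, is a weak solution in `L_∞(0,t;L₂(Ω)) ∩ L₂(0,t;H¹(Ω))` of
`θ_t + v·∇θ - κ Δθ = 0` with homogeneous Neumann condition on the whole boundary and initial value
`θ₀`: for every `ψ` smooth up to the boundary the distributional derivative of `∫ θ ψ` in time is
`-∫ (v·∇θ ψ + κ ∇θ·∇ψ)`, with initial value `∫ θ₀ ψ`. -/
structure IsWeakSolution (Ω : Set E3) (κ t : ℝ) (v : ℝ → E3 → E3) (θ₀ : E3 → ℝ)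
    (θ : ℝ → E3 → ℝ) (g : ℝ → E3 → E3) : Prop where
  measurable : JointlyMeasurable t Ω θ
  measurable_grad : JointlyMeasurable t Ω g
  finite_energy : energyNorm t Ω θ g < ∞
  weak_grad : ∀ᵐ s ∂(volume.restrict (Ioo 0 t)), HasWeakGradient Ω (θ s) (g s)
  equation : ∀ ψ : E3 → ℝ, IsTest ψ → ∀ᵐ s ∂(volume.restrict (Ioo 0 t)),
    ∫ x in Ω, θ s x * ψ x = (∫ x in Ω, θ₀ x * ψ x) -
      ∫ r in (0 : ℝ)..s, ∫ x in Ω,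
        (inner ℝ (v r x) (g r x) * ψ x + κ * inner ℝ (g r x) (gradient ψ x))

end HeatCylinder

end

/-! Formally, test the equation with θ. Since div v = 0, convection becomes the boundary flux
½∫(v·n)θ². The outflow has the good sign, so only the inflow term ½∫_{S₂(-a)} d₁θ² has to be
bounded, and there are two ways to do it.

Trace bound (`exists_trace`, `flux_le_of_trace`). For every δ > 0 there is K with ∫ d|w|² ≤ δ‖∇w‖² +
K(‖d‖_{L₃}⁶ + ‖d‖_{L₁})‖w‖², the left side being taken on the bottom. With δ = κ the gradient is
absorbed, and Grönwall gives ‖θ(s)‖² + κ∫₀ˢ‖∇θ‖² ≤ ‖θ₀‖² exp(K(‖d₁‖⁶ + X)), where ‖d₁‖ is the norm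
of L₆(L₃) and X the norm of d₁ in L₁ (`IsWeakSolution.ae_gronwall`). The coefficient of ‖w‖² must
vanish with d: a bare ‖w‖² would produce exp(ct) and make the constant depend on t. For this reason
the localization uses increments χ(w - w(· + q)) along inward displacements q, whose energy is
bounded by ‖∇w‖² alone, and the shifted value w(· + q) is averaged over q. The power 6 comes from
the planar inequality ∫F⁶ ≤ C ∫F² (∫|∇F|²)², proved by a Loomis–Whitney argument along two inward
directions. Applied to the excess of |θ| over θ*, the same estimate is the maximum principle
(`IsWeakSolution.ae_abs_le`).

Sup bound (`flux_le_of_bounded`). Once |θ| ≤ θ*, the flux integrated in time is at most ½θ*²X, so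
κ∫‖∇θ‖² ≤ ½‖θ₀‖² + ½θ*²X.

The theorem follows by comparing X with a threshold M depending on |Ω| and κ. If X ≥ M, then X²
dominates the terms 2|Ω| + X/κ produced by the sup bound, so X²θ*² appears with coefficient 1. If X
< M, the factor exp(KX) of the trace bound is at most the constant exp(KM).

Rigour: v·∇θ is only integrable, so θ is not an admissible test function. Instead, backward time
increments of the weak formulation are tested with β'(θ(s)), where β is smooth and convex with
bounded derivatives; this uses density of smooth functions in H¹(Ω) (`exists_test_approx`).
Convexity gives an inequality for ∫β(θ), and the errors are time translations of v·∇θ in L₁ and of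
∇θ in L₂, which are negligible after integration in s. This is `ae_entropy_le`; letting β increase
to P²/2 gives the energy inequality. -/

namespace HeatCylinder

open Filter Topology

/-! ### Grönwall's inequality with an integrable kernel. -/

/-- Composition of an absolutely continuous function with a Lipschitz function. -/
lemma absolutelyContinuous_comp_lipschitzOn {f φ : ℝ → ℝ} {a b C : ℝ} (hC : 0 ≤ C)
    (hf : AbsolutelyContinuousOnInterval f a b)
    (hφ : ∀ x ∈ uIcc a b, ∀ y ∈ uIcc a b, dist (φ (f x)) (φ (f y)) ≤ C * dist (f x) (f y)) :
    AbsolutelyContinuousOnInterval (fun x => φ (f x)) a b := by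
  rw [absolutelyContinuousOnInterval_iff] at hf ⊢
  intro ε hε
  -- Dividing by C + 1 rather than C covers C = 0 and makes the final inequality strict.
  obtain ⟨δ, hδ, h⟩ := hf (ε / (C + 1)) (by positivity)
  refine ⟨δ, hδ, fun E hE hE' => ?_⟩
  have h1 := h E hE hE'
  calc _ ≤ ∑ i ∈ Finset.range E.1, C * dist (f (E.2 i).1) (f (E.2 i).2) := by
        apply Finset.sum_le_sum
        intro i hi
        exact hφ _ (hE.1 i hi).1 _ (hE.1 i hi).2
    _ = C * ∑ i ∈ Finset.range E.1, dist (f (E.2 i).1) (f (E.2 i).2) := by rw [Finset.mul_sum]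
    _ ≤ C * (ε / (C + 1)) := by gcongr
    _ < (C + 1) * (ε / (C + 1)) := by
        have : 0 < ε / (C + 1) := by positivity
        nlinarith
    _ = ε := by field_simp

lemma abs_exp_neg_sub_le {x y : ℝ} (hx : 0 ≤ x) (hy : 0 ≤ y) :
    dist (Real.exp (-x)) (Real.exp (-y)) ≤ 1 * dist x y := by
  wlog h : x ≤ y generalizing x y
  · rw [dist_comm, dist_comm x]; exact this hy hx (by linarith)
  rw [Real.dist_eq, Real.dist_eq, abs_of_nonneg (by simpa using h),
    abs_of_nonpos (by linarith)]
  have h1 : Real.exp (-y) = Real.exp (-x) * Real.exp (-(y - x)) := by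
    rw [← Real.exp_add]; ring_nf
  have h2 : 1 - (y - x) ≤ Real.exp (-(y - x)) := by linarith [Real.add_one_le_exp (-(y - x))]
  have h3 : Real.exp (-x) ≤ 1 := by simpa using hx
  have h4 := Real.exp_pos (-x)
  nlinarith

/-- Grönwall's inequality in integral form with an integrable kernel. -/
lemma gronwall_integral {y k : ℝ → ℝ} {y₀ t : ℝ}
    (hk : IntervalIntegrable k volume 0 t) (hk0 : ∀ s, 0 ≤ k s)
    (hky : IntervalIntegrable (fun s => k s * y s) volume 0 t)
    (h : ∀ᵐ s ∂(volume.restrict (Ioo 0 t)), y s ≤ y₀ + ∫ r in (0 : ℝ)..s, k r * y r)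
    {s : ℝ} (hs : s ∈ Icc 0 t) :
    y₀ + ∫ r in (0 : ℝ)..s, k r * y r ≤ y₀ * Real.exp (∫ r in (0 : ℝ)..s, k r) := by
  -- With K = ∫k and Y = y₀ + ∫ky, the product Y exp(-K) is absolutely continuous with derivative
  -- k(y - Y)exp(-K) ≤ 0 almost everywhere, so it never exceeds its initial value y₀. No sign of y
  -- is needed.
  have h0s : (0 : ℝ) ≤ s := hs.1
  have hsub : uIcc 0 s ⊆ uIcc 0 t := by
    rw [uIcc_of_le h0s, uIcc_of_le (h0s.trans hs.2)]; exact Icc_subset_Icc_right hs.2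
  have hk' := hk.mono_set hsub
  have hky' := hky.mono_set hsub
  set K : ℝ → ℝ := fun s => ∫ r in (0 : ℝ)..s, k r with hK
  set Y : ℝ → ℝ := fun s => y₀ + ∫ r in (0 : ℝ)..s, k r * y r with hY
  have hKac : AbsolutelyContinuousOnInterval K 0 s :=
    hk'.absolutelyContinuousOnInterval_intervalIntegral left_mem_uIcc
  have hKnn : ∀ r ∈ uIcc 0 s, 0 ≤ K r := by
    intro r hr
    rw [uIcc_of_le h0s] at hr
    exact intervalIntegral.integral_nonneg hr.1 (fun u _ => hk0 u)
  have hYac : AbsolutelyContinuousOnInterval Y 0 s := by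
    have h1 : AbsolutelyContinuousOnInterval (fun _ : ℝ => y₀) 0 s :=
      (contDiff_const.contDiffOn : ContDiffOn ℝ 1 (fun _ : ℝ => y₀) _).absolutelyContinuousOnInterval
    exact h1.fun_add (hky'.absolutelyContinuousOnInterval_intervalIntegral left_mem_uIcc)
  -- exp(-x) is 1-Lipschitz only for x ≥ 0, which is why K ≥ 0 was recorded.
  have hEac : AbsolutelyContinuousOnInterval (fun r => Real.exp (-(K r))) 0 s :=
    absolutelyContinuous_comp_lipschitzOn (φ := fun x => Real.exp (-x)) zero_le_one hKac
      (fun x hx y hy => abs_exp_neg_sub_le (hKnn x hx) (hKnn y hy))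
  have hF := (hYac.fun_mul hEac).integral_deriv_eq_sub
  have hneg : ∫ x in (0 : ℝ)..s, deriv (fun r => Y r * Real.exp (-(K r))) x ≤ 0 := by
    rw [intervalIntegral.integral_of_le h0s, ← integral_Icc_eq_integral_Ioc]
    apply integral_nonpos_of_ae
    have h1 := hk'.ae_hasDerivAt_integral
    have h2 := hky'.ae_hasDerivAt_integral
    have h3 : ∀ᵐ s ∂volume, s ∈ Ioo 0 t → y s ≤ Y s :=
      (ae_restrict_iff' measurableSet_Ioo).1 h
    have h4 : ∀ᵐ x ∂(volume : Measure ℝ), x ≠ 0 ∧ x ≠ s := by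
      have e : {x : ℝ | ¬(x ≠ 0 ∧ x ≠ s)} = {0, s} := by ext x; simp; tauto
      rw [ae_iff, e]
      exact (Set.Finite.measure_zero (by simp) _)
    apply (ae_restrict_iff' measurableSet_Icc).2
    filter_upwards [h1, h2, h3, h4] with x a1 a2 a3 a4 hx
    have hx' : x ∈ uIcc 0 s := by rwa [uIcc_of_le h0s]
    have d1 : HasDerivAt K (k x) x := a1 hx' 0 left_mem_uIcc
    have d2 : HasDerivAt Y (k x * y x) x := by
      have := (a2 hx' 0 left_mem_uIcc).const_add y₀
      exact this
    have d3 := d2.mul (d1.neg.exp)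
    have hlt : x ∈ Ioo 0 t :=
      ⟨lt_of_le_of_ne hx.1 (Ne.symm a4.1), lt_of_lt_of_le (lt_of_le_of_ne hx.2 a4.2) hs.2⟩
    have e1 : deriv (fun r => Y r * Real.exp (-(K r))) x
        = k x * y x * Real.exp (-(K x)) + Y x * (Real.exp (-(K x)) * -(k x)) := d3.deriv
    rw [e1]
    have := mul_nonneg (mul_nonneg (hk0 x) (Real.exp_pos (-(K x))).le) (sub_nonneg.2 (a3 hlt))
    simp only [Pi.zero_apply]
    nlinarith
  rw [hF] at hneg
  have e0 : Y 0 * Real.exp (-(K 0)) = y₀ := by simp [hY, hK]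
  rw [e0] at hneg
  have : Y s * Real.exp (-(K s)) * Real.exp (K s) = Y s := by
    rw [mul_assoc, ← Real.exp_add]; simp
  change Y s ≤ y₀ * Real.exp (K s)
  rw [← this]
  exact mul_le_mul_of_nonneg_right (by linarith) (Real.exp_pos _).le

end HeatCylinder

/-! ### Geometry of the cylinder: product structure and inward directions. -/

namespace HeatCylinder

open Filter Topology Metric

lemma isOpen_crossSection {φ₀ : E2 → ℝ} {c₀ : ℝ} (h : Continuous φ₀) :
    IsOpen (crossSection φ₀ c₀) := isOpen_lt h continuous_const

lemma toLp_pair_eq (y : E2) : (!₂[y 0, y 1] : E2) = y := by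
  ext i; fin_cases i <;> simp

lemma continuous_plane_proj : Continuous (fun x : E3 => (!₂[x 0, x 1] : E2)) := by
  refine (PiLp.continuous_toLp 2 _).comp (continuous_pi fun i => ?_)
  fin_cases i <;> simp <;> fun_prop

lemma isOpen_cylinder {φ₀ : E2 → ℝ} {c₀ a : ℝ} (h : Continuous φ₀) :
    IsOpen (cylinder φ₀ c₀ a) := by
  have h2 : Continuous (fun x : E3 => x 2) := by fun_prop
  exact (isOpen_lt (h.comp continuous_plane_proj) continuous_const).inter
    ((isOpen_lt continuous_const h2).inter (isOpen_lt h2 continuous_const))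

lemma lift_mem_cylinder {φ₀ : E2 → ℝ} {c₀ a : ℝ} {y : E2} {z : ℝ} :
    lift y z ∈ cylinder φ₀ c₀ a ↔ y ∈ crossSection φ₀ c₀ ∧ z ∈ Ioo (-a) a := by
  simp [lift, cylinder, crossSection, toLp_pair_eq]

lemma lift_proj (x : E3) : lift !₂[x 0, x 1] (x 2) = x := by
  ext i; fin_cases i <;> simp [lift]

/-- The product decomposition of space as a linear equivalence. -/
noncomputable def liftEquiv : (E2 × ℝ) ≃L[ℝ] E3 :=
  LinearEquiv.toContinuousLinearEquiv
    { toFun := fun p => lift p.1 p.2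
      invFun := fun x => (!₂[x 0, x 1], x 2)
      map_add' := fun p q => by ext i; fin_cases i <;> simp [lift]
      map_smul' := fun c p => by ext i; fin_cases i <;> simp [lift]
      left_inv := fun p => by simp [lift, toLp_pair_eq]
      right_inv := fun x => lift_proj x }

@[simp] lemma liftEquiv_apply (p : E2 × ℝ) : liftEquiv p = lift p.1 p.2 := rfl

lemma measurePreserving_lift :
    MeasurePreserving (fun p : E2 × ℝ => lift p.1 p.2) (volume.prod volume) volume := by
  have h1 := EuclideanSpace.volume_preserving_symm_measurableEquiv_toLp (Fin 2)
  have h2 := EuclideanSpace.volume_preserving_symm_measurableEquiv_toLp (Fin 3)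
  have h3 := volume_preserving_piFinSuccAbove (fun _ : Fin 3 => ℝ) 2
  have h4 : MeasurePreserving (fun p : E2 × ℝ => (p.2, (MeasurableEquiv.toLp 2 (Fin 2 → ℝ)).symm p.1))
      (volume.prod volume) (volume.prod volume) :=
    ((MeasurePreserving.id volume).prod h1).comp Measure.measurePreserving_swap
  have h5 := ((h2.symm _).comp (h3.symm _)).comp h4
  have e : (fun p : E2 × ℝ => lift p.1 p.2) =
      ((MeasurableEquiv.toLp 2 (Fin 3 → ℝ)).symm.symm ∘
        (MeasurableEquiv.piFinSuccAbove (fun _ => ℝ) 2).symm) ∘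
        fun p => (p.2, (MeasurableEquiv.toLp 2 (Fin 2 → ℝ)).symm p.1) := by
    funext p
    ext i
    fin_cases i <;> simp [lift, MeasurableEquiv.piFinSuccAbove, Fin.insertNthEquiv] <;> rfl
  rw [e]
  exact h5

lemma measurableEmbedding_lift : MeasurableEmbedding (fun p : E2 × ℝ => lift p.1 p.2) :=
  liftEquiv.toHomeomorph.measurableEmbedding

lemma preimage_lift_cylinder {φ₀ : E2 → ℝ} {c₀ a : ℝ} :
    (fun p : E2 × ℝ => lift p.1 p.2) ⁻¹' cylinder φ₀ c₀ a = crossSection φ₀ c₀ ×ˢ Ioo (-a) a := by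
  ext p; exact lift_mem_cylinder

lemma lintegral_cylinder {φ₀ : E2 → ℝ} {c₀ a : ℝ} {f : E3 → ℝ≥0∞} (hf : Measurable f) :
    ∫⁻ x in cylinder φ₀ c₀ a, f x =
      ∫⁻ z in Ioo (-a) a, ∫⁻ y in crossSection φ₀ c₀, f (lift y z) := by
  have h := measurePreserving_lift.setLIntegral_comp_preimage_emb measurableEmbedding_lift f
    (cylinder φ₀ c₀ a)
  rw [← h, preimage_lift_cylinder, ← Measure.prod_restrict, lintegral_prod_symm]
  exact (hf.comp measurableEmbedding_lift.measurable).aemeasurable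

lemma exists_plane_equiv {e₁ e₂ : E2} (h : e₁ 0 * e₂ 1 - e₁ 1 * e₂ 0 ≠ 0) :
    ∃ A : (ℝ × ℝ) ≃L[ℝ] E2, ∀ s τ : ℝ, A (s, τ) = s • e₁ + τ • e₂ := by
  let f : (ℝ × ℝ) →ₗ[ℝ] E2 :=
    (LinearMap.toSpanSingleton ℝ E2 e₁).coprod (LinearMap.toSpanSingleton ℝ E2 e₂)
  have hf : Function.Injective f := by
    rw [← LinearMap.ker_eq_bot, LinearMap.ker_eq_bot']
    rintro ⟨s, τ⟩ hst
    have h0 := congrArg (fun v : E2 => v 0) hst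
    have h1 := congrArg (fun v : E2 => v 1) hst
    simp [f] at h0 h1
    have hs : s * (e₁ 0 * e₂ 1 - e₁ 1 * e₂ 0) = 0 := by linear_combination e₂ 1 * h0 - e₂ 0 * h1
    have ht : τ * (e₁ 0 * e₂ 1 - e₁ 1 * e₂ 0) = 0 := by linear_combination e₁ 0 * h1 - e₁ 1 * h0
    simp [(mul_eq_zero.1 hs).resolve_right h, (mul_eq_zero.1 ht).resolve_right h]
  refine ⟨(f.linearEquivOfInjective hf (by simp)).toContinuousLinearEquiv, fun s τ => ?_⟩
  simp [f]

/-- Near a point of the closure of a regular section there are two independent directions along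
which one stays in the section. -/
lemma exists_inward_directions {φ₀ : E2 → ℝ} {c₀ : ℝ} (hsec : IsRegularSection φ₀ c₀) {y₀ : E2}
    (hy₀ : y₀ ∈ closure (crossSection φ₀ c₀)) :
    ∃ (R : ℝ) (A : (ℝ × ℝ) ≃L[ℝ] E2), 0 < R ∧
      ∀ y ∈ crossSection φ₀ c₀, y ∈ ball y₀ R → ∀ s : ℝ, 0 ≤ s →
        (y + A (s, 0) ∈ ball y₀ R → y + A (s, 0) ∈ crossSection φ₀ c₀) ∧
        (y + A (0, s) ∈ ball y₀ R → y + A (0, s) ∈ crossSection φ₀ c₀) := by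
  have hcont : Continuous φ₀ := hsec.smooth.continuous
  by_cases hD : y₀ ∈ crossSection φ₀ c₀
  -- At an interior point any frame will do, since a whole ball lies in the section.
  · obtain ⟨R, hR, hRD⟩ := Metric.isOpen_iff.1 (isOpen_crossSection hcont) y₀ hD
    obtain ⟨A, -⟩ := exists_plane_equiv (e₁ := !₂[1, 0]) (e₂ := !₂[0, 1]) (by simp)
    exact ⟨R, A, hR, fun y _ _ s _ => ⟨fun h => hRD h, fun h => hRD h⟩⟩
  · have hle : φ₀ y₀ ≤ c₀ := by
      have : closure (crossSection φ₀ c₀) ⊆ {y | φ₀ y ≤ c₀} :=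
        closure_minimal (fun y hy => show φ₀ y ≤ c₀ from le_of_lt hy) (isClosed_le hcont continuous_const)
      exact this hy₀
    have heq : φ₀ y₀ = c₀ := le_antisymm hle (not_lt.1 hD)
    have hne := hsec.regular y₀ heq
    set n : E2 := gradient φ₀ y₀ with hn
    have hn0 : n ≠ 0 := by
      intro h
      apply hne
      rw [← toDual_gradient, ← hn, h]
      simp
    have hL : ∀ e : E2, fderiv ℝ φ₀ y₀ e = n 0 * e 0 + n 1 * e 1 := by
      intro e
      rw [← inner_gradient_left, ← hn]
      simp [PiLp.inner_apply, mul_comm]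
    have hpos : 0 < n 0 * n 0 + n 1 * n 1 := by
      by_contra hcon
      apply hn0
      have h0 : n 0 = 0 := by nlinarith [mul_self_nonneg (n 0), mul_self_nonneg (n 1)]
      have h1 : n 1 = 0 := by nlinarith [mul_self_nonneg (n 0), mul_self_nonneg (n 1)]
      ext i; fin_cases i <;> simp [h0, h1]
    -- e₁ and e₂ are -n ± n^⊥ with n^⊥ = (-n₁, n₀): both have derivative -|n|² < 0 at y₀, and their
    -- determinant is 2|n|² ≠ 0.
    set e₁ : E2 := !₂[-n 0 - n 1, -n 1 + n 0] with he₁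
    set e₂ : E2 := !₂[-n 0 + n 1, -n 1 - n 0] with he₂
    obtain ⟨A, hA⟩ := exists_plane_equiv (e₁ := e₁) (e₂ := e₂) (by simp [e₁, e₂]; nlinarith)
    have hneg1 : fderiv ℝ φ₀ y₀ e₁ < 0 := by rw [hL]; simp [e₁]; nlinarith
    have hneg2 : fderiv ℝ φ₀ y₀ e₂ < 0 := by rw [hL]; simp [e₂]; nlinarith
    have hdc : Continuous (fderiv ℝ φ₀) := hsec.smooth.continuous_fderiv (by norm_num)
    have hev : ∀ᶠ y in 𝓝 y₀, fderiv ℝ φ₀ y e₁ < 0 ∧ fderiv ℝ φ₀ y e₂ < 0 := by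
      have c1 : Continuous (fun y => fderiv ℝ φ₀ y e₁) := hdc.clm_apply continuous_const
      have c2 : Continuous (fun y => fderiv ℝ φ₀ y e₂) := hdc.clm_apply continuous_const
      exact (c1.continuousAt.eventually_lt continuousAt_const hneg1).and
        (c2.continuousAt.eventually_lt continuousAt_const hneg2)
    obtain ⟨R, hR, hball⟩ := Metric.eventually_nhds_iff_ball.1 hev
    -- In a ball where the derivative of φ₀ along e is negative, the mean value theorem makes φ₀
    -- decrease along e, so the level c₀ is not reached.
    have key : ∀ e : E2, (∀ y ∈ ball y₀ R, fderiv ℝ φ₀ y e < 0) → ∀ y ∈ crossSection φ₀ c₀,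
        y ∈ ball y₀ R → ∀ s : ℝ, 0 ≤ s → y + s • e ∈ ball y₀ R → y + s • e ∈ crossSection φ₀ c₀ := by
      intro e he y hy hyB s hs hsB
      obtain ⟨z, hz, hzeq⟩ := domain_mvt (f := φ₀) (f' := fderiv ℝ φ₀) (s := ball y₀ R)
        (fun x _ => ((hsec.smooth.differentiable (by norm_num)) x).hasFDerivAt.hasFDerivWithinAt)
        (convex_ball y₀ R) hyB hsB
      have hzB : z ∈ ball y₀ R := (convex_ball y₀ R).segment_subset hyB hsB hz
      have h1 := he z hzB
      rw [add_sub_cancel_left, map_smul, smul_eq_mul] at hzeq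
      have h2 : φ₀ y < c₀ := hy
      show φ₀ (y + s • e) < c₀
      nlinarith
    refine ⟨R, A, hR, fun y hy hyB s hs => ⟨?_, ?_⟩⟩
    · rw [hA]; simp only [zero_smul, add_zero]
      exact key e₁ (fun y hy => (hball y hy).1) y hy hyB s hs
    · rw [hA]; simp only [zero_smul, zero_add]
      exact key e₂ (fun y hy => (hball y hy).2) y hy hyB s hs

/-- The two inward directions together with a small parallelogram of inward displacements. -/
lemma exists_inward_patch {φ₀ : E2 → ℝ} {c₀ : ℝ} (hsec : IsRegularSection φ₀ c₀) {y₀ : E2}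
    (hy₀ : y₀ ∈ closure (crossSection φ₀ c₀)) :
    ∃ (R ρ : ℝ) (A : (ℝ × ℝ) ≃L[ℝ] E2), 0 < R ∧ 0 < ρ ∧
      (∀ y ∈ crossSection φ₀ c₀, y ∈ ball y₀ R → ∀ s : ℝ, 0 ≤ s →
        (y + A (s, 0) ∈ ball y₀ R → y + A (s, 0) ∈ crossSection φ₀ c₀) ∧
        (y + A (0, s) ∈ ball y₀ R → y + A (0, s) ∈ crossSection φ₀ c₀)) ∧
      ∀ y ∈ crossSection φ₀ c₀, y ∈ ball y₀ (R / 2) → ∀ α ∈ Icc 0 ρ, ∀ β ∈ Icc 0 ρ,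
        y + A (α, β) ∈ crossSection φ₀ c₀ := by
  obtain ⟨R, A, hR, h⟩ := exists_inward_directions hsec hy₀
  obtain ⟨δ, hδ, hsmall⟩ : ∃ δ > 0, ∀ p : ℝ × ℝ, ‖p‖ < δ → ‖A p‖ < R / 2 := by
    have hc : Continuous (fun p => ‖A p‖) := A.continuous.norm
    have := (hc.tendsto 0).eventually_lt_const (u := R / 2) (by simp [hR])
    obtain ⟨δ, hδ, hb⟩ := Metric.eventually_nhds_iff.1 this
    exact ⟨δ, hδ, fun p hp => hb (by simpa using hp)⟩
  -- From the half ball, displacements shorter than R/2 remain in the ball of radius R, so one can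
  -- move by α along the first direction and then by β along the second.
  refine ⟨R, δ / 2, A, hR, by positivity, h, ?_⟩
  intro y hy hyB α hα β hβ
  have hin : ∀ p : ℝ × ℝ, ‖p‖ < δ → y + A p ∈ ball y₀ R := by
    intro p hp
    have h1 := hsmall p hp
    rw [mem_ball, dist_eq_norm] at hyB ⊢
    calc ‖y + A p - y₀‖ = ‖(y - y₀) + A p‖ := by congr 1; abel
      _ ≤ ‖y - y₀‖ + ‖A p‖ := norm_add_le _ _
      _ < R := by linarith
  have hyR : y ∈ ball y₀ R := ball_subset_ball (by linarith) hyB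
  have hn1 : ‖((α, 0) : ℝ × ℝ)‖ < δ := by
    rw [Prod.norm_def]; simp [abs_of_nonneg hα.1, hδ]; linarith [hα.2]
  have hn2 : ‖((α, β) : ℝ × ℝ)‖ < δ := by
    rw [Prod.norm_def]; simp [abs_of_nonneg hα.1, abs_of_nonneg hβ.1]
    constructor <;> linarith [hα.2, hβ.2]
  have h1 := (h y hy hyR α hα.1).1 (hin _ hn1)
  have e : y + A (α, β) = y + A (α, 0) + A (0, β) := by
    rw [add_assoc, ← map_add]; simp
  rw [e]
  exact (h _ h1 (hin _ hn1) β hβ.1).2 (by rw [← e]; exact hin _ hn2)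

end HeatCylinder

/-! ### A planar Gagliardo–Nirenberg inequality by the Loomis–Whitney method. -/

namespace HeatCylinder

open Filter Topology Metric

section Lintegral

variable {α : Type*} [MeasurableSpace α] {μ : Measure α}

lemma sq_lintegral_mul_le {f g : α → ℝ≥0∞} (hf : AEMeasurable f μ) (hg : AEMeasurable g μ) :
    (∫⁻ x, f x * g x ∂μ) ^ 2 ≤ (∫⁻ x, f x ^ 2 ∂μ) * ∫⁻ x, g x ^ 2 ∂μ := by
  have h := ENNReal.lintegral_mul_le_Lp_mul_Lq μ Real.HolderConjugate.two_two hf hg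
  simp only [Pi.mul_apply, ENNReal.rpow_two] at h
  calc (∫⁻ x, f x * g x ∂μ) ^ 2
      ≤ ((∫⁻ x, f x ^ 2 ∂μ) ^ (1 / 2 : ℝ) * (∫⁻ x, g x ^ 2 ∂μ) ^ (1 / 2 : ℝ)) ^ 2 := by gcongr
    _ = _ := by
      rw [mul_pow, ← ENNReal.rpow_mul_natCast, ← ENNReal.rpow_mul_natCast]
      norm_num

/-- Hölder with exponents 3/2 and 3, cubed so that all powers are integers. The weight enters only
through its L₃ norm, and the sixth power of g is what the planar inequality controls. -/
lemma cube_lintegral_mul_le {f g : α → ℝ≥0∞} (hf : AEMeasurable f μ) (hg : AEMeasurable g μ) :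
    (∫⁻ x, f x ^ 2 * g x ^ 2 ∂μ) ^ 3 ≤ (∫⁻ x, f x ^ 3 ∂μ) ^ 2 * ∫⁻ x, g x ^ 6 ∂μ := by
  have hpq : (3 / 2 : ℝ).HolderConjugate 3 := by
    rw [Real.holderConjugate_iff]; norm_num
  have h := ENNReal.lintegral_mul_le_Lp_mul_Lq μ hpq (hf.pow_const 2) (hg.pow_const 2)
  have e1 : ∀ x, (f x ^ 2) ^ (3 / 2 : ℝ) = f x ^ 3 := fun x => by
    rw [← ENNReal.rpow_natCast, ← ENNReal.rpow_natCast, ← ENNReal.rpow_mul]; norm_num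
  have e2 : ∀ x, (g x ^ 2) ^ (3 : ℝ) = g x ^ 6 := fun x => by
    rw [← ENNReal.rpow_natCast, ← ENNReal.rpow_natCast, ← ENNReal.rpow_mul]; norm_num
  simp only [Pi.mul_apply, e1, e2] at h
  calc (∫⁻ x, f x ^ 2 * g x ^ 2 ∂μ) ^ 3
      ≤ ((∫⁻ x, f x ^ 3 ∂μ) ^ (1 / (3 / 2) : ℝ) * (∫⁻ x, g x ^ 6 ∂μ) ^ (1 / 3 : ℝ)) ^ 3 := by
        gcongr
    _ = _ := by
      rw [mul_pow, ← ENNReal.rpow_mul_natCast, ← ENNReal.rpow_mul_natCast,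
        ← ENNReal.rpow_natCast (∫⁻ x, f x ^ 3 ∂μ)]
      norm_num

end Lintegral

/-- The two-dimensional Loomis–Whitney inequality along two independent directions. -/
lemma exists_loomisWhitney (A : (ℝ × ℝ) ≃L[ℝ] E2) :
    ∃ c : ℝ≥0∞, c ≠ ∞ ∧ ∀ Φ : E2 → ℝ≥0∞, Measurable Φ →
      ∫⁻ y, (∫⁻ s : ℝ, Φ (y + A (s, 0))) * (∫⁻ τ : ℝ, Φ (y + A (0, τ))) = c * (∫⁻ y, Φ y) ^ 2 := by
  -- Translating y by -s e₁ turns the product of line integrals into Φ(y) times the integral of Φ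
  -- over the whole plane in the oblique coordinates A; c is the Haar factor of that change of
  -- coordinates.
  have : (Measure.map A (volume : Measure (ℝ × ℝ))).IsAddHaarMeasure :=
    A.isAddHaarMeasure_map volume
  have hmap := Measure.isAddLeftInvariant_eq_smul (Measure.map A (volume : Measure (ℝ × ℝ)))
    (volume : Measure E2)
  set c := Measure.addHaarScalarFactor (Measure.map A (volume : Measure (ℝ × ℝ)))
    (volume : Measure E2)
  refine ⟨c, ENNReal.coe_ne_top, fun Φ hΦ => ?_⟩
  have hA : Measurable A := A.continuous.measurable
  have key : ∀ y, ∫⁻ s : ℝ, ∫⁻ τ : ℝ, Φ (y + A (s, τ)) = c * ∫⁻ x, Φ x := by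
    intro y
    have h1 : Measurable fun x => Φ (y + x) := hΦ.comp (measurable_const_add y)
    rw [← lintegral_prod (fun p : ℝ × ℝ => Φ (y + A p)) (h1.comp hA).aemeasurable,
      ← Measure.volume_eq_prod, ← lintegral_map h1 hA, hmap, lintegral_smul_measure,
      lintegral_add_left_eq_self]
    rfl
  have m0 : Measurable fun p : E2 × ℝ => Φ (p.1 + A (p.2, 0)) :=
    hΦ.comp (by fun_prop)
  have m0' : Measurable fun p : E2 × ℝ => Φ (p.1 + A (0, p.2)) :=
    hΦ.comp (by fun_prop)
  have e1 : ∀ y, (∫⁻ s : ℝ, Φ (y + A (s, 0))) * (∫⁻ τ : ℝ, Φ (y + A (0, τ))) =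
      ∫⁻ s : ℝ, Φ (y + A (s, 0)) * ∫⁻ τ : ℝ, Φ (y + A (0, τ)) := by
    intro y
    rw [lintegral_mul_const]
    exact m0.comp measurable_prodMk_left
  have mI : Measurable fun y : E2 => ∫⁻ τ : ℝ, Φ (y + A (0, τ)) :=
    Measurable.lintegral_prod_right m0'
  rw [lintegral_congr e1, lintegral_lintegral_swap (m0.mul (mI.comp measurable_fst)).aemeasurable]
  have e2 : ∀ s : ℝ, ∫⁻ y, Φ (y + A (s, 0)) * ∫⁻ τ : ℝ, Φ (y + A (0, τ)) =
      ∫⁻ y, Φ y * ∫⁻ τ : ℝ, Φ (y + A (-s, τ)) := by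
    intro s
    rw [← lintegral_add_right_eq_self (fun y => Φ y * ∫⁻ τ : ℝ, Φ (y + A (-s, τ))) (A (s, 0))]
    have h : ∀ (y : E2) (τ : ℝ), y + A (s, 0) + A (-s, τ) = y + A (0, τ) := fun y τ => by
      rw [add_assoc, ← map_add]; simp
    simp_rw [h]
  rw [lintegral_congr e2]
  have m3 : Measurable fun q : (ℝ × E2) × ℝ => Φ (q.1.2 + A (-q.1.1, q.2)) :=
    hΦ.comp (by fun_prop)
  rw [lintegral_lintegral_swap
    ((hΦ.comp measurable_snd).mul (Measurable.lintegral_prod_right m3)).aemeasurable]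
  have e3 : ∀ y, ∫⁻ s : ℝ, Φ y * ∫⁻ τ : ℝ, Φ (y + A (-s, τ)) = Φ y * (c * ∫⁻ x, Φ x) := by
    intro y
    have m4 : Measurable fun q : ℝ × ℝ => Φ (y + A (-q.1, q.2)) := hΦ.comp (by fun_prop)
    rw [lintegral_const_mul _ (Measurable.lintegral_prod_right m4)]
    rw [lintegral_neg_eq_self fun s : ℝ => ∫⁻ τ : ℝ, Φ (y + A (s, τ)), key]
  rw [lintegral_congr e3, lintegral_mul_const _ hΦ]
  ring

/-- A function vanishing at the right end of an interval is controlled by its derivative. -/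
lemma enorm_le_lintegral_enorm_deriv {f f' : ℝ → ℝ} (hf : ∀ s, HasDerivAt f (f' s) s)
    (hf' : Continuous f') {p q : ℝ} (hpq : p ≤ q) (hfq : f q = 0) :
    ‖f p‖ₑ ≤ ∫⁻ s in Ioc p q, ‖f' s‖ₑ := by
  have h := intervalIntegral.integral_eq_sub_of_hasDerivAt (fun s _ => hf s)
    (hf'.intervalIntegrable p q)
  rw [hfq, zero_sub, intervalIntegral.integral_of_le hpq] at h
  rw [← enorm_neg, ← h]
  exact enorm_integral_le_lintegral_enorm _

/-- The cube of a `C¹` function supported in a ball is controlled, at points of `D`, by an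
integral along the part in `D` of an inward ray. -/
lemma enorm_cube_le_lintegral_ray {D : Set E2} {y₀ : E2} {R : ℝ} {F : E2 → ℝ}
    (hF : ContDiff ℝ 1 F) (hsupp : ∀ y, y ∉ ball y₀ R → F y = 0) {e : E2} (he : e ≠ 0)
    {y : E2} (hray : ∀ s : ℝ, 0 ≤ s → y + s • e ∈ ball y₀ R → y + s • e ∈ D) :
    ‖F y‖ₑ ^ 3 ≤ ∫⁻ s : ℝ, D.indicator
      (fun x => 3 * ‖F x‖ₑ ^ 2 * (‖fderiv ℝ F x‖ₑ * ‖e‖ₑ)) (y + s • e) := by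
  have hFd : ∀ x, HasFDerivAt F (fderiv ℝ F x) x := fun x =>
    (hF.differentiable (by norm_num) x).hasFDerivAt
  -- Integrate the derivative of F³ along the ray up to a point outside the ball, where F vanishes.
  -- Points of the ray inside the ball lie in D; the others contribute nothing.
  have hd : ∀ s : ℝ, HasDerivAt (fun s : ℝ => F (y + s • e) ^ 3)
      (3 * F (y + s • e) ^ 2 * (fderiv ℝ F (y + s • e) e)) s := by
    intro s
    have h1 : HasDerivAt (fun s : ℝ => y + s • e) e s := by
      simpa using ((hasDerivAt_id s).smul_const e).const_add y
    have h2 := ((hFd (y + s • e)).comp_hasDerivAt s h1).pow 3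
    simp only [Nat.cast_ofNat, Nat.add_one_sub_one] at h2
    exact h2
  have hcont : Continuous fun s : ℝ => 3 * F (y + s • e) ^ 2 * (fderiv ℝ F (y + s • e) e) := by
    have h1 := hF.continuous
    have h2 := hF.continuous_fderiv (by norm_num)
    have h3 : Continuous fun s : ℝ => y + s • e := by fun_prop
    exact (continuous_const.mul ((h1.comp h3).pow 2)).mul ((h2.comp h3).clm_apply continuous_const)
  obtain ⟨T, hT, hTb⟩ : ∃ T : ℝ, 0 ≤ T ∧ y + T • e ∉ ball y₀ R := by
    have hepos : 0 < ‖e‖ := norm_pos_iff.2 he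
    refine ⟨(|R| + ‖y - y₀‖) / ‖e‖, by positivity, fun h => ?_⟩
    rw [mem_ball, dist_eq_norm] at h
    have h1 : ‖((|R| + ‖y - y₀‖) / ‖e‖) • e‖ = |R| + ‖y - y₀‖ := by
      rw [norm_smul, Real.norm_eq_abs, abs_of_nonneg (by positivity), div_mul_cancel₀ _ hepos.ne']
    have h2 : ‖((|R| + ‖y - y₀‖) / ‖e‖) • e‖ ≤
        ‖y + ((|R| + ‖y - y₀‖) / ‖e‖) • e - y₀‖ + ‖y - y₀‖ := by
      calc _ = ‖(y + ((|R| + ‖y - y₀‖) / ‖e‖) • e - y₀) - (y - y₀)‖ := by congr 1; abel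
        _ ≤ _ := norm_sub_le _ _
    linarith [le_abs_self R]
  have h := enorm_le_lintegral_enorm_deriv hd hcont hT (by simp [hsupp _ hTb])
  simp only [zero_smul, add_zero, enorm_pow] at h
  refine h.trans ?_
  refine le_trans ?_ (setLIntegral_le_lintegral (Ioc 0 T) _)
  refine setLIntegral_mono_ae' measurableSet_Ioc (Eventually.of_forall fun s hs => ?_)
  by_cases hb : y + s • e ∈ ball y₀ R
  · rw [indicator_of_mem (hray s hs.1.le hb), enorm_mul, enorm_mul, enorm_pow]
    have h3 : ‖(3 : ℝ)‖ₑ = 3 := by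
      rw [Real.enorm_of_nonneg (by norm_num)]; norm_num
    rw [h3]
    gcongr
    exact ContinuousLinearMap.le_opENorm _ _
  · rw [hsupp _ hb]; simp

lemma lintegral_enorm_pow_lt_top {y₀ : E2} {R : ℝ} {F : E2 → ℝ} (hF : Continuous F)
    (hsupp : ∀ y, y ∉ ball y₀ R → F y = 0) (n : ℕ) (hn : n ≠ 0) :
    ∫⁻ y, ‖F y‖ₑ ^ n < ∞ := by
  have hcs : HasCompactSupport fun y => F y ^ n := by
    refine HasCompactSupport.intro (isCompact_closedBall y₀ R) fun y hy => ?_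
    rw [hsupp y fun h => hy (ball_subset_closedBall h), zero_pow hn]
  have hc : Continuous fun y => F y ^ n := hF.pow n
  have h4 := (hc.integrable_of_hasCompactSupport (μ := volume) hcs).hasFiniteIntegral
  rw [hasFiniteIntegral_iff_enorm] at h4
  simpa only [enorm_pow] using h4

/-- A Gagliardo–Nirenberg inequality on the part in `D` of a ball in which `D` admits two
independent inward directions. -/
lemma exists_ladyzhenskaya {D : Set E2} (hD : MeasurableSet D) {y₀ : E2} {R : ℝ}
    (A : (ℝ × ℝ) ≃L[ℝ] E2)
    (hray : ∀ y ∈ D, y ∈ ball y₀ R → ∀ s : ℝ, 0 ≤ s →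
        (y + A (s, 0) ∈ ball y₀ R → y + A (s, 0) ∈ D) ∧
        (y + A (0, s) ∈ ball y₀ R → y + A (0, s) ∈ D)) :
    ∃ C : ℝ≥0∞, C ≠ ∞ ∧ ∀ F : E2 → ℝ, ContDiff ℝ 1 F → (∀ y, y ∉ ball y₀ R → F y = 0) →
      ∫⁻ y in D, ‖F y‖ₑ ^ 6 ≤
        C * (∫⁻ y in D, ‖F y‖ₑ ^ 2) * (∫⁻ y in D, ‖fderiv ℝ F y‖ₑ ^ 2) ^ 2 := by
  obtain ⟨c, hc, hLW⟩ := exists_loomisWhitney A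
  set e₁ : E2 := A (1, 0) with he₁
  set e₂ : E2 := A (0, 1) with he₂
  have hs1 : ∀ s : ℝ, A (s, 0) = s • e₁ := fun s => by rw [he₁, ← map_smul]; simp
  have hs2 : ∀ s : ℝ, A (0, s) = s • e₂ := fun s => by rw [he₂, ← map_smul]; simp
  have ne1 : e₁ ≠ 0 := by simp [he₁]
  have ne2 : e₂ ≠ 0 := by simp [he₂]
  set m : ℝ≥0∞ := 3 * (‖e₁‖ₑ + ‖e₂‖ₑ) with hm
  have hmtop : m ≠ ∞ := by simp [hm, ENNReal.mul_eq_top]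
  -- Multiplying the bounds for |F|³ along the two directions and integrating gives S ≤ c(∫Φ)² ≤ c
  -- m² Q G. With Q² ≤ A2·S, obtained from F⁴ = F·F³, this becomes S² ≤ (c m²)² A2 G² S.
  refine ⟨(c * m ^ 2) ^ 2, by finiteness, fun F hF hsupp => ?_⟩
  have hFc := hF.continuous
  have hF'c := hF.continuous_fderiv (by norm_num)
  have mF : Measurable fun x => ‖F x‖ₑ := hFc.enorm.measurable
  have mF' : Measurable fun x => ‖fderiv ℝ F x‖ₑ := hF'c.enorm.measurable
  set Φ : E2 → ℝ≥0∞ := D.indicator fun x => m * (‖F x‖ₑ ^ 2 * ‖fderiv ℝ F x‖ₑ) with hΦ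
  have mΦ : Measurable Φ := Measurable.indicator (by fun_prop) hD
  set S := ∫⁻ y in D, ‖F y‖ₑ ^ 6
  set A2 := ∫⁻ y in D, ‖F y‖ₑ ^ 2
  set G := ∫⁻ y in D, ‖fderiv ℝ F y‖ₑ ^ 2
  set Q := ∫⁻ y in D, ‖F y‖ₑ ^ 4
  have hpt : ∀ e : E2, e ≠ 0 → ‖e‖ₑ ≤ ‖e₁‖ₑ + ‖e₂‖ₑ →
      (∀ y ∈ D, y ∈ ball y₀ R → ∀ s : ℝ, 0 ≤ s → y + s • e ∈ ball y₀ R → y + s • e ∈ D) →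
      ∀ y ∈ D, ‖F y‖ₑ ^ 3 ≤ ∫⁻ s : ℝ, Φ (y + s • e) := by
    intro e hne hle he y hy
    by_cases hyB : y ∈ ball y₀ R
    · refine (enorm_cube_le_lintegral_ray hF hsupp hne (he y hy hyB)).trans ?_
      refine lintegral_mono fun s => ?_
      refine indicator_le_indicator ?_
      calc 3 * ‖F (y + s • e)‖ₑ ^ 2 * (‖fderiv ℝ F (y + s • e)‖ₑ * ‖e‖ₑ)
          = 3 * ‖e‖ₑ * (‖F (y + s • e)‖ₑ ^ 2 * ‖fderiv ℝ F (y + s • e)‖ₑ) := by ring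
        _ ≤ _ := by rw [hm]; gcongr
    · simp [hsupp y hyB]
  have h1 : S ≤ c * (∫⁻ y, Φ y) ^ 2 := by
    rw [← hLW Φ mΦ]
    calc S ≤ ∫⁻ y in D, (∫⁻ s : ℝ, Φ (y + A (s, 0))) * (∫⁻ τ : ℝ, Φ (y + A (0, τ))) := by
          refine setLIntegral_mono' hD fun y hy => ?_
          have a1 := hpt e₁ ne1 le_self_add
            (fun y hy hb s hs h => by rw [← hs1] at h ⊢; exact (hray y hy hb s hs).1 h) y hy
          have a2 := hpt e₂ ne2 le_add_self
            (fun y hy hb s hs h => by rw [← hs2] at h ⊢; exact (hray y hy hb s hs).2 h) y hy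
          simp_rw [hs1, hs2]
          calc ‖F y‖ₑ ^ 6 = ‖F y‖ₑ ^ 3 * ‖F y‖ₑ ^ 3 := by ring
            _ ≤ _ := by gcongr
      _ ≤ _ := setLIntegral_le_lintegral _ _
  have h2 : (∫⁻ y, Φ y) ^ 2 ≤ m ^ 2 * (Q * G) := by
    rw [hΦ, lintegral_indicator hD, lintegral_const_mul _ (by fun_prop), mul_pow]
    gcongr
    have h := sq_lintegral_mul_le (μ := volume.restrict D) (f := fun y => ‖F y‖ₑ ^ 2)
      (g := fun y => ‖fderiv ℝ F y‖ₑ) (by fun_prop) (by fun_prop)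
    simp_rw [← pow_mul] at h
    exact h
  have h3 : Q ^ 2 ≤ A2 * S := by
    have := sq_lintegral_mul_le (μ := volume.restrict D) (f := fun y => ‖F y‖ₑ)
      (g := fun y => ‖F y‖ₑ ^ 3) (by fun_prop) (by fun_prop)
    have e1 : ∀ y, ‖F y‖ₑ * ‖F y‖ₑ ^ 3 = ‖F y‖ₑ ^ 4 := fun y => by ring
    have e2 : ∀ y, (‖F y‖ₑ ^ 3) ^ 2 = ‖F y‖ₑ ^ 6 := fun y => by ring
    simp_rw [e1, e2] at this
    exact this
  -- Compact support makes S finite, so a factor S may be cancelled.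
  have hS : S ≠ ∞ :=
    ((setLIntegral_le_lintegral D _).trans_lt (lintegral_enorm_pow_lt_top hFc hsupp 6 (by norm_num))).ne
  have h5 : S * S ≤ ((c * m ^ 2) ^ 2 * A2 * G ^ 2) * S := by
    calc S * S = S ^ 2 := by ring
      _ ≤ (c * (m ^ 2 * (Q * G))) ^ 2 := by gcongr; exact h1.trans (by gcongr)
      _ = (c * m ^ 2) ^ 2 * G ^ 2 * Q ^ 2 := by ring
      _ ≤ (c * m ^ 2) ^ 2 * G ^ 2 * (A2 * S) := by gcongr
      _ = _ := by ring
  by_cases hS0 : S = 0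
  · rw [hS0]; exact zero_le
  · exact (ENNReal.mul_le_mul_iff_left hS0 hS).1 h5

/-- Young's inequality in the form used to absorb the gradient. -/
lemma le_add_of_pow_six_le {T x y δ K C : ℝ≥0∞} (h : T ^ 6 ≤ C * y * x ^ 5) (hC : C ≤ δ ^ 5 * K) :
    T ≤ δ * x + K * y := by
  refine (ENNReal.pow_le_pow_left_iff (n := 6) (by norm_num)).1 (h.trans ?_)
  calc C * y * x ^ 5 ≤ δ ^ 5 * K * y * x ^ 5 := by gcongr
    _ = (δ * x) ^ 5 * (K * y) := by ring
    _ ≤ (δ * x + K * y) ^ 5 * (δ * x + K * y) := by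
        gcongr
        · exact le_self_add
        · exact le_add_self
    _ = _ := by ring

end HeatCylinder

/-! ### Weighted bottom trace for functions supported over a small ball. -/

namespace HeatCylinder

open Filter Topology Metric

lemma contDiff_slice {W : E3 → ℝ} (hW : ContDiff ℝ 1 W) (z : ℝ) :
    ContDiff ℝ 1 fun y : E2 => W (lift y z) := by
  have : ContDiff ℝ 1 fun y : E2 => liftEquiv (y, z) :=
    liftEquiv.contDiff.comp (contDiff_id.prodMk contDiff_const)
  exact ContDiff.comp (g := W) hW this

lemma hasFDerivAt_slice {W : E3 → ℝ} (hW : ContDiff ℝ 1 W) (z : ℝ) (y : E2) :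
    HasFDerivAt (fun y : E2 => W (lift y z)) ((fderiv ℝ W (lift y z)).comp
      ((liftEquiv : (E2 × ℝ) →L[ℝ] E3).comp (ContinuousLinearMap.inl ℝ E2 ℝ))) y := by
  have h1 : HasFDerivAt (fun y : E2 => liftEquiv (y, z))
      ((liftEquiv : (E2 × ℝ) →L[ℝ] E3).comp (ContinuousLinearMap.inl ℝ E2 ℝ)) y :=
    (liftEquiv.hasFDerivAt (x := (y, z))).comp y (hasFDerivAt_prodMk_left y z)
  have h2 := (hW.differentiable (by norm_num) (lift y z)).hasFDerivAt
  exact HasFDerivAt.comp (g := W) y h2 h1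

lemma hasDerivAt_vertical {W : E3 → ℝ} (hW : ContDiff ℝ 1 W) (y : E2) (z : ℝ) :
    HasDerivAt (fun z => W (lift y z))
      (fderiv ℝ W (lift y z) ((liftEquiv : (E2 × ℝ) →L[ℝ] E3) (0, 1))) z := by
  have h1 : HasDerivAt (fun z : ℝ => liftEquiv (y, z))
      ((liftEquiv : (E2 × ℝ) →L[ℝ] E3) (0, 1)) z :=
    (liftEquiv.hasFDerivAt (x := (y, z))).comp_hasDerivAt z
      ((hasDerivAt_const z y).prodMk (hasDerivAt_id z))
  have h2 := (hW.differentiable (by norm_num) (lift y z)).hasFDerivAt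
  exact HasFDerivAt.comp_hasDerivAt (l := W) z h2 h1

/-- The bottom trace of a `C¹` function supported in a cylinder over a ball in which the section
admits two independent inward directions. -/
lemma exists_trace_of_support {φ₀ : E2 → ℝ} {c₀ a : ℝ} (hφ : Continuous φ₀) (ha : 0 < a)
    {y₀ : E2} {R : ℝ} (A : (ℝ × ℝ) ≃L[ℝ] E2)
    (hray : ∀ y ∈ crossSection φ₀ c₀, y ∈ ball y₀ R → ∀ s : ℝ, 0 ≤ s →
        (y + A (s, 0) ∈ ball y₀ R → y + A (s, 0) ∈ crossSection φ₀ c₀) ∧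
        (y + A (0, s) ∈ ball y₀ R → y + A (0, s) ∈ crossSection φ₀ c₀))
    {δ : ℝ≥0∞} (hδ : δ ≠ 0) (hδ' : δ ≠ ∞) :
    ∃ K : ℝ≥0∞, K ≠ ∞ ∧ ∀ W : E3 → ℝ, ContDiff ℝ 1 W →
      (∀ y z, y ∉ ball y₀ R → W (lift y z) = 0) → (∀ y, W (lift y a) = 0) →
      ∀ d : E2 → ℝ≥0∞, Measurable d →
      ∫⁻ y in crossSection φ₀ c₀, d y * ‖W (lift y (-a))‖ₑ ^ 2 ≤
        δ * (∫⁻ x in cylinder φ₀ c₀ a, ‖fderiv ℝ W x‖ₑ ^ 2) +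
        K * ((∫⁻ y in crossSection φ₀ c₀, d y ^ 3) ^ 2 *
          ∫⁻ x in cylinder φ₀ c₀ a, ‖W x‖ₑ ^ 2) := by
  set D := crossSection φ₀ c₀ with hDdef
  have hD : MeasurableSet D := (isOpen_crossSection hφ).measurableSet
  obtain ⟨C, hC, hlady⟩ := exists_ladyzhenskaya hD A hray
  set L : (E2 × ℝ) →L[ℝ] E3 := (liftEquiv : (E2 × ℝ) →L[ℝ] E3) with hL
  have hLtop : ‖L‖ₑ ≠ ∞ := enorm_ne_top
  -- 64‖L‖⁶ is (2‖L‖)⁶ from the vertical derivative, ‖L‖⁴ comes from the squared gradient integral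
  -- of a slice, and δ⁵ from Young's inequality.
  refine ⟨(64 * C * ‖L‖ₑ ^ 10) / δ ^ 5, by finiteness, fun W hW hsupp htop d hd => ?_⟩
  have hWd : ∀ x, HasFDerivAt W (fderiv ℝ W x) x := fun x =>
    (hW.differentiable (by norm_num) x).hasFDerivAt
  have hWc := hW.continuous
  have hW'c := hW.continuous_fderiv (by norm_num)
  have hlift : Continuous fun p : E2 × ℝ => lift p.1 p.2 := liftEquiv.continuous
  have mW : Measurable fun p : E2 × ℝ => ‖W (lift p.1 p.2)‖ₑ := (hWc.comp hlift).enorm.measurable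
  have mW' : Measurable fun p : E2 × ℝ => ‖fderiv ℝ W (lift p.1 p.2)‖ₑ :=
    (hW'c.comp hlift).enorm.measurable
  -- the vertical derivative controls the value at the bottom
  have hvert : ∀ y, ‖W (lift y (-a))‖ₑ ^ 2 ≤ ∫⁻ z in Ioo (-a) a,
      2 * ‖L‖ₑ * (‖W (lift y z)‖ₑ * ‖fderiv ℝ W (lift y z)‖ₑ) := by
    intro y
    have hdz : ∀ z : ℝ, HasDerivAt (fun z => W (lift y z) ^ 2)
        (2 * W (lift y z) * fderiv ℝ W (lift y z) (L (0, 1))) z := by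
      intro z
      have h2 := (hasDerivAt_vertical hW y z).pow 2
      simp only [Nat.cast_ofNat, Nat.add_one_sub_one, pow_one] at h2
      exact h2
    have hzc : Continuous fun z : ℝ => lift y z := hlift.comp (Continuous.prodMk_right y)
    have hc : Continuous fun z => 2 * W (lift y z) * fderiv ℝ W (lift y z) (L (0, 1)) :=
      (continuous_const.mul (hWc.comp hzc)).mul ((hW'c.comp hzc).clm_apply continuous_const)
    have h := enorm_le_lintegral_enorm_deriv hdz hc (show -a ≤ a by linarith) (by simp [htop])
    rw [enorm_pow, setLIntegral_congr (Ioo_ae_eq_Ioc (μ := volume)).symm] at h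
    refine h.trans (lintegral_mono fun z => ?_)
    rw [enorm_mul, enorm_mul]
    have h2 : ‖(2 : ℝ)‖ₑ = 2 := by rw [Real.enorm_of_nonneg (by norm_num)]; norm_num
    have h3 : ‖fderiv ℝ W (lift y z) (L (0, 1))‖ₑ ≤ ‖fderiv ℝ W (lift y z)‖ₑ * ‖L‖ₑ := by
      refine (ContinuousLinearMap.le_opENorm _ _).trans ?_
      gcongr
      refine (ContinuousLinearMap.le_opENorm _ _).trans ?_
      have : ‖((0, 1) : E2 × ℝ)‖ₑ = 1 := by
        rw [← ofReal_norm, Prod.norm_def]; simp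
      rw [this, mul_one]
    rw [h2]
    calc _ ≤ 2 * ‖W (lift y z)‖ₑ * (‖fderiv ℝ W (lift y z)‖ₑ * ‖L‖ₑ) := by gcongr
      _ = _ := by ring
  -- the estimate on a horizontal slice
  have hslice : ∀ z, ∫⁻ y in D, d y * (2 * ‖L‖ₑ * (‖W (lift y z)‖ₑ * ‖fderiv ℝ W (lift y z)‖ₑ)) ≤
      δ * (∫⁻ y in D, ‖fderiv ℝ W (lift y z)‖ₑ ^ 2) +
      (64 * C * ‖L‖ₑ ^ 10) / δ ^ 5 *
        ((∫⁻ y in D, d y ^ 3) ^ 2 * ∫⁻ y in D, ‖W (lift y z)‖ₑ ^ 2) := by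
    intro z
    have hyc : Continuous fun y : E2 => lift y z := hlift.comp (Continuous.prodMk_left z)
    have mWz : Measurable fun y => ‖W (lift y z)‖ₑ := (hWc.comp hyc).enorm.measurable
    have mWz' : Measurable fun y => ‖fderiv ℝ W (lift y z)‖ₑ := (hW'c.comp hyc).enorm.measurable
    set F : E2 → ℝ := fun y => W (lift y z) with hF
    have hFd : ∀ y, HasFDerivAt F
        ((fderiv ℝ W (lift y z)).comp (L.comp (ContinuousLinearMap.inl ℝ E2 ℝ))) y :=
      hasFDerivAt_slice hW z
    have hFC : ContDiff ℝ 1 F := contDiff_slice hW z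
    set Gz := ∫⁻ y in D, ‖fderiv ℝ W (lift y z)‖ₑ ^ 2
    set Az := ∫⁻ y in D, ‖W (lift y z)‖ₑ ^ 2
    set N := ∫⁻ y in D, d y ^ 3
    have hG : ∫⁻ y in D, ‖fderiv ℝ F y‖ₑ ^ 2 ≤ ‖L‖ₑ ^ 2 * Gz := by
      rw [← lintegral_const_mul _ (by fun_prop)]
      refine lintegral_mono fun y => ?_
      rw [(hFd y).fderiv]
      have : ‖(fderiv ℝ W (lift y z)).comp (L.comp (ContinuousLinearMap.inl ℝ E2 ℝ))‖ₑ ≤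
          ‖L‖ₑ * ‖fderiv ℝ W (lift y z)‖ₑ := by
        rw [← ofReal_norm, ← ofReal_norm, ← ofReal_norm, ← ENNReal.ofReal_mul (norm_nonneg _)]
        refine ENNReal.ofReal_le_ofReal ?_
        refine (ContinuousLinearMap.opNorm_comp_le _ _).trans ?_
        rw [mul_comm]
        gcongr
        refine (ContinuousLinearMap.opNorm_comp_le _ _).trans ?_
        exact mul_le_of_le_one_right (norm_nonneg _) (ContinuousLinearMap.norm_inl_le_one ℝ E2 ℝ)
      calc _ ≤ (‖L‖ₑ * ‖fderiv ℝ W (lift y z)‖ₑ) ^ 2 := by gcongr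
        _ = _ := by rw [mul_pow]
    have hS := hlady F hFC fun y hy => hsupp y z hy
    refine le_add_of_pow_six_le (C := 64 * C * ‖L‖ₑ ^ 10) ?_ ?_
    -- Cauchy–Schwarz, Hölder with exponents 3/2 and 3, then the planar inequality on the slice. In
    -- the sixth power the gradient integral Gz appears to the power 3 + 2 = 5 and Az to the power
    -- 1, exactly the balance for Young's inequality.
    · have e1 : ∫⁻ y in D, d y * (2 * ‖L‖ₑ * (‖W (lift y z)‖ₑ * ‖fderiv ℝ W (lift y z)‖ₑ)) =
          2 * ‖L‖ₑ * ∫⁻ y in D, (d y * ‖W (lift y z)‖ₑ) * ‖fderiv ℝ W (lift y z)‖ₑ := by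
        rw [← lintegral_const_mul _ (by fun_prop)]
        refine lintegral_congr fun y => by ring
      have h1 := sq_lintegral_mul_le (μ := volume.restrict D) (f := fun y => d y * ‖W (lift y z)‖ₑ)
        (g := fun y => ‖fderiv ℝ W (lift y z)‖ₑ) (by fun_prop) (by fun_prop)
      have h2 := cube_lintegral_mul_le (μ := volume.restrict D) (f := d)
        (g := fun y => ‖W (lift y z)‖ₑ) (by fun_prop) (by fun_prop)
      simp_rw [mul_pow] at h1
      rw [e1, mul_pow]
      set T := ∫⁻ y in D, (d y * ‖W (lift y z)‖ₑ) * ‖fderiv ℝ W (lift y z)‖ₑ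
      set U := ∫⁻ y in D, d y ^ 2 * ‖W (lift y z)‖ₑ ^ 2
      calc (2 * ‖L‖ₑ) ^ 6 * T ^ 6 = (2 * ‖L‖ₑ) ^ 6 * (T ^ 2) ^ 3 := by ring
        _ ≤ (2 * ‖L‖ₑ) ^ 6 * (U * Gz) ^ 3 := by gcongr
        _ = (2 * ‖L‖ₑ) ^ 6 * (U ^ 3 * Gz ^ 3) := by ring
        _ ≤ (2 * ‖L‖ₑ) ^ 6 * ((N ^ 2 * (C * Az * (‖L‖ₑ ^ 2 * Gz) ^ 2)) * Gz ^ 3) := by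
          gcongr
          refine h2.trans ?_
          gcongr
          refine hS.trans ?_
          gcongr
        _ = _ := by ring
    · rw [ENNReal.mul_div_cancel (pow_ne_zero _ hδ) (ENNReal.pow_ne_top hδ')]
  have mdom : Measurable fun p : E2 × ℝ => d p.1 := hd.comp measurable_fst
  calc ∫⁻ y in D, d y * ‖W (lift y (-a))‖ₑ ^ 2
      ≤ ∫⁻ y in D, ∫⁻ z in Ioo (-a) a,
          d y * (2 * ‖L‖ₑ * (‖W (lift y z)‖ₑ * ‖fderiv ℝ W (lift y z)‖ₑ)) := by
        refine lintegral_mono fun y => ?_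
        rw [lintegral_const_mul]
        · gcongr; exact hvert y
        · exact (measurable_const.mul (mW.mul mW')).comp measurable_prodMk_left
    _ = ∫⁻ z in Ioo (-a) a, ∫⁻ y in D,
          d y * (2 * ‖L‖ₑ * (‖W (lift y z)‖ₑ * ‖fderiv ℝ W (lift y z)‖ₑ)) := by
        rw [lintegral_lintegral_swap]
        exact (mdom.mul (measurable_const.mul (mW.mul mW'))).aemeasurable
    _ ≤ ∫⁻ z in Ioo (-a) a, (δ * (∫⁻ y in D, ‖fderiv ℝ W (lift y z)‖ₑ ^ 2) +
          (64 * C * ‖L‖ₑ ^ 10) / δ ^ 5 *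
        ((∫⁻ y in D, d y ^ 3) ^ 2 * ∫⁻ y in D, ‖W (lift y z)‖ₑ ^ 2)) := lintegral_mono hslice
    _ = _ := by
        have m1 : Measurable fun z => ∫⁻ y in D, ‖fderiv ℝ W (lift y z)‖ₑ ^ 2 :=
          (mW'.pow_const 2).lintegral_prod_left
        have m2 : Measurable fun z => ∫⁻ y in D, ‖W (lift y z)‖ₑ ^ 2 :=
          (mW.pow_const 2).lintegral_prod_left
        rw [lintegral_add_left (m1.const_mul _), lintegral_const_mul _ m1,
          lintegral_const_mul _ (m2.const_mul _), lintegral_const_mul _ m2,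
          lintegral_cylinder (hW'c.enorm.measurable.pow_const 2),
          lintegral_cylinder (hWc.enorm.measurable.pow_const 2)]

end HeatCylinder

/-! ### Increments along inward displacements, bounded by the gradient. -/

namespace HeatCylinder

open Filter Topology Metric

lemma enorm_add_sq_le {E : Type*} [NormedAddCommGroup E] (x y : E) :
    ‖x + y‖ₑ ^ 2 ≤ 2 * ‖x‖ₑ ^ 2 + 2 * ‖y‖ₑ ^ 2 := by
  have h : ‖x + y‖ ^ 2 ≤ 2 * ‖x‖ ^ 2 + 2 * ‖y‖ ^ 2 := by
    have h1 := norm_add_le x y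
    have h2 := norm_nonneg (x + y)
    nlinarith [sq_nonneg (‖x‖ - ‖y‖)]
  have h' := ENNReal.ofReal_le_ofReal h
  rwa [ENNReal.ofReal_add (by positivity) (by positivity), ENNReal.ofReal_mul (by norm_num),
    ENNReal.ofReal_mul (by norm_num), ENNReal.ofReal_pow (norm_nonneg _),
    ENNReal.ofReal_pow (norm_nonneg _), ENNReal.ofReal_pow (norm_nonneg _), ofReal_norm,
    ofReal_norm, ofReal_norm, ENNReal.ofReal_ofNat] at h'

lemma enorm_sub_sq_le {E : Type*} [NormedAddCommGroup E] (x y : E) :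
    ‖x - y‖ₑ ^ 2 ≤ 2 * ‖x‖ₑ ^ 2 + 2 * ‖y‖ₑ ^ 2 := by
  simpa [sub_eq_add_neg] using enorm_add_sq_le x (-y)

lemma setLIntegral_comp_add_le {Ω S : Set E3} (hΩ : MeasurableSet Ω) {f : E3 → ℝ≥0∞}
    {q : E3} (hS : MeasurableSet S) (hq : ∀ x ∈ S, x + q ∈ Ω) :
    ∫⁻ x in S, f (x + q) ≤ ∫⁻ x in Ω, f x := by
  rw [← lintegral_indicator hΩ, ← lintegral_add_right_eq_self (Ω.indicator f) q]
  refine le_trans ?_ (setLIntegral_le_lintegral S _)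
  refine setLIntegral_mono' hS fun x hx => ?_
  rw [indicator_of_mem (hq x hx)]

/-- Fundamental theorem of calculus along the segment from x to x + q, followed by Cauchy–Schwarz on
the unit interval. -/
lemma enorm_sub_translate_sq_le {w : E3 → ℝ} (hw : ContDiff ℝ 1 w) (x q : E3) :
    ‖w x - w (x + q)‖ₑ ^ 2 ≤
      ∫⁻ τ in Ioc (0 : ℝ) 1, ‖q‖ₑ ^ 2 * ‖fderiv ℝ w (x + τ • q)‖ₑ ^ 2 := by
  have hwd : ∀ x, HasFDerivAt w (fderiv ℝ w x) x := fun x =>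
    (hw.differentiable (by norm_num) x).hasFDerivAt
  have hw'c := hw.continuous_fderiv (by norm_num)
  have hd : ∀ τ : ℝ, HasDerivAt (fun τ : ℝ => w (x + τ • q) - w (x + q))
      (fderiv ℝ w (x + τ • q) q) τ := by
    intro τ
    have h1 : HasDerivAt (fun τ : ℝ => x + τ • q) q τ := by
      simpa using ((hasDerivAt_id τ).smul_const q).const_add x
    exact ((hwd (x + τ • q)).comp_hasDerivAt τ h1).sub_const _
  have hlin : Continuous fun τ : ℝ => x + τ • q := by fun_prop
  have hc : Continuous fun τ : ℝ => fderiv ℝ w (x + τ • q) q :=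
    (hw'c.comp hlin).clm_apply continuous_const
  have hn : Continuous fun τ : ℝ => ‖fderiv ℝ w (x + τ • q)‖ₑ := (hw'c.comp hlin).enorm
  have h := enorm_le_lintegral_enorm_deriv hd hc zero_le_one (by simp)
  simp only [zero_smul, add_zero] at h
  have h2 : ∫⁻ τ in Ioc (0 : ℝ) 1, ‖fderiv ℝ w (x + τ • q) q‖ₑ ≤
      ∫⁻ τ in Ioc (0 : ℝ) 1, (‖q‖ₑ * ‖fderiv ℝ w (x + τ • q)‖ₑ) * 1 := by
    refine lintegral_mono fun τ => ?_
    rw [mul_one, mul_comm]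
    exact ContinuousLinearMap.le_opENorm _ _
  have h3 := sq_lintegral_mul_le (μ := volume.restrict (Ioc (0 : ℝ) 1))
    (f := fun τ => ‖q‖ₑ * ‖fderiv ℝ w (x + τ • q)‖ₑ) (g := fun _ => 1)
    (hn.measurable.const_mul _).aemeasurable aemeasurable_const
  calc ‖w x - w (x + q)‖ₑ ^ 2 ≤
      (∫⁻ τ in Ioc (0 : ℝ) 1, (‖q‖ₑ * ‖fderiv ℝ w (x + τ • q)‖ₑ) * 1) ^ 2 := by
        gcongr; exact h.trans h2
    _ ≤ _ := h3
    _ = _ := by simp [mul_pow]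

/-- Integrate the segment bound over S: each translate S + τq lies in Ω, so its gradient integral is
at most that over Ω. An increment is thus controlled without any contribution of the L₂ norm of w.
-/
lemma setLIntegral_sub_translate_le {Ω S : Set E3} (hΩ : MeasurableSet Ω) (hS : MeasurableSet S)
    {w : E3 → ℝ} (hw : ContDiff ℝ 1 w) {q : E3}
    (hq : ∀ x ∈ S, ∀ τ ∈ Icc (0 : ℝ) 1, x + τ • q ∈ Ω) :
    ∫⁻ x in S, ‖w x - w (x + q)‖ₑ ^ 2 ≤ ‖q‖ₑ ^ 2 * ∫⁻ x in Ω, ‖fderiv ℝ w x‖ₑ ^ 2 := by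
  have hw'c := hw.continuous_fderiv (by norm_num)
  have hm : Measurable fun x => ‖fderiv ℝ w x‖ₑ ^ 2 := hw'c.enorm.measurable.pow_const 2
  have hj : Measurable fun p : E3 × ℝ => ‖fderiv ℝ w (p.1 + p.2 • q)‖ₑ ^ 2 :=
    hm.comp (by fun_prop : Measurable fun p : E3 × ℝ => p.1 + p.2 • q)
  calc _ ≤ ∫⁻ x in S, ∫⁻ τ in Ioc (0 : ℝ) 1, ‖q‖ₑ ^ 2 * ‖fderiv ℝ w (x + τ • q)‖ₑ ^ 2 :=
        lintegral_mono fun x => enorm_sub_translate_sq_le hw x q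
    _ = ∫⁻ τ in Ioc (0 : ℝ) 1, ∫⁻ x in S, ‖q‖ₑ ^ 2 * ‖fderiv ℝ w (x + τ • q)‖ₑ ^ 2 :=
        lintegral_lintegral_swap (hj.const_mul _).aemeasurable
    _ ≤ ∫⁻ τ in Ioc (0 : ℝ) 1, ‖q‖ₑ ^ 2 * ∫⁻ x in Ω, ‖fderiv ℝ w x‖ₑ ^ 2 := by
        refine setLIntegral_mono' measurableSet_Ioc fun τ hτ => ?_
        have hjτ : Measurable fun x : E3 => ‖fderiv ℝ w (x + τ • q)‖ₑ ^ 2 :=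
          hm.comp (measurable_add_const _)
        rw [lintegral_const_mul _ hjτ]
        refine mul_le_mul_right ?_ _
        exact setLIntegral_comp_add_le hΩ hS fun x hx => hq x hx τ ⟨hτ.1.le, hτ.2⟩
    _ = _ := by simp

/-- Energy bounds for a localized increment. -/
lemma setLIntegral_localized_increment_le {Ω : Set E3} (hΩ : MeasurableSet Ω) {χ : E3 → ℝ}
    (hχ : ContDiff ℝ 1 χ) (hχ1 : ∀ x, ‖χ x‖ₑ ≤ 1) {L : ℝ≥0∞} (hL : ∀ x, ‖fderiv ℝ χ x‖ₑ ≤ L)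
    {w : E3 → ℝ} (hw : ContDiff ℝ 1 w) {q : E3}
    (hq : ∀ x ∈ Ω ∩ tsupport χ, ∀ τ ∈ Icc (0 : ℝ) 1, x + τ • q ∈ Ω) :
    (∫⁻ x in Ω, ‖fderiv ℝ (fun x => χ x * (w x - w (x + q))) x‖ₑ ^ 2 ≤
      (8 + 2 * L ^ 2 * ‖q‖ₑ ^ 2) * ∫⁻ x in Ω, ‖fderiv ℝ w x‖ₑ ^ 2) ∧
    ∫⁻ x in Ω, ‖χ x * (w x - w (x + q))‖ₑ ^ 2 ≤ 4 * ∫⁻ x in Ω, ‖w x‖ₑ ^ 2 := by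
  set S := Ω ∩ tsupport χ with hSdef
  have hS : MeasurableSet S := hΩ.inter (isClosed_tsupport χ).measurableSet
  have hw'c := hw.continuous_fderiv (by norm_num)
  have hq1 : ∀ x ∈ S, x + q ∈ Ω := fun x hx => by
    simpa using hq x hx 1 (by simp)
  have mw : Measurable fun x => ‖w x‖ₑ ^ 2 := hw.continuous.enorm.measurable.pow_const 2
  have mw' : Measurable fun x => ‖fderiv ℝ w x‖ₑ ^ 2 := hw'c.enorm.measurable.pow_const 2
  have hS' : S ⊆ Ω := inter_subset_left
  -- Off the support of χ the localized increment vanishes; on Ω ∩ tsupport χ the shifted points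
  -- stay in Ω.
  have split : ∀ f g : E3 → ℝ≥0∞, (∀ x, f x ≤ g x) → (∀ x, x ∉ tsupport χ → f x = 0) →
      ∫⁻ x in Ω, f x ≤ ∫⁻ x in S, g x := by
    intro f g hfg hf0
    rw [← lintegral_indicator hΩ, ← lintegral_indicator hS]
    refine lintegral_mono fun x => ?_
    by_cases hx : x ∈ Ω
    · by_cases hx' : x ∈ tsupport χ
      · rw [indicator_of_mem hx, indicator_of_mem (show x ∈ S from ⟨hx, hx'⟩)]; exact hfg x
      · rw [indicator_of_mem hx, hf0 x hx']; exact zero_le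
    · rw [indicator_of_notMem hx]; exact zero_le
  constructor
  · have hder : ∀ x, fderiv ℝ (fun x => χ x * (w x - w (x + q))) x =
        χ x • (fderiv ℝ w x - fderiv ℝ w (x + q)) + (w x - w (x + q)) • fderiv ℝ χ x := by
      intro x
      have h1 := (hχ.differentiable (by norm_num) x).hasFDerivAt
      have h2 := (hw.differentiable (by norm_num) x).hasFDerivAt
      have h3 : HasFDerivAt (fun x => w (x + q)) (fderiv ℝ w (x + q)) x :=
        (hasFDerivAt_comp_add_right q).2 (hw.differentiable (by norm_num) (x + q)).hasFDerivAt
      exact (h1.mul (h2.sub h3)).fderiv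
    have hpt : ∀ x, ‖fderiv ℝ (fun x => χ x * (w x - w (x + q))) x‖ₑ ^ 2 ≤
        (4 * ‖fderiv ℝ w x‖ₑ ^ 2 + 4 * ‖fderiv ℝ w (x + q)‖ₑ ^ 2) +
          2 * L ^ 2 * ‖w x - w (x + q)‖ₑ ^ 2 := by
      intro x
      rw [hder]
      refine (enorm_add_sq_le _ _).trans ?_
      rw [enorm_smul, enorm_smul]
      gcongr ?_ + ?_
      · calc 2 * (‖χ x‖ₑ * ‖fderiv ℝ w x - fderiv ℝ w (x + q)‖ₑ) ^ 2
            ≤ 2 * (1 * ‖fderiv ℝ w x - fderiv ℝ w (x + q)‖ₑ) ^ 2 := by gcongr; exact hχ1 x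
          _ ≤ 2 * (2 * ‖fderiv ℝ w x‖ₑ ^ 2 + 2 * ‖fderiv ℝ w (x + q)‖ₑ ^ 2) := by
            rw [one_mul]; gcongr; exact enorm_sub_sq_le _ _
          _ = _ := by ring
      · calc 2 * (‖w x - w (x + q)‖ₑ * ‖fderiv ℝ χ x‖ₑ) ^ 2
            ≤ 2 * (‖w x - w (x + q)‖ₑ * L) ^ 2 := by gcongr; exact hL x
          _ = _ := by ring
    have hz : ∀ x, x ∉ tsupport χ → ‖fderiv ℝ (fun x => χ x * (w x - w (x + q))) x‖ₑ ^ 2 = 0 := by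
      intro x hx
      have h1 : fderiv ℝ χ x = 0 := by
        by_contra h
        exact hx (support_fderiv_subset ℝ h)
      have h0 : fderiv ℝ (fun x => χ x * (w x - w (x + q))) x = 0 := by
        rw [hder, h1, image_eq_zero_of_notMem_tsupport hx, zero_smul, smul_zero, add_zero]
      rw [← ofReal_norm, h0, norm_zero, ENNReal.ofReal_zero, zero_pow two_ne_zero]
    refine (split _ _ hpt hz).trans ?_
    have m1 : Measurable fun x => 4 * ‖fderiv ℝ w x‖ₑ ^ 2 := mw'.const_mul 4
    have m2 : Measurable fun x => ‖fderiv ℝ w (x + q)‖ₑ ^ 2 := mw'.comp (measurable_add_const q)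
    have m3 : Measurable fun x => ‖w x - w (x + q)‖ₑ ^ 2 :=
      ((hw.continuous.sub (hw.continuous.comp (continuous_add_const q))).enorm.measurable).pow_const 2
    rw [lintegral_add_right _ (m3.const_mul _), lintegral_add_left m1, lintegral_const_mul _ mw',
      lintegral_const_mul _ m2, lintegral_const_mul _ m3]
    -- In the term containing ∇χ the increment is estimated by |q|²‖∇w‖², so the bound is
    -- proportional to the Dirichlet energy of w.
    calc _ ≤ 4 * (∫⁻ x in Ω, ‖fderiv ℝ w x‖ₑ ^ 2) + 4 * (∫⁻ x in Ω, ‖fderiv ℝ w x‖ₑ ^ 2) +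
        2 * L ^ 2 * (‖q‖ₑ ^ 2 * ∫⁻ x in Ω, ‖fderiv ℝ w x‖ₑ ^ 2) := by
          gcongr ?_ + ?_ + ?_
          · gcongr
          · exact mul_le_mul_right (setLIntegral_comp_add_le hΩ hS hq1) _
          · gcongr
            exact setLIntegral_sub_translate_le hΩ hS hw hq
      _ = _ := by ring
  · have hpt : ∀ x, ‖χ x * (w x - w (x + q))‖ₑ ^ 2 ≤ 2 * ‖w x‖ₑ ^ 2 + 2 * ‖w (x + q)‖ₑ ^ 2 := by
      intro x
      rw [enorm_mul]
      calc _ ≤ (1 * ‖w x - w (x + q)‖ₑ) ^ 2 := by gcongr; exact hχ1 x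
        _ ≤ _ := by rw [one_mul]; exact enorm_sub_sq_le _ _
    refine (split _ _ hpt fun x hx => ?_).trans ?_
    · rw [image_eq_zero_of_notMem_tsupport hx]; simp
    · have m2 : Measurable fun x => ‖w (x + q)‖ₑ ^ 2 := mw.comp (measurable_add_const q)
      rw [lintegral_add_left (mw.const_mul 2), lintegral_const_mul _ mw, lintegral_const_mul _ m2]
      calc _ ≤ 2 * (∫⁻ x in Ω, ‖w x‖ₑ ^ 2) + 2 * (∫⁻ x in Ω, ‖w x‖ₑ ^ 2) := by
            gcongr ?_ + ?_
            · gcongr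
            · exact mul_le_mul_right (setLIntegral_comp_add_le hΩ hS hq1) _
        _ = _ := by ring

end HeatCylinder

/-! ### The weighted trace inequality on the bottom of the cylinder. -/

namespace HeatCylinder

open Filter Topology Metric

/-- A cutoff function near a point of the bottom. -/
lemma exists_bottom_cutoff {a R : ℝ} (ha : 0 < a) (hR : 0 < R) (y₀ : E2) :
    ∃ χ : E3 → ℝ, ContDiff ℝ 1 χ ∧ (∀ x, ‖χ x‖ₑ ≤ 1) ∧ (∃ L : ℝ≥0∞, L ≠ ∞ ∧ ∀ x, ‖fderiv ℝ χ x‖ₑ ≤ L) ∧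
      (∀ y ∈ ball y₀ (R / 4), χ (lift y (-a)) = 1) ∧
      (∀ y z, lift y z ∈ tsupport χ → y ∈ ball y₀ (R / 2) ∧ z < 0 - a / 4) := by
  -- The outer radii R/3 and a/2 are chosen so that the closed support of the product still lies
  -- over the open ball of radius R/2 and strictly below height -a/4.
  let η : ContDiffBump y₀ := ⟨R / 4, R / 3, by positivity, by linarith⟩
  let ζ : ContDiffBump (-a) := ⟨a / 4, a / 2, by positivity, by linarith⟩
  let f : E2 × ℝ → ℝ := fun p => η p.1 * ζ p.2
  have hf : ContDiff ℝ 1 f := (η.contDiff.comp contDiff_fst).mul (ζ.contDiff.comp contDiff_snd)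
  let χ : E3 → ℝ := fun x => f (liftEquiv.symm x)
  have hlift : ∀ y z, liftEquiv.symm (lift y z) = (y, z) := fun y z => by
    rw [← liftEquiv_apply (y, z), ContinuousLinearEquiv.symm_apply_apply]
  have hχ : ContDiff ℝ 1 χ := hf.comp liftEquiv.symm.contDiff
  have hts : tsupport χ ⊆ liftEquiv.symm ⁻¹' (closedBall y₀ (R / 3) ×ˢ closedBall (-a) (a / 2)) := by
    refine closure_minimal ?_ ((isClosed_closedBall.prod isClosed_closedBall).preimage
      liftEquiv.symm.continuous)
    intro x hx
    have h1 : η (liftEquiv.symm x).1 * ζ (liftEquiv.symm x).2 ≠ 0 := hx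
    have h2 := left_ne_zero_of_mul h1
    have h3 := right_ne_zero_of_mul h1
    have h4 : (liftEquiv.symm x).1 ∈ Function.support η := h2
    have h5 : (liftEquiv.symm x).2 ∈ Function.support ζ := h3
    rw [η.support_eq] at h4
    rw [ζ.support_eq] at h5
    exact ⟨ball_subset_closedBall h4, ball_subset_closedBall h5⟩
  have hcs : HasCompactSupport χ := by
    refine IsCompact.of_isClosed_subset ?_ (isClosed_tsupport χ) hts
    exact liftEquiv.symm.toHomeomorph.isCompact_preimage.2
      ((isCompact_closedBall _ _).prod (isCompact_closedBall _ _))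
  refine ⟨χ, hχ, fun x => ?_, ?_, fun y hy => ?_, fun y z h => ?_⟩
  · rw [← ofReal_norm, ← ENNReal.ofReal_one]
    refine ENNReal.ofReal_le_ofReal ?_
    rw [Real.norm_eq_abs, abs_of_nonneg (mul_nonneg η.nonneg ζ.nonneg)]
    exact mul_le_one₀ η.le_one ζ.nonneg ζ.le_one
  · obtain ⟨C, hC⟩ := (hcs.fderiv (𝕜 := ℝ)).exists_bound_of_continuous (hχ.continuous_fderiv (by norm_num))
    refine ⟨ENNReal.ofReal C, ENNReal.ofReal_ne_top, fun x => ?_⟩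
    rw [← ofReal_norm]
    exact ENNReal.ofReal_le_ofReal (hC x)
  · show η (liftEquiv.symm (lift y (-a))).1 * ζ (liftEquiv.symm (lift y (-a))).2 = 1
    rw [hlift, η.one_of_mem_closedBall (ball_subset_closedBall hy),
      ζ.one_of_mem_closedBall (by simp [ζ]; positivity), one_mul]
  · have h1 := hts h
    rw [mem_preimage, hlift] at h1
    refine ⟨closedBall_subset_ball (by linarith) h1.1, ?_⟩
    have h2 : dist z (-a) ≤ a / 2 := h1.2
    rw [Real.dist_eq] at h2
    linarith [le_abs_self (z - -a)]

/-- Trace inequality near a point of the closure of the section. -/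
lemma exists_local_trace {φ₀ : E2 → ℝ} {c₀ a : ℝ} (hsec : IsRegularSection φ₀ c₀) (ha : 0 < a)
    {y₀ : E2} (hy₀ : y₀ ∈ closure (crossSection φ₀ c₀)) :
    ∃ r : ℝ, 0 < r ∧ ∀ δ : ℝ≥0∞, δ ≠ 0 → δ ≠ ∞ → ∃ K : ℝ≥0∞, K ≠ ∞ ∧
      ∀ w : E3 → ℝ, ContDiff ℝ 1 w → ∀ d : E2 → ℝ≥0∞, Measurable d →
      ∫⁻ y in crossSection φ₀ c₀ ∩ ball y₀ r, d y * ‖w (lift y (-a))‖ₑ ^ 2 ≤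
        δ * (∫⁻ x in cylinder φ₀ c₀ a, ‖fderiv ℝ w x‖ₑ ^ 2) +
        K * (((∫⁻ y in crossSection φ₀ c₀, d y ^ 3) ^ 2 + ∫⁻ y in crossSection φ₀ c₀, d y) *
          ∫⁻ x in cylinder φ₀ c₀ a, ‖w x‖ₑ ^ 2) := by
  have hφ := hsec.smooth.continuous
  set D := crossSection φ₀ c₀ with hDdef
  set Ω := cylinder φ₀ c₀ a with hΩdef
  have hD : MeasurableSet D := (isOpen_crossSection hφ).measurableSet
  have hΩ : MeasurableSet Ω := (isOpen_cylinder hφ).measurableSet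
  -- On the bottom near y₀, w equals χ(w - w(· + q)) + w(· + q) for every q in a box Q of inward
  -- displacements. The first summand falls under `exists_trace_of_support` and has energy bounded
  -- by ‖∇w‖²; the second is averaged over Q. Localizing by χw instead would leave a multiple of
  -- ‖w‖² that does not carry the weight d.
  obtain ⟨R, ρ, A, hR, hρ, hray, hbox⟩ := exists_inward_patch hsec hy₀
  obtain ⟨χ, hχ, hχ1, ⟨L, hLtop, hL⟩, hχeq, hχsupp⟩ := exists_bottom_cutoff ha hR y₀
  -- the box of inward displacements
  let J : ((ℝ × ℝ) × ℝ) ≃L[ℝ] E3 := (A.prodCongr (ContinuousLinearEquiv.refl ℝ ℝ)).trans liftEquiv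
  have hJ : ∀ p, J p = lift (A p.1) p.2 := fun p => rfl
  set B : Set ((ℝ × ℝ) × ℝ) := (Ioo 0 ρ ×ˢ Ioo 0 ρ) ×ˢ Ioo 0 (a / 4) with hB
  set Q : Set E3 := J '' B with hQ
  have hQo : IsOpen Q := J.toHomeomorph.isOpenMap _ ((isOpen_Ioo.prod isOpen_Ioo).prod isOpen_Ioo)
  have hQne : Q.Nonempty := by
    refine ⟨_, mem_image_of_mem J (show ((ρ / 2, ρ / 2), a / 8) ∈ B from ?_)⟩
    refine ⟨⟨⟨?_, ?_⟩, ⟨?_, ?_⟩⟩, ⟨?_, ?_⟩⟩ <;> simp <;> linarith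
  have hQb : Bornology.IsBounded Q := by
    refine (IsCompact.image ((isCompact_Icc.prod isCompact_Icc).prod isCompact_Icc)
      J.continuous).isBounded.subset (image_mono (t := (Icc 0 ρ ×ˢ Icc 0 ρ) ×ˢ Icc 0 (a / 4)) ?_)
    exact prod_mono (prod_mono Ioo_subset_Icc_self Ioo_subset_Icc_self) Ioo_subset_Icc_self
  have hQ0 : volume Q ≠ 0 := (hQo.measure_pos volume hQne).ne'
  have hQtop : volume Q ≠ ∞ := hQb.measure_lt_top.ne
  obtain ⟨M, hM⟩ : ∃ M : ℝ≥0∞, M ≠ ∞ ∧ ∀ q ∈ Q, ‖q‖ₑ ≤ M := by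
    obtain ⟨M, hM⟩ := hQb.exists_norm_le
    refine ⟨ENNReal.ofReal M, ENNReal.ofReal_ne_top, fun q hq => ?_⟩
    rw [← ofReal_norm]
    exact ENNReal.ofReal_le_ofReal (hM q hq)
  have hadd : ∀ (y y' : E2) (z z' : ℝ), lift y z + lift y' z' = lift (y + y') (z + z') := by
    intro y y' z z'
    exact (map_add liftEquiv (y, z) (y', z')).symm
  have hin : ∀ q ∈ Q, ∀ x ∈ Ω ∩ tsupport χ, ∀ τ ∈ Icc (0 : ℝ) 1, x + τ • q ∈ Ω := by
    rintro _ ⟨⟨⟨α, β⟩, γ⟩, ⟨⟨hα, hβ⟩, hγ⟩, rfl⟩ x ⟨hx, hxs⟩ τ hτ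
    obtain ⟨⟨y, z⟩, rfl⟩ := liftEquiv.surjective x
    rw [liftEquiv_apply] at hx hxs ⊢
    obtain ⟨hyD, hz⟩ := lift_mem_cylinder.1 hx
    obtain ⟨hyB, hz0⟩ := hχsupp y z hxs
    have e : τ • J ((α, β), γ) = lift (A (τ * α, τ * β)) (τ * γ) := by
      rw [← map_smul, hJ]; rfl
    simp only at hα hβ hγ hz hz0 ⊢
    rw [e, hadd, lift_mem_cylinder]
    refine ⟨hbox y hyD hyB _ ⟨by have := hα.1; have := hτ.1; positivity, ?_⟩ _
      ⟨by have := hβ.1; have := hτ.1; positivity, ?_⟩, ?_, ?_⟩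
    · nlinarith [hα.1, hα.2, hτ.1, hτ.2]
    · nlinarith [hβ.1, hβ.2, hτ.1, hτ.2]
    · nlinarith [hz.1, hγ.1, hτ.1]
    · nlinarith [hγ.1, hγ.2, hτ.1, hτ.2]
  have hinb : ∀ q ∈ Q, ∀ y ∈ D ∩ ball y₀ (R / 4), lift y (-a) + q ∈ Ω := by
    rintro _ ⟨⟨⟨α, β⟩, γ⟩, ⟨⟨hα, hβ⟩, hγ⟩, rfl⟩ y ⟨hyD, hyB⟩
    rw [hJ, hadd, lift_mem_cylinder]
    simp only at hα hβ hγ ⊢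
    refine ⟨hbox y hyD (ball_subset_ball (by linarith) hyB) _ (Ioo_subset_Icc_self hα) _
      (Ioo_subset_Icc_self hβ), ?_, ?_⟩ <;> linarith [hγ.1, hγ.2]
  refine ⟨R / 4, by positivity, fun δ hδ hδ' => ?_⟩
  -- c₁ bounds the growth of the Dirichlet energy from w to its localized increment. Using δ/(2c₁)
  -- in the trace bound leaves exactly δ after the factor 2 of (x + y)² ≤ 2x² + 2y².
  set c₁ : ℝ≥0∞ := 8 + 2 * L ^ 2 * M ^ 2 with hc₁
  have hc₁0 : c₁ ≠ 0 := by simp [hc₁]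
  have hMtop := hM.1
  have hc₁' : c₁ ≠ ∞ := by finiteness
  obtain ⟨K, hK, htr⟩ := exists_trace_of_support hφ ha A hray (δ := δ / (2 * c₁))
    (ENNReal.div_ne_zero.2 ⟨hδ, by finiteness⟩)
    (ENNReal.div_ne_top hδ' (by simp [hc₁0]))
  -- 8K is 2·4·K, with 4 from the L₂ bound of the increment; 2/|Q| comes from averaging the shifted
  -- value.
  refine ⟨8 * K + 2 / volume Q, by finiteness, fun w hw d hd => ?_⟩
  set G := ∫⁻ x in Ω, ‖fderiv ℝ w x‖ₑ ^ 2
  set A2 := ∫⁻ x in Ω, ‖w x‖ₑ ^ 2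
  set N := (∫⁻ y in D, d y ^ 3) ^ 2
  set d₁ := ∫⁻ y in D, d y
  set T := ∫⁻ y in D ∩ ball y₀ (R / 4), d y * ‖w (lift y (-a))‖ₑ ^ 2
  have hDB : MeasurableSet (D ∩ ball y₀ (R / 4)) := hD.inter measurableSet_ball
  have hwc := hw.continuous
  have hliftc : Continuous fun y : E2 => lift y (-a) :=
    liftEquiv.continuous.comp (Continuous.prodMk_left (-a))
  have hq : ∀ q ∈ Q, T ≤ (δ * G + 8 * K * (N * A2)) +
      2 * ∫⁻ y in D ∩ ball y₀ (R / 4), d y * ‖w (lift y (-a) + q)‖ₑ ^ 2 := by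
    intro q hqQ
    have mq : Measurable fun y : E2 => ‖w (lift y (-a) + q)‖ₑ :=
      (hwc.comp (hliftc.add continuous_const)).enorm.measurable
    have hW : ContDiff ℝ 1 fun x => χ x * (w x - w (x + q)) :=
      hχ.mul (hw.sub (hw.comp (contDiff_id.add contDiff_const)))
    have hout : ∀ y z, y ∉ ball y₀ (R / 2) ∨ ¬ z < 0 - a / 4 → χ (lift y z) = 0 := by
      intro y z h
      apply image_eq_zero_of_notMem_tsupport
      intro hm
      have := hχsupp y z hm
      tauto
    have h1 := htr _ hW
      (fun y z hy => by
        rw [hout y z (Or.inl fun h => hy (ball_subset_ball (by linarith) h)), zero_mul])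
      (fun y => by rw [hout y a (Or.inr (by linarith)), zero_mul]) d hd
    obtain ⟨h2, h3⟩ := setLIntegral_localized_increment_le hΩ hχ hχ1 hL hw (hin q hqQ)
    have mW : Measurable fun y : E2 =>
        ‖χ (lift y (-a)) * (w (lift y (-a)) - w (lift y (-a) + q))‖ₑ :=
      (hW.continuous.comp hliftc).enorm.measurable
    calc T ≤ ∫⁻ y in D ∩ ball y₀ (R / 4),
          (2 * (d y * ‖χ (lift y (-a)) * (w (lift y (-a)) - w (lift y (-a) + q))‖ₑ ^ 2) +
            2 * (d y * ‖w (lift y (-a) + q)‖ₑ ^ 2)) := by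
          refine setLIntegral_mono' hDB fun y hy => ?_
          rw [hχeq y hy.2, one_mul]
          have h4 := enorm_add_sq_le (w (lift y (-a)) - w (lift y (-a) + q)) (w (lift y (-a) + q))
          rw [sub_add_cancel] at h4
          calc _ ≤ d y * (2 * ‖w (lift y (-a)) - w (lift y (-a) + q)‖ₑ ^ 2 +
                2 * ‖w (lift y (-a) + q)‖ₑ ^ 2) := by gcongr
            _ = _ := by ring
      _ = 2 * (∫⁻ y in D ∩ ball y₀ (R / 4),
          d y * ‖χ (lift y (-a)) * (w (lift y (-a)) - w (lift y (-a) + q))‖ₑ ^ 2) +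
          2 * ∫⁻ y in D ∩ ball y₀ (R / 4), d y * ‖w (lift y (-a) + q)‖ₑ ^ 2 := by
          rw [lintegral_add_left (by fun_prop), lintegral_const_mul _ (by fun_prop),
            lintegral_const_mul _ (by fun_prop)]
      _ ≤ _ := by
          gcongr ?_ + _
          calc _ ≤ 2 * (δ / (2 * c₁) * (c₁ * G) + K * (N * (4 * A2))) := by
                refine mul_le_mul_right ?_ _
                refine (lintegral_mono_set inter_subset_left).trans (h1.trans ?_)
                gcongr
                refine h2.trans ?_
                rw [hc₁]
                gcongr
                exact hM.2 q hqQ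
            _ = (δ / (2 * c₁) * (2 * c₁)) * G + 8 * K * (N * A2) := by ring
            _ = _ := by
                rw [ENNReal.div_mul_cancel (by simp [hc₁0]) (by finiteness)]
  have hjm : Measurable fun p : E3 × E2 => d p.2 * ‖w (lift p.2 (-a) + p.1)‖ₑ ^ 2 := by
    have h1 : Measurable fun p : E3 × E2 => ‖w (lift p.2 (-a) + p.1)‖ₑ :=
      (hwc.comp ((hliftc.comp continuous_snd).add continuous_fst)).enorm.measurable
    exact (hd.comp measurable_snd).mul (h1.pow_const 2)
  -- Integrate over q ∈ Q. For fixed y the points (y, -a) + q stay in Ω, so the inner integral of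
  -- |w|² is at most the one over Ω, and only ∫d remains as weight.
  have hint : volume Q * T ≤ volume Q * (δ * G + 8 * K * (N * A2)) + 2 * (d₁ * A2) := by
    calc volume Q * T = ∫⁻ _ in Q, T := by rw [setLIntegral_const, mul_comm]
      _ ≤ ∫⁻ q in Q, ((δ * G + 8 * K * (N * A2)) +
          2 * ∫⁻ y in D ∩ ball y₀ (R / 4), d y * ‖w (lift y (-a) + q)‖ₑ ^ 2) :=
          setLIntegral_mono' hQo.measurableSet hq
      _ = volume Q * (δ * G + 8 * K * (N * A2)) +
          2 * ∫⁻ q in Q, ∫⁻ y in D ∩ ball y₀ (R / 4), d y * ‖w (lift y (-a) + q)‖ₑ ^ 2 := by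
          rw [lintegral_add_left measurable_const, setLIntegral_const, mul_comm (volume Q),
            lintegral_const_mul _ hjm.lintegral_prod_right]
      _ ≤ _ := by
          gcongr
          rw [lintegral_lintegral_swap hjm.aemeasurable]
          calc _ ≤ ∫⁻ y in D ∩ ball y₀ (R / 4), d y * A2 := by
                refine setLIntegral_mono' hDB fun y hy => ?_
                have m1 : Measurable fun q : E3 => ‖w (lift y (-a) + q)‖ₑ ^ 2 :=
                  (hwc.comp (continuous_const_add _)).enorm.measurable.pow_const 2
                rw [lintegral_const_mul _ m1]
                refine mul_le_mul_right ?_ _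
                have h5 := setLIntegral_comp_add_le (f := fun x => ‖w x‖ₑ ^ 2) hΩ
                  hQo.measurableSet (q := lift y (-a)) (fun q hqQ => by
                    rw [add_comm]; exact hinb q hqQ y hy)
                simpa only [add_comm] using h5
            _ ≤ ∫⁻ y in D, d y * A2 := lintegral_mono_set inter_subset_left
            _ = d₁ * A2 := lintegral_mul_const _ hd
  have hfin : T ≤ (δ * G + 8 * K * (N * A2)) + 2 / volume Q * (d₁ * A2) := by
    refine (ENNReal.mul_le_mul_iff_right hQ0 hQtop).1 (hint.trans (le_of_eq ?_))
    rw [mul_add _ (_ + _), ← mul_assoc (volume Q) (2 / volume Q), ENNReal.mul_div_cancel hQ0 hQtop]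
  refine hfin.trans ?_
  calc δ * G + 8 * K * (N * A2) + 2 / volume Q * (d₁ * A2)
      = δ * G + (8 * K * (N * A2) + 2 / volume Q * (d₁ * A2)) := by ring
    _ ≤ δ * G + ((8 * K + 2 / volume Q) * (N * A2) + (8 * K + 2 / volume Q) * (d₁ * A2)) := by
        gcongr
        · exact le_self_add
        · exact le_add_self
    _ = _ := by ring

/-- Trace inequality on the bottom of the cylinder with an unbounded weight. -/
lemma exists_trace {φ₀ : E2 → ℝ} {c₀ a : ℝ} (hsec : IsRegularSection φ₀ c₀) (ha : 0 < a)
    {δ : ℝ≥0∞} (hδ : δ ≠ 0) (hδ' : δ ≠ ∞) : ∃ K : ℝ≥0∞, K ≠ ∞ ∧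
      ∀ w : E3 → ℝ, ContDiff ℝ 1 w → ∀ d : E2 → ℝ≥0∞,
      AEMeasurable d (volume.restrict (crossSection φ₀ c₀)) →
      ∫⁻ y in crossSection φ₀ c₀, d y * ‖w (lift y (-a))‖ₑ ^ 2 ≤
        δ * (∫⁻ x in cylinder φ₀ c₀ a, ‖fderiv ℝ w x‖ₑ ^ 2) +
        K * (((∫⁻ y in crossSection φ₀ c₀, d y ^ 3) ^ 2 + ∫⁻ y in crossSection φ₀ c₀, d y) *
          ∫⁻ x in cylinder φ₀ c₀ a, ‖w x‖ₑ ^ 2) := by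
  have hcomp : IsCompact (closure (crossSection φ₀ c₀)) := hsec.bounded.isCompact_closure
  choose! r hr hloc using fun y₀ (hy₀ : y₀ ∈ closure (crossSection φ₀ c₀)) =>
    exists_local_trace hsec ha hy₀
  obtain ⟨t, ht, hcov⟩ := hcomp.elim_nhds_subcover (fun y => ball y (r y))
    (fun y hy => ball_mem_nhds y (hr y hy))
  have hn : (t.card : ℝ≥0∞) + 1 ≠ 0 := by simp
  have hn' : (t.card : ℝ≥0∞) + 1 ≠ ∞ := by finiteness
  -- The radii of the cover do not depend on δ, so the number of balls is known before δ is divided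
  -- among them; the summand 1 keeps the divisor nonzero.
  choose! K hK hKloc using fun y (hy : y ∈ closure (crossSection φ₀ c₀)) =>
    hloc y hy (δ / (t.card + 1)) (ENNReal.div_ne_zero.2 ⟨hδ, hn'⟩) (ENNReal.div_ne_top hδ' hn)
  refine ⟨∑ y ∈ t, K y, ENNReal.sum_ne_top.2 fun y hy => hK y (ht y hy), fun w hw d₀ hd₀ => ?_⟩
  wlog hd : Measurable d₀ generalizing d₀
  · have h := this (hd₀.mk d₀) hd₀.measurable_mk.aemeasurable hd₀.measurable_mk
    have e := hd₀.ae_eq_mk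
    have e1 : ∫⁻ y in crossSection φ₀ c₀, d₀ y * ‖w (lift y (-a))‖ₑ ^ 2 =
        ∫⁻ y in crossSection φ₀ c₀, hd₀.mk d₀ y * ‖w (lift y (-a))‖ₑ ^ 2 :=
      lintegral_congr_ae (e.mono fun y hy => by simp only [hy])
    have e2 : ∫⁻ y in crossSection φ₀ c₀, d₀ y ^ 3 = ∫⁻ y in crossSection φ₀ c₀, hd₀.mk d₀ y ^ 3 :=
      lintegral_congr_ae (e.mono fun y hy => by simp only [hy])
    rw [e1, e2, lintegral_congr_ae e]
    exact h
  set f : E2 → ℝ≥0∞ := fun y => d₀ y * ‖w (lift y (-a))‖ₑ ^ 2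
  set G := ∫⁻ x in cylinder φ₀ c₀ a, ‖fderiv ℝ w x‖ₑ ^ 2
  set Z := ((∫⁻ y in crossSection φ₀ c₀, d₀ y ^ 3) ^ 2 + ∫⁻ y in crossSection φ₀ c₀, d₀ y) *
          ∫⁻ x in cylinder φ₀ c₀ a, ‖w x‖ₑ ^ 2
  calc ∫⁻ y in crossSection φ₀ c₀, f y
      ≤ ∫⁻ y in ⋃ i : t, crossSection φ₀ c₀ ∩ ball i (r i), f y := by
        refine lintegral_mono_set fun y hy => ?_
        obtain ⟨i, hi, hyi⟩ := mem_iUnion₂.1 (hcov (subset_closure hy))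
        exact mem_iUnion.2 ⟨⟨i, hi⟩, hy, hyi⟩
    _ ≤ ∑ i ∈ t, ∫⁻ y in crossSection φ₀ c₀ ∩ ball i (r i), f y := by
        rw [← Finset.sum_coe_sort t
          fun i => ∫⁻ y in crossSection φ₀ c₀ ∩ ball i (r i), f y, ← tsum_fintype (L := .unconditional _)]
        exact lintegral_iUnion_le _ _
    _ ≤ ∑ i ∈ t, (δ / (t.card + 1) * G + K i * Z) :=
        Finset.sum_le_sum fun i hi => hKloc i (ht i hi) w hw d₀ hd
    _ = t.card * (δ / (t.card + 1)) * G + (∑ i ∈ t, K i) * Z := by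
        rw [Finset.sum_add_distrib, Finset.sum_const, nsmul_eq_mul, Finset.sum_mul]
        ring
    _ ≤ δ * G + (∑ i ∈ t, K i) * Z := by
        gcongr
        calc (t.card : ℝ≥0∞) * (δ / (t.card + 1)) ≤ (t.card + 1) * (δ / (t.card + 1)) := by
              gcongr; exact le_self_add
          _ = δ := ENNReal.mul_div_cancel hn hn'

end HeatCylinder

/-! ### Continuity of translations and mollification in L₂. -/

namespace HeatCylinder

open Filter Topology Metric

/-- Translations are continuous in `L^p`. -/
lemma tendsto_eLpNorm_translate {G F : Type*} [NormedAddCommGroup G] [MeasurableSpace G]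
    [BorelSpace G] [SecondCountableTopology G] [LocallyCompactSpace G] {μ : Measure G} [μ.IsAddHaarMeasure]
    [μ.InnerRegularCompactLTTop] [NormedAddCommGroup F]
    {p : ℝ≥0∞} [hp1 : Fact (1 ≤ p)] (hp : p ≠ ∞) {f : G → F} (hf : MemLp f p μ) :
    Tendsto (fun t : G => eLpNorm (fun x => f (x - t) - f x) p μ) (𝓝 0) (𝓝 0) := by
  -- Translations depend continuously on the shift in the compact-open topology, and composition of
  -- an L^p function with measure-preserving maps is continuous for that topology.
  let g : C(G, C(G, G)) := ContinuousMap.curry ⟨fun q : G × G => q.2 - q.1, by fun_prop⟩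
  have hg : ∀ t x, g t x = x - t := fun t x => rfl
  have hm : ∀ t, MeasurePreserving (g t) μ μ := fun t => measurePreserving_sub_right μ t
  have h := Filter.Tendsto.compMeasurePreservingLp (μ := μ) (ν := μ) (p := p)
    (tendsto_const_nhds (x := hf.toLp f)) (g.continuous.tendsto 0) hm (hm 0) hp
  have e0 : Lp.compMeasurePreserving (g 0) (hm 0) (hf.toLp f) = hf.toLp f := by
    apply Lp.ext
    refine (Lp.coeFn_compMeasurePreserving _ (hm 0)).trans ?_
    refine Eventually.of_forall fun x => ?_
    simp [hg]
  rw [e0, tendsto_iff_edist_tendsto_0] at h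
  refine h.congr fun t => ?_
  rw [Lp.edist_def]
  refine eLpNorm_congr_ae ?_
  have h1 := Lp.coeFn_compMeasurePreserving (hf.toLp f) (hm t)
  have h2 := hf.coeFn_toLp
  have h3 := (hm t).quasiMeasurePreserving.ae_eq_comp h2
  filter_upwards [h1, h2, h3] with x a1 a2 a3
  simp only [Pi.sub_apply, Function.comp_apply] at a1 a3 ⊢
  rw [a1, a2, a3, hg]

/-- Average of `f` against the kernel `k`. -/
noncomputable def mollify {F : Type*} [NormedAddCommGroup F] [NormedSpace ℝ F] (k : E3 → ℝ)
    (f : E3 → F) (x : E3) : F := ∫ t, k t • f (x - t)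

section Mollify

variable {F : Type*} [NormedAddCommGroup F] [NormedSpace ℝ F] {k : E3 → ℝ} {f : E3 → F}

lemma integrable_mollify (hk : Continuous k) (hkc : HasCompactSupport k)
    (hf : LocallyIntegrable f volume) (x : E3) : Integrable fun t => k t • f (x - t) := by
  have h := hkc.convolutionExists_left (L := ContinuousLinearMap.lsmul ℝ ℝ) (μ := volume) hk hf x
  exact h

/-- Averaging against a probability density preserves bounds; this carries sup bounds of a solution
over to its smooth approximations. -/
lemma norm_mollify_le (hk0 : ∀ t, 0 ≤ k t) (hki : Integrable k) (hk1 : ∫ t, k t = 1) {K : ℝ}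
    (hf : ∀ᵐ x, ‖f x‖ ≤ K) (x : E3) : ‖mollify k f x‖ ≤ K := by
  have hq : ∀ᵐ t, ‖f (x - t)‖ ≤ K :=
    (quasiMeasurePreserving_sub_left volume x).ae hf
  calc ‖mollify k f x‖ ≤ ∫ t, k t * K := by
        refine norm_integral_le_of_norm_le (hki.mul_const K) ?_
        filter_upwards [hq] with t ht
        rw [norm_smul, Real.norm_of_nonneg (hk0 t)]
        exact mul_le_mul_of_nonneg_left ht (hk0 t)
    _ = K := by rw [integral_mul_const, hk1, one_mul]

/-- Since k has mass one, the error is an average of the differences f(x - t) - f(x). Cauchy–Schwarz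
with k = √k·√k moves the square inside, and Tonelli exchanges x and t. -/
lemma lintegral_enorm_mollify_sub_sq_le [CompleteSpace F] (hk : Continuous k) (hkc : HasCompactSupport k)
    (hk0 : ∀ t, 0 ≤ k t) (hk1 : ∫ t, k t = 1) (hf : LocallyIntegrable f volume) :
    ∫⁻ x, ‖mollify k f x - f x‖ₑ ^ 2 ≤ ∫⁻ t, ‖k t‖ₑ * ∫⁻ x, ‖f (x - t) - f x‖ₑ ^ 2 := by
  have hki : Integrable k := hk.integrable_of_hasCompactSupport hkc
  have hk1' : ∫⁻ t, ‖k t‖ₑ = 1 := by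
    have : ∀ t, ‖k t‖ₑ = ENNReal.ofReal (k t) := fun t => Real.enorm_of_nonneg (hk0 t)
    simp_rw [this]
    rw [← ofReal_integral_eq_lintegral_ofReal hki (Eventually.of_forall hk0), hk1,
      ENNReal.ofReal_one]
  have hfm : AEStronglyMeasurable f volume := hf.aestronglyMeasurable
  have hjoint : AEStronglyMeasurable (fun p : E3 × E3 => f (p.1 - p.2) - f p.1)
      (volume.prod volume) :=
    (hfm.comp_quasiMeasurePreserving (quasiMeasurePreserving_sub volume volume)).sub
      (hfm.comp_quasiMeasurePreserving Measure.quasiMeasurePreserving_fst)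
  have hpt : ∀ᵐ x, ‖mollify k f x - f x‖ₑ ^ 2 ≤ ∫⁻ t, ‖k t‖ₑ * ‖f (x - t) - f x‖ₑ ^ 2 := by
    filter_upwards [hjoint.prodMk_left] with x hx
    have e : mollify k f x - f x = ∫ t, k t • (f (x - t) - f x) := by
      simp_rw [smul_sub]
      rw [integral_sub (integrable_mollify hk hkc hf x) (hki.smul_const _), integral_smul_const,
        hk1, one_smul]
      rfl
    rw [e]
    set r : E3 → ℝ≥0∞ := fun t => ‖k t‖ₑ ^ (1 / 2 : ℝ)
    have hr2 : ∀ t, r t * r t = ‖k t‖ₑ := fun t => by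
      rw [← ENNReal.rpow_add_of_nonneg _ _ (by norm_num) (by norm_num)]; norm_num
    have mr : Measurable r := hk.enorm.measurable.pow_const _
    calc ‖∫ t, k t • (f (x - t) - f x)‖ₑ ^ 2
        ≤ (∫⁻ t, r t * (r t * ‖f (x - t) - f x‖ₑ)) ^ 2 := by
          gcongr
          refine (enorm_integral_le_lintegral_enorm _).trans (le_of_eq (lintegral_congr fun t => ?_))
          rw [enorm_smul, ← hr2, mul_assoc]
      _ ≤ (∫⁻ t, r t ^ 2) * ∫⁻ t, (r t * ‖f (x - t) - f x‖ₑ) ^ 2 :=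
          sq_lintegral_mul_le mr.aemeasurable (mr.aemeasurable.mul hx.enorm)
      _ = _ := by
          simp_rw [mul_pow, pow_two, hr2]
          rw [hk1', one_mul]
  calc _ ≤ ∫⁻ x, ∫⁻ t, ‖k t‖ₑ * ‖f (x - t) - f x‖ₑ ^ 2 := lintegral_mono_ae hpt
    _ = ∫⁻ t, ∫⁻ x, ‖k t‖ₑ * ‖f (x - t) - f x‖ₑ ^ 2 := by
        rw [lintegral_lintegral_swap]
        exact ((hk.comp continuous_snd).enorm.measurable.aemeasurable).mul (hjoint.enorm.pow_const 2)
    _ = _ := by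
        refine lintegral_congr fun t => ?_
        rw [lintegral_const_mul' _ _ enorm_ne_top]

lemma eLpNorm_two_eq {α : Type*} [MeasurableSpace α] {μ : Measure α} {F : Type*}
    [NormedAddCommGroup F] (f : α → F) :
    eLpNorm f 2 μ = (∫⁻ x, ‖f x‖ₑ ^ 2 ∂μ) ^ (1 / 2 : ℝ) := by
  rw [eLpNorm_eq_lintegral_rpow_enorm_toReal (by norm_num) (by norm_num)]
  simp

lemma eLpNorm_two_sq {α : Type*} [MeasurableSpace α] {μ : Measure α} {F : Type*}
    [NormedAddCommGroup F] (f : α → F) :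
    eLpNorm f 2 μ ^ 2 = ∫⁻ x, ‖f x‖ₑ ^ 2 ∂μ := by
  rw [eLpNorm_two_eq, ← ENNReal.rpow_natCast, ← ENNReal.rpow_mul]
  norm_num

/-- Mollification converges in `L²` when the kernels concentrate at the origin. -/
lemma tendsto_eLpNorm_mollify_sub [CompleteSpace F] {k : ℕ → E3 → ℝ} (hk : ∀ n, Continuous (k n))
    (hkc : ∀ n, HasCompactSupport (k n)) (hk0 : ∀ n t, 0 ≤ k n t) (hk1 : ∀ n, ∫ t, k n t = 1)
    {r : ℕ → ℝ} (hr : Tendsto r atTop (𝓝 0)) (hks : ∀ n t, k n t ≠ 0 → ‖t‖ ≤ r n)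
    (hf : MemLp f 2 volume) :
    Tendsto (fun n => eLpNorm (fun x => mollify (k n) f x - f x) 2 volume) atTop (𝓝 0) := by
  have hω := tendsto_eLpNorm_translate (p := 2) (by norm_num) hf
  rw [ENNReal.tendsto_nhds_zero] at hω ⊢
  intro ε hε
  obtain ⟨δ, hδ, hb⟩ := Metric.eventually_nhds_iff.1 (hω ε hε)
  filter_upwards [hr.eventually_lt_const hδ] with n hn
  have hki : Integrable (k n) := (hk n).integrable_of_hasCompactSupport (hkc n)
  have hk1' : ∫⁻ t, ‖k n t‖ₑ = 1 := by
    have : ∀ t, ‖k n t‖ₑ = ENNReal.ofReal (k n t) := fun t => Real.enorm_of_nonneg (hk0 n t)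
    simp_rw [this]
    rw [← ofReal_integral_eq_lintegral_ofReal hki (Eventually.of_forall (hk0 n)), hk1,
      ENNReal.ofReal_one]
  refine (ENNReal.pow_le_pow_left_iff (n := 2) (by norm_num)).1 ?_
  rw [eLpNorm_two_sq]
  refine (lintegral_enorm_mollify_sub_sq_le (hk n) (hkc n) (hk0 n) (hk1 n)
    (hf.locallyIntegrable (by norm_num))).trans ?_
  calc _ ≤ ∫⁻ t, ‖k n t‖ₑ * ε ^ 2 := by
        refine lintegral_mono fun t => ?_
        by_cases ht : k n t = 0
        · simp [ht]
        · dsimp only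
          gcongr
          rw [← eLpNorm_two_sq]
          gcongr
          exact hb (by simpa using (hks n t ht).trans_lt hn)
    _ = ε ^ 2 := by
        rw [lintegral_mul_const _ (hk n).enorm.measurable, hk1', one_mul]

end Mollify

end HeatCylinder

/-! ### One-sided mollification of weakly differentiable functions. -/

namespace HeatCylinder

open Filter Topology Metric

lemma hasGradientAt_of_hasFDerivAt {f : E3 → ℝ} {L : E3 →L[ℝ] ℝ} {G x : E3}
    (h : HasFDerivAt f L x) (hG : ∀ v, inner ℝ G v = L v) : HasGradientAt f G x := by
  have e : L = InnerProductSpace.toDual ℝ E3 G := by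
    ext v
    rw [← hG v, InnerProductSpace.toDual_apply_apply]
  rw [e] at h
  exact hasGradientAt_iff_hasFDerivAt.2 h

lemma gradient_comp_sub_left {k : E3 → ℝ} (hk : Differentiable ℝ k) (x t : E3) :
    gradient (fun t => k (x - t)) t = -gradient k (x - t) := by
  apply HasGradientAt.gradient
  have h1 : HasFDerivAt (fun t : E3 => x - t) (-ContinuousLinearMap.id ℝ E3) t :=
    (hasFDerivAt_id t).const_sub x
  refine hasGradientAt_of_hasFDerivAt ((hk (x - t)).hasFDerivAt.comp t h1) fun v => ?_
  simp

lemma isTest_comp_sub_left {k : E3 → ℝ} (hk : IsTest k) (x : E3) : IsTest fun t => k (x - t) :=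
  ⟨hk.1.comp (contDiff_const.sub contDiff_id),
    hk.2.comp_homeomorph (Homeomorph.subLeft x)⟩

/-- One-sided mollifications of a weakly differentiable function. -/
lemma hasGradientAt_mollify {Ω : Set E3} (hΩ : MeasurableSet Ω) {u : E3 → ℝ} {g : E3 → E3}
    (hu : HasWeakGradient Ω u g) {k : E3 → ℝ} (hk : IsTest k) {x : E3}
    (hx : ∀ t ∈ tsupport k, x - t ∈ Ω) :
    HasGradientAt (mollify k (Ω.indicator u)) (mollify k (Ω.indicator g) x) x := by
  set f := Ω.indicator u with hf
  have hf2 : MemLp f 2 volume := (memLp_indicator_iff_restrict hΩ).2 hu.1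
  have hfl : LocallyIntegrable f volume := hf2.locallyIntegrable (by norm_num)
  have hk1 : ContDiff ℝ 1 k := hk.1.of_le (by exact_mod_cast le_top)
  have hkd : Differentiable ℝ k := hk1.differentiable (by norm_num)
  have h := hk.2.hasFDerivAt_convolution_left (ContinuousLinearMap.lsmul ℝ ℝ) hk1 hfl x
  rw [convolution_def] at h
  have e1 : ∀ t, ((ContinuousLinearMap.precompL E3 (ContinuousLinearMap.lsmul ℝ ℝ))
      (fderiv ℝ k t)) (f (x - t)) = InnerProductSpace.toDual ℝ E3 (f (x - t) • gradient k t) := by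
    intro t
    ext v
    simp [mul_comm]
  simp_rw [e1] at h
  let T : E3 →ₗᵢ[ℝ] (E3 →L[ℝ] ℝ) :=
    { toFun := fun x => InnerProductSpace.toDual ℝ E3 x
      map_add' := fun x y => map_add _ x y
      map_smul' := fun c x => by simp
      norm_map' := fun x => (InnerProductSpace.toDual ℝ E3).norm_map x }
  have e3 : ∫ t, InnerProductSpace.toDual ℝ E3 (f (x - t) • gradient k t) =
      InnerProductSpace.toDual ℝ E3 (∫ t, f (x - t) • gradient k t) :=
    T.integral_comp_comm fun t => f (x - t) • gradient k t
  rw [e3] at h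
  suffices hG : ∫ t, f (x - t) • gradient k t = mollify k (Ω.indicator g) x by
    rw [hG] at h
    exact hasGradientAt_iff_hasFDerivAt.2 h
  rw [← integral_sub_left_eq_self (fun t => f (x - t) • gradient k t) volume x]
  -- As x - supp k ⊆ Ω, the function t ↦ k(x - t) is admissible in the definition of the weak
  -- gradient. This moves the derivative from the kernel to u without seeing the jump of the
  -- extension by zero.
  have hψ : IsTest fun t => k (x - t) := isTest_comp_sub_left hk x
  have hts : tsupport (fun t => k (x - t)) ⊆ Ω := by
    intro s hs
    have h1 : x - s ∈ tsupport k := by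
      have : tsupport (fun t => k (x - t)) = (Homeomorph.subLeft x) ⁻¹' tsupport k :=
        tsupport_comp_eq_preimage k (Homeomorph.subLeft x)
      rw [this] at hs
      exact hs
    simpa using hx _ h1
  have h3 := hu.2.2 _ hψ hts
  have e2 : ∀ t, f (x - (x - t)) • gradient k (x - t) =
      Ω.indicator (fun t => -(u t • gradient (fun t => k (x - t)) t)) t := by
    intro t
    rw [sub_sub_cancel, hf]
    by_cases ht : t ∈ Ω
    · rw [indicator_of_mem ht, indicator_of_mem ht, gradient_comp_sub_left hkd, smul_neg, neg_neg]
    · rw [indicator_of_notMem ht, indicator_of_notMem ht, zero_smul]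
  simp_rw [e2]
  rw [integral_indicator hΩ, integral_neg, h3, neg_neg, mollify,
    ← integral_sub_left_eq_self (fun t => k t • Ω.indicator g (x - t)) volume x,
    ← integral_indicator hΩ]
  refine integral_congr_ae (Eventually.of_forall fun t => ?_)
  simp only [sub_sub_cancel]
  by_cases ht : t ∈ Ω
  · rw [indicator_of_mem ht, indicator_of_mem ht]
  · rw [indicator_of_notMem ht, indicator_of_notMem ht, smul_zero]

lemma contDiff_mollify {k : E3 → ℝ} (hk : IsTest k) {f : E3 → ℝ} (hf : LocallyIntegrable f volume) :
    ContDiff ℝ ((⊤ : ℕ∞) : WithTop ℕ∞) (mollify k f) :=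
  hk.2.contDiff_convolution_left (ContinuousLinearMap.lsmul ℝ ℝ) hk.1 hf

lemma isBounded_cylinder {φ₀ : E2 → ℝ} {c₀ a : ℝ} (hsec : IsRegularSection φ₀ c₀) :
    Bornology.IsBounded (cylinder φ₀ c₀ a) := by
  have h1 : IsCompact (liftEquiv '' (closure (crossSection φ₀ c₀) ×ˢ Icc (-a) a)) :=
    (hsec.bounded.isCompact_closure.prod isCompact_Icc).image liftEquiv.continuous
  refine h1.isBounded.subset fun x hx => ?_
  obtain ⟨⟨y, z⟩, rfl⟩ := liftEquiv.surjective x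
  obtain ⟨hy, hz⟩ := lift_mem_cylinder.1 hx
  exact mem_image_of_mem _ ⟨subset_closure hy, Ioo_subset_Icc_self hz⟩

/-- Near each point of the closure of the cylinder there is an open cone of inward displacements. -/
lemma exists_inward_ball {φ₀ : E2 → ℝ} {c₀ a : ℝ} (hsec : IsRegularSection φ₀ c₀) (ha : 0 < a)
    {x₀ : E3} (hx₀ : x₀ ∈ closure (cylinder φ₀ c₀ a)) :
    ∃ (R r : ℝ) (q₀ : E3), 0 < R ∧ 0 < r ∧ ∀ x ∈ cylinder φ₀ c₀ a, x ∈ ball x₀ R →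
      ∀ τ ∈ Ioc (0 : ℝ) 1, ∀ q ∈ closedBall q₀ r, x + τ • q ∈ cylinder φ₀ c₀ a := by
  obtain ⟨⟨y₀, z₀⟩, rfl⟩ := liftEquiv.surjective x₀
  have hproj : ∀ x ∈ cylinder φ₀ c₀ a, (liftEquiv.symm x).1 ∈ crossSection φ₀ c₀ := by
    intro x hx
    obtain ⟨⟨y, z⟩, rfl⟩ := liftEquiv.surjective x
    rw [ContinuousLinearEquiv.symm_apply_apply]
    exact (lift_mem_cylinder.1 hx).1
  have hy₀ : y₀ ∈ closure (crossSection φ₀ c₀) := by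
    have hc : Continuous fun x : E3 => (liftEquiv.symm x).1 :=
      continuous_fst.comp liftEquiv.symm.continuous
    have := map_mem_closure hc hx₀ hproj
    simpa only [ContinuousLinearEquiv.symm_apply_apply] using this
  obtain ⟨R, ρ, A, hR, hρ, -, hbox⟩ := exists_inward_patch hsec hy₀
  let J : ((ℝ × ℝ) × ℝ) ≃L[ℝ] E3 := (A.prodCongr (ContinuousLinearEquiv.refl ℝ ℝ)).trans liftEquiv
  have hJ : ∀ p, J p = lift (A p.1) p.2 := fun p => rfl
  have hadd : ∀ (y y' : E2) (z z' : ℝ), lift y z + lift y' z' = lift (y + y') (z + z') := by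
    intro y y' z z'
    exact (map_add liftEquiv (y, z) (y', z')).symm
  -- The vertical part of the displacement points away from the nearer end: upwards in the lower
  -- half, downwards in the upper half.
  obtain ⟨σ, hσ⟩ : ∃ σ : ℝ, (σ = 1 ∧ z₀ ≤ 0) ∨ (σ = -1 ∧ 0 ≤ z₀) := by
    rcases le_total z₀ 0 with h | h
    · exact ⟨1, Or.inl ⟨rfl, h⟩⟩
    · exact ⟨-1, Or.inr ⟨rfl, h⟩⟩
  set B : Set ((ℝ × ℝ) × ℝ) := (Ioo 0 ρ ×ˢ Ioo 0 ρ) ×ˢ ((fun γ => σ * γ) ⁻¹' Ioo 0 (a / 4)) with hB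
  have hBo : IsOpen B := (isOpen_Ioo.prod isOpen_Ioo).prod
    (isOpen_Ioo.preimage (continuous_const_mul σ))
  have hQo : IsOpen (J '' B) := J.toHomeomorph.isOpenMap _ hBo
  have hq₀ : J ((ρ / 2, ρ / 2), σ * (a / 8)) ∈ J '' B := by
    refine mem_image_of_mem J ⟨⟨⟨?_, ?_⟩, ⟨?_, ?_⟩⟩, ?_⟩
    · simp; linarith
    · simp; linarith
    · simp; linarith
    · simp; linarith
    · have : σ * (σ * (a / 8)) = a / 8 := by
        rcases hσ with ⟨rfl, -⟩ | ⟨rfl, -⟩ <;> ring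
      simp only [mem_preimage, this]
      exact ⟨by linarith, by linarith⟩
  obtain ⟨r, hr, hrB⟩ := nhds_basis_closedBall.mem_iff.1 (hQo.mem_nhds hq₀)
  have hU : IsOpen (liftEquiv.symm ⁻¹' (ball y₀ (R / 2) ×ˢ ball z₀ (a / 2))) :=
    (isOpen_ball.prod isOpen_ball).preimage liftEquiv.symm.continuous
  have hx₀U : liftEquiv (y₀, z₀) ∈ liftEquiv.symm ⁻¹' (ball y₀ (R / 2) ×ˢ ball z₀ (a / 2)) := by
    rw [mem_preimage, ContinuousLinearEquiv.symm_apply_apply]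
    exact ⟨mem_ball_self (by positivity), mem_ball_self (by positivity)⟩
  obtain ⟨R', hR', hball⟩ := Metric.isOpen_iff.1 hU _ hx₀U
  refine ⟨R', r, J ((ρ / 2, ρ / 2), σ * (a / 8)), hR', hr, fun x hx hxB τ hτ q hq => ?_⟩
  obtain ⟨⟨⟨α, β⟩, γ⟩, ⟨⟨hα, hβ⟩, hγ⟩, rfl⟩ := hrB hq
  obtain ⟨⟨y, z⟩, rfl⟩ := liftEquiv.surjective x
  have h1 := hball hxB
  rw [mem_preimage, ContinuousLinearEquiv.symm_apply_apply] at h1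
  obtain ⟨hyB, hzB⟩ := h1
  rw [liftEquiv_apply] at hx ⊢
  obtain ⟨hyD, hz⟩ := lift_mem_cylinder.1 hx
  have e : τ • J ((α, β), γ) = lift (A (τ * α, τ * β)) (τ * γ) := by
    rw [← map_smul, hJ]; rfl
  simp only [mem_preimage] at hα hβ hγ hz hzB hyB hyD ⊢
  rw [mem_ball, Real.dist_eq, abs_lt] at hzB
  rw [e, hadd, lift_mem_cylinder]
  have hτ0 := hτ.1
  have hτ1 := hτ.2
  refine ⟨hbox y hyD hyB _ ⟨by have := hα.1; positivity, ?_⟩ _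
    ⟨by have := hβ.1; positivity, ?_⟩, ?_⟩
  · nlinarith [hα.1, hα.2]
  · nlinarith [hβ.1, hβ.2]
  · rcases hσ with ⟨rfl, h0⟩ | ⟨rfl, h0⟩
    · refine ⟨?_, ?_⟩
      · nlinarith [hγ.1, hγ.2, hz.1]
      · nlinarith [hγ.1, hγ.2]
    · refine ⟨?_, ?_⟩
      · nlinarith [hγ.1, hγ.2]
      · nlinarith [hγ.1, hγ.2, hz.2]

/-- Mollifying kernels supported in a shrinking inward cone. -/
lemma exists_inward_kernels {q₀ : E3} {r : ℝ} (hr : 0 < r) :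
    ∃ k : ℕ → E3 → ℝ, (∀ n, IsTest (k n)) ∧ (∀ n t, 0 ≤ k n t) ∧ (∀ n, ∫ t, k n t = 1) ∧
      (∃ ρ : ℕ → ℝ, Tendsto ρ atTop (𝓝 0) ∧ ∀ n t, k n t ≠ 0 → ‖t‖ ≤ ρ n) ∧
      ∀ n, ∀ t ∈ tsupport (k n), ∃ τ ∈ Ioc (0 : ℝ) 1, ∃ q ∈ closedBall q₀ r, t = -(τ • q) := by
  set τ : ℕ → ℝ := fun n => 1 / ((n : ℝ) + 1) with hτ
  have hτ0 : ∀ n, 0 < τ n := fun n => by positivity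
  have hτ1 : ∀ n, τ n ≤ 1 := fun n => by
    rw [hτ, div_le_one (by positivity)]; simp
  -- Mollification evaluates at x - t, so kernels centred at -τq₀ with radius τr sample only points
  -- x + τq with q near q₀, that is, inward displacements.
  let φ : ∀ n, ContDiffBump (-(τ n • q₀)) := fun n =>
    ⟨τ n * r / 2, τ n * r, by have := hτ0 n; positivity, by have := hτ0 n; nlinarith [mul_pos this hr]⟩
  have hcone : ∀ n, ∀ t ∈ closedBall (-(τ n • q₀)) (τ n * r),
      ∃ q ∈ closedBall q₀ r, t = -(τ n • q) := by
    intro n t ht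
    refine ⟨-((τ n)⁻¹ • t), ?_, ?_⟩
    · rw [mem_closedBall, dist_eq_norm] at ht ⊢
      have e : -((τ n)⁻¹ • t) - q₀ = -((τ n)⁻¹ • (t - -(τ n • q₀))) := by
        rw [smul_sub, smul_neg, smul_smul, inv_mul_cancel₀ (hτ0 n).ne', one_smul]; abel
      rw [e, norm_neg, norm_smul, Real.norm_of_nonneg (inv_nonneg.2 (hτ0 n).le),
        inv_mul_le_iff₀ (hτ0 n)]
      exact ht
    · rw [smul_neg, smul_smul, mul_inv_cancel₀ (hτ0 n).ne', one_smul, neg_neg]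
  refine ⟨fun n => (φ n).normed volume, fun n => ⟨(φ n).contDiff_normed, (φ n).hasCompactSupport_normed⟩,
    fun n t => (φ n).nonneg_normed t, fun n => (φ n).integral_normed,
    ⟨fun n => τ n * (‖q₀‖ + r), ?_, ?_⟩, ?_⟩
  · have h := (tendsto_one_div_add_atTop_nhds_zero_nat (𝕜 := ℝ)).mul_const (‖q₀‖ + r)
    rw [zero_mul] at h
    exact h
  · intro n t ht
    have h1 : t ∈ ball (-(τ n • q₀)) (τ n * r) := by
      have : t ∈ Function.support ((φ n).normed volume) := ht
      rwa [(φ n).support_normed_eq] at this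
    obtain ⟨q, hq, rfl⟩ := hcone n t (ball_subset_closedBall h1)
    rw [norm_neg, norm_smul, Real.norm_of_nonneg (hτ0 n).le]
    have h2 : ‖q‖ ≤ ‖q₀‖ + r := by
      rw [mem_closedBall, dist_eq_norm] at hq
      calc ‖q‖ = ‖q₀ + (q - q₀)‖ := by congr 1; abel
        _ ≤ _ := (norm_add_le _ _).trans (by linarith)
    exact mul_le_mul_of_nonneg_left h2 (hτ0 n).le
  · intro n t ht
    rw [(φ n).tsupport_normed_eq] at ht
    obtain ⟨q, hq, e⟩ := hcone n t ht
    exact ⟨τ n, ⟨hτ0 n, hτ1 n⟩, q, hq, e⟩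

end HeatCylinder

/-! ### Density of smooth functions in H¹ of the cylinder. -/

namespace HeatCylinder

open Filter Topology Metric
open scoped Manifold

/-- A smooth partition of unity subordinate to a family of balls around the points of a
compact set. -/
lemma exists_partition_of_balls {K : Set E3} (hK : IsCompact K) {R : E3 → ℝ}
    (hR : ∀ x ∈ K, 0 < R x) :
    ∃ (T : Finset E3) (χ : E3 → E3 → ℝ), (∀ i ∈ T, i ∈ K) ∧ (∀ i ∈ T, IsTest (χ i)) ∧
      (∀ i ∈ T, ∀ x, 0 ≤ χ i x) ∧ (∀ i ∈ T, tsupport (χ i) ⊆ ball i (R i)) ∧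
      (∀ x ∈ K, ∑ i ∈ T, χ i x = 1) ∧ ∀ x, ∑ i ∈ T, χ i x ≤ 1 := by
  classical
  obtain ⟨T, hTK, hT⟩ := hK.elim_nhds_subcover (fun x => ball x (R x))
    fun x hx => ball_mem_nhds x (hR x hx)
  obtain ⟨p, hp⟩ := SmoothPartitionOfUnity.exists_isSubordinate (ι := T) 𝓘(ℝ, E3)
    hK.isClosed (fun i => ball (i : E3) (R i)) (fun _ => isOpen_ball) (by
      intro x hx
      obtain ⟨i, hi, hxi⟩ := mem_iUnion₂.1 (hT hx)
      exact mem_iUnion.2 ⟨⟨i, hi⟩, hxi⟩)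
  set χ : E3 → E3 → ℝ := fun i x => if h : i ∈ T then p ⟨i, h⟩ x else 0 with hχ
  have e : ∀ i (h : i ∈ T), χ i = p ⟨i, h⟩ := by
    intro i h; ext x; simp [hχ, h]
  have hsum : ∀ x, ∑ i ∈ T, χ i x = ∑ᶠ i, p i x := by
    intro x
    rw [finsum_eq_sum_of_fintype, ← Finset.sum_coe_sort]
    exact Finset.sum_congr rfl fun i _ => by rw [e i i.2]
  refine ⟨T, χ, hTK, fun i hi => ⟨?_, ?_⟩, fun i hi x => ?_, fun i hi => ?_, fun x hx => ?_,
    fun x => ?_⟩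
  · rw [e i hi]
    exact (p ⟨i, hi⟩).contMDiff.contDiff
  · rw [e i hi]
    exact (isCompact_closedBall i (R i)).of_isClosed_subset (isClosed_tsupport _)
      ((hp ⟨i, hi⟩).trans ball_subset_closedBall)
  · rw [e i hi]
    exact p.nonneg _ x
  · rw [e i hi]
    exact hp ⟨i, hi⟩
  · rw [hsum]
    exact p.sum_eq_one hx
  · rw [hsum]
    exact p.sum_le_one x

lemma continuous_mollify {F : Type*} [NormedAddCommGroup F] [NormedSpace ℝ F] {k : E3 → ℝ}
    (hk : Continuous k) (hkc : HasCompactSupport k) {f : E3 → F} (hf : LocallyIntegrable f volume) :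
    Continuous (mollify k f) :=
  hkc.continuous_convolution_left (ContinuousLinearMap.lsmul ℝ ℝ) hk hf

lemma hasGradientAt_mul {p q : E3 → ℝ} {P Q x : E3} (hp : HasGradientAt p P x)
    (hq : HasGradientAt q Q x) :
    HasGradientAt (fun x => p x * q x) (p x • Q + q x • P) x := by
  refine hasGradientAt_of_hasFDerivAt (hp.hasFDerivAt.mul hq.hasFDerivAt) fun v => ?_
  simp [inner_add_left, inner_smul_left]

lemma hasGradientAt_sum {ι : Type*} {T : Finset ι} {p : ι → E3 → ℝ} {P : ι → E3} {x : E3}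
    (hp : ∀ i ∈ T, HasGradientAt (p i) (P i) x) :
    HasGradientAt (fun x => ∑ i ∈ T, p i x) (∑ i ∈ T, P i) x := by
  refine hasGradientAt_of_hasFDerivAt
    (HasFDerivAt.fun_sum fun i hi => (hp i hi).hasFDerivAt) fun v => ?_
  simp [sum_inner]

lemma continuous_gradient {p : E3 → ℝ} (hp : ContDiff ℝ 1 p) : Continuous (gradient p) :=
  (InnerProductSpace.toDual ℝ E3).symm.continuous.comp (hp.continuous_fderiv (by norm_num))

lemma IsTest.contDiff_one {p : E3 → ℝ} (hp : IsTest p) : ContDiff ℝ 1 p :=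
  hp.1.of_le (by exact_mod_cast le_top)

lemma IsTest.hasGradientAt {p : E3 → ℝ} (hp : IsTest p) (x : E3) :
    HasGradientAt p (gradient p x) x :=
  (hp.contDiff_one.differentiable (by norm_num) x).hasGradientAt

lemma norm_gradient (p : E3 → ℝ) (x : E3) : ‖gradient p x‖ = ‖fderiv ℝ p x‖ :=
  (InnerProductSpace.toDual ℝ E3).symm.norm_map _

lemma tsupport_gradient_subset (p : E3 → ℝ) : tsupport (gradient p) ⊆ tsupport p := by
  refine closure_minimal (fun x hx => ?_) (isClosed_tsupport _)
  refine support_fderiv_subset ℝ (fun h => hx ?_)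
  rw [← norm_eq_zero, norm_gradient, h, norm_zero]

lemma IsTest.exists_norm_gradient_le {p : E3 → ℝ} (hp : IsTest p) :
    ∃ C : ℝ, 0 ≤ C ∧ ∀ x, ‖gradient p x‖ ≤ C := by
  have hc : HasCompactSupport (gradient p) :=
    hp.2.of_isClosed_subset (isClosed_tsupport _) (tsupport_gradient_subset p)
  obtain ⟨C, hC⟩ := hc.exists_bound_of_continuous (continuous_gradient hp.contDiff_one)
  exact ⟨C, (norm_nonneg _).trans (hC 0), hC⟩

lemma tendsto_sum_mul_eLpNorm {ι : Type*} {T : Finset ι} {C : ι → ℝ≥0∞} (hC : ∀ i ∈ T, C i ≠ ∞)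
    {p : ι → ℕ → ℝ≥0∞} (hp : ∀ i ∈ T, Tendsto (p i) atTop (𝓝 0)) :
    Tendsto (fun n => ∑ i ∈ T, C i * p i n) atTop (𝓝 0) := by
  have : (0 : ℝ≥0∞) = ∑ i ∈ T, C i * 0 := by simp
  rw [this]
  exact tendsto_finsetSum _ fun i hi =>
    ENNReal.Tendsto.const_mul (hp i hi) (Or.inr (hC i hi))

lemma eLpNorm_le_ofReal_mul {α F F' : Type*} [MeasurableSpace α] {μ : Measure α}
    [NormedAddCommGroup F] [NormedAddCommGroup F'] {f : α → F} {h : α → F'} {C : ℝ}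
    (hfh : ∀ x, ‖f x‖ ≤ C * ‖h x‖) : eLpNorm f 2 μ ≤ ENNReal.ofReal C * eLpNorm h 2 μ :=
  eLpNorm_le_mul_eLpNorm_of_ae_le_mul (Eventually.of_forall hfh) 2

/-- Smooth functions are dense in `H¹` of the cylinder, with preservation of bounds. -/
lemma exists_test_approx {φ₀ : E2 → ℝ} {c₀ a : ℝ} (hsec : IsRegularSection φ₀ c₀) (ha : 0 < a)
    {u : E3 → ℝ} {g : E3 → E3} (hu : HasWeakGradient (cylinder φ₀ c₀ a) u g) :
    ∃ U : ℕ → E3 → ℝ, (∀ n, IsTest (U n)) ∧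
      Tendsto (fun n => eLpNorm (fun x => U n x - u x) 2 (volume.restrict (cylinder φ₀ c₀ a)))
        atTop (𝓝 0) ∧
      Tendsto (fun n => eLpNorm (fun x => gradient (U n) x - g x) 2
        (volume.restrict (cylinder φ₀ c₀ a))) atTop (𝓝 0) ∧
      (∀ᵐ x ∂(volume.restrict (cylinder φ₀ c₀ a)), Tendsto (fun n => U n x) atTop (𝓝 (u x))) ∧
      ∀ K : ℝ, 0 ≤ K → (∀ᵐ x ∂(volume.restrict (cylinder φ₀ c₀ a)), |u x| ≤ K) →
        ∀ n x, |U n x| ≤ K := by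
  set Ω := cylinder φ₀ c₀ a with hΩdef
  have hΩo : IsOpen Ω := isOpen_cylinder hsec.smooth.continuous
  have hΩ : MeasurableSet Ω := hΩo.measurableSet
  have hball : ∀ x₀ : E3, ∃ (R r : ℝ) (q₀ : E3), x₀ ∈ closure Ω → 0 < R ∧ 0 < r ∧ ∀ x ∈ Ω,
      x ∈ ball x₀ R → ∀ τ ∈ Ioc (0 : ℝ) 1, ∀ q ∈ closedBall q₀ r, x + τ • q ∈ Ω := by
    intro x₀
    by_cases h : x₀ ∈ closure Ω
    · obtain ⟨R, r, q₀, hh⟩ := exists_inward_ball hsec ha h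
      exact ⟨R, r, q₀, fun _ => hh⟩
    · exact ⟨0, 0, 0, fun h' => absurd h' h⟩
  choose R r q₀ hball using hball
  obtain ⟨T, χ, hTK, hχ, hχ0, hχs, hχ1, hχle⟩ := exists_partition_of_balls
    (isBounded_cylinder (a := a) hsec).isCompact_closure fun x hx => (hball x hx).1
  have hker : ∀ i, ∃ k : ℕ → E3 → ℝ, i ∈ T → (∀ n, IsTest (k n)) ∧ (∀ n t, 0 ≤ k n t) ∧
      (∀ n, ∫ t, k n t = 1) ∧
      (∃ ρ : ℕ → ℝ, Tendsto ρ atTop (𝓝 0) ∧ ∀ n t, k n t ≠ 0 → ‖t‖ ≤ ρ n) ∧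
      ∀ n, ∀ t ∈ tsupport (k n),
        ∃ τ ∈ Ioc (0 : ℝ) 1, ∃ q ∈ closedBall (q₀ i) (r i), t = -(τ • q) := by
    intro i
    by_cases h : i ∈ T
    · obtain ⟨k, hk⟩ := exists_inward_kernels (q₀ := q₀ i) (hball i (hTK i h)).2.1
      exact ⟨k, fun _ => hk⟩
    · exact ⟨fun _ _ => 0, fun h' => absurd h' h⟩
  choose k hk using hker
  set f := Ω.indicator u with hf
  set G := Ω.indicator g with hG
  have hf2 : MemLp f 2 volume := (memLp_indicator_iff_restrict hΩ).2 hu.1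
  have hfl : LocallyIntegrable f volume := hf2.locallyIntegrable (by norm_num)
  have hG2 : MemLp G 2 volume := (memLp_indicator_iff_restrict hΩ).2 hu.2.1
  have hGl : LocallyIntegrable G volume := hG2.locallyIntegrable (by norm_num)
  have hmf : ∀ i ∈ T, Tendsto (fun n => eLpNorm (fun x => mollify (k i n) f x - f x) 2 volume)
      atTop (𝓝 0) := by
    intro i hi
    obtain ⟨h1, h2, h3, ⟨ρ, h4, h5⟩, -⟩ := hk i hi
    exact tendsto_eLpNorm_mollify_sub (fun n => (h1 n).1.continuous) (fun n => (h1 n).2) h2 h3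
      h4 h5 hf2
  have hmG : ∀ i ∈ T, Tendsto (fun n => eLpNorm (fun x => mollify (k i n) G x - G x) 2 volume)
      atTop (𝓝 0) := by
    intro i hi
    obtain ⟨h1, h2, h3, ⟨ρ, h4, h5⟩, -⟩ := hk i hi
    exact tendsto_eLpNorm_mollify_sub (fun n => (h1 n).1.continuous) (fun n => (h1 n).2) h2 h3
      h4 h5 hG2
  have hC : ∀ i, ∃ C : ℝ, 0 ≤ C ∧ (i ∈ T → ∀ x, ‖gradient (χ i) x‖ ≤ C) := by
    intro i
    by_cases h : i ∈ T
    · obtain ⟨C, hC0, hC⟩ := (hχ i h).exists_norm_gradient_le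
      exact ⟨C, hC0, fun _ => hC⟩
    · exact ⟨0, le_rfl, fun h' => absurd h' h⟩
  choose C hC0 hC using hC
  have hχle1 : ∀ i ∈ T, ∀ x, χ i x ≤ 1 := fun i hi x =>
    (Finset.single_le_sum (fun j hj => hχ0 j hj x) hi).trans (hχle x)
  -- Each local piece is mollified with kernels adapted to the inward cone of its own ball, and the
  -- pieces are glued by the partition of unity.
  set U : ℕ → E3 → ℝ := fun n x => ∑ i ∈ T, χ i x * mollify (k i n) f x with hU
  have hUt : ∀ n, IsTest (U n) := by
    intro n
    refine ⟨ContDiff.sum fun i hi => (hχ i hi).1.mul (contDiff_mollify ((hk i hi).1 n) hfl), ?_⟩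
    refine HasCompactSupport.of_support_subset_isCompact
      (T.isCompact_biUnion fun i hi => (hχ i hi).2) fun x hx => ?_
    obtain ⟨i, hi, hne⟩ := Finset.exists_ne_zero_of_sum_ne_zero hx
    exact mem_iUnion₂.2 ⟨i, hi, subset_tsupport _ (left_ne_zero_of_mul hne)⟩
  have hUd : ∀ n, ∀ x ∈ Ω, U n x - u x = ∑ i ∈ T, χ i x * (mollify (k i n) f x - f x) := by
    intro n x hx
    have e : f x = u x := indicator_of_mem hx u
    rw [e]
    simp only [mul_sub, Finset.sum_sub_distrib, ← Finset.sum_mul, hχ1 x (subset_closure hx),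
      one_mul, hU]
  -- Because the gradients of the partition sum to zero, u·∇χᵢ can be subtracted in each term, and
  -- the gradient error consists of mollification errors only.
  have hgrad0 : ∀ x ∈ Ω, ∑ i ∈ T, gradient (χ i) x = 0 := by
    intro x hx
    have h1 : HasGradientAt (fun x => ∑ i ∈ T, χ i x) (∑ i ∈ T, gradient (χ i) x) x :=
      hasGradientAt_sum fun i hi => (hχ i hi).hasGradientAt x
    have h2 : HasGradientAt (fun _ : E3 => (1 : ℝ)) (∑ i ∈ T, gradient (χ i) x) x :=
      h1.congr_of_eventuallyEq (by
        filter_upwards [hΩo.mem_nhds hx] with y hy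
        exact (hχ1 y (subset_closure hy)).symm)
    exact h2.unique (hasGradientAt_const x 1)
  have hUg : ∀ n, ∀ x ∈ Ω, gradient (U n) x - g x = ∑ i ∈ T,
      (χ i x • (mollify (k i n) G x - G x) + (mollify (k i n) f x - f x) • gradient (χ i) x) := by
    intro n x hx
    have e : G x = g x := indicator_of_mem hx g
    have h1 : HasGradientAt (U n) (∑ i ∈ T,
        (χ i x • mollify (k i n) G x + mollify (k i n) f x • gradient (χ i) x)) x := by
      refine hasGradientAt_sum fun i hi => ?_
      by_cases hxi : x ∈ tsupport (χ i)
      · refine hasGradientAt_mul ((hχ i hi).hasGradientAt x)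
          (hasGradientAt_mollify hΩ hu ((hk i hi).1 n) fun t ht => ?_)
        obtain ⟨τ, hτ, q, hq, rfl⟩ := (hk i hi).2.2.2.2 n t ht
        rw [sub_neg_eq_add]
        exact (hball i (hTK i hi)).2.2 x hx (hχs i hi hxi) τ hτ q hq
      · have h0 : χ i x = 0 := image_eq_zero_of_notMem_tsupport hxi
        have h0' : gradient (χ i) x = 0 :=
          image_eq_zero_of_notMem_tsupport fun h => hxi (tsupport_gradient_subset _ h)
        rw [h0, h0', zero_smul, smul_zero, add_zero]
        refine (hasGradientAt_const x 0).congr_of_eventuallyEq ?_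
        filter_upwards [(isClosed_tsupport (χ i)).isOpen_compl.mem_nhds hxi] with y hy
        rw [image_eq_zero_of_notMem_tsupport hy, zero_mul]
    rw [h1.gradient, e]
    simp only [smul_sub, sub_smul, Finset.sum_add_distrib, Finset.sum_sub_distrib,
      ← Finset.sum_smul, ← Finset.smul_sum, hχ1 x (subset_closure hx), one_smul, hgrad0 x hx,
      smul_zero, sub_zero]
    abel
  have hmfc : ∀ i ∈ T, ∀ n, Continuous (mollify (k i n) f) := fun i hi n =>
    continuous_mollify ((hk i hi).1 n).1.continuous ((hk i hi).1 n).2 hfl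
  have hmGc : ∀ i ∈ T, ∀ n, Continuous (mollify (k i n) G) := fun i hi n =>
    continuous_mollify ((hk i hi).1 n).1.continuous ((hk i hi).1 n).2 hGl
  have hL2 : Tendsto (fun n => eLpNorm (fun x => U n x - u x) 2 (volume.restrict Ω))
      atTop (𝓝 0) := by
    refine tendsto_of_tendsto_of_tendsto_of_le_of_le tendsto_const_nhds
      (tendsto_sum_mul_eLpNorm (C := fun _ => ENNReal.ofReal 1) (fun i _ => ENNReal.ofReal_ne_top) hmf)
      (fun n => zero_le) fun n => ?_
    calc eLpNorm (fun x => U n x - u x) 2 (volume.restrict Ω)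
        = eLpNorm (∑ i ∈ T, fun x => χ i x * (mollify (k i n) f x - f x)) 2
            (volume.restrict Ω) := by
          refine eLpNorm_congr_ae ?_
          filter_upwards [ae_restrict_mem hΩ] with x hx
          rw [hUd n x hx, Finset.sum_apply]
      _ ≤ ∑ i ∈ T, eLpNorm (fun x => χ i x * (mollify (k i n) f x - f x)) 2
            (volume.restrict Ω) := by
          refine eLpNorm_sum_le (fun i hi => ?_) (by norm_num)
          exact (((hχ i hi).1.continuous.aestronglyMeasurable.mul
            ((hmfc i hi n).aestronglyMeasurable.sub hf2.1))).restrict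
      _ ≤ _ := by
          refine Finset.sum_le_sum fun i hi => ?_
          refine (eLpNorm_le_ofReal_mul (C := 1)
            (h := fun x => mollify (k i n) f x - f x) fun x => ?_).trans ?_
          · rw [norm_mul, Real.norm_of_nonneg (hχ0 i hi x)]
            exact mul_le_mul_of_nonneg_right (hχle1 i hi x) (norm_nonneg _)
          · exact mul_le_mul_right (eLpNorm_mono_measure _ Measure.restrict_le_self) _
  have hH1 : Tendsto (fun n => eLpNorm (fun x => gradient (U n) x - g x) 2 (volume.restrict Ω))
      atTop (𝓝 0) := by
    have hlim := (tendsto_sum_mul_eLpNorm (C := fun _ => ENNReal.ofReal 1)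
      (fun i _ => ENNReal.ofReal_ne_top) hmG).add
      (tendsto_sum_mul_eLpNorm (C := fun i => ENNReal.ofReal (C i))
      (fun i _ => ENNReal.ofReal_ne_top) hmf)
    rw [add_zero] at hlim
    refine tendsto_of_tendsto_of_tendsto_of_le_of_le tendsto_const_nhds hlim
      (fun n => zero_le) fun n => ?_
    have hm1 : ∀ i ∈ T, AEStronglyMeasurable (fun x => χ i x • (mollify (k i n) G x - G x))
        (volume.restrict Ω) := fun i hi =>
      ((hχ i hi).1.continuous.aestronglyMeasurable.smul
        ((hmGc i hi n).aestronglyMeasurable.sub hG2.1)).restrict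
    have hm2 : ∀ i ∈ T, AEStronglyMeasurable
        (fun x => (mollify (k i n) f x - f x) • gradient (χ i) x) (volume.restrict Ω) :=
      fun i hi => (((hmfc i hi n).aestronglyMeasurable.sub hf2.1).smul
        (continuous_gradient (hχ i hi).contDiff_one).aestronglyMeasurable).restrict
    calc eLpNorm (fun x => gradient (U n) x - g x) 2 (volume.restrict Ω)
        = eLpNorm (∑ i ∈ T, ((fun x => χ i x • (mollify (k i n) G x - G x)) +
            fun x => (mollify (k i n) f x - f x) • gradient (χ i) x)) 2
            (volume.restrict Ω) := by
          refine eLpNorm_congr_ae ?_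
          filter_upwards [ae_restrict_mem hΩ] with x hx
          rw [hUg n x hx, Finset.sum_apply]
          rfl
      _ ≤ ∑ i ∈ T, eLpNorm ((fun x => χ i x • (mollify (k i n) G x - G x)) +
            fun x => (mollify (k i n) f x - f x) • gradient (χ i) x) 2 (volume.restrict Ω) :=
          eLpNorm_sum_le (fun i hi => (hm1 i hi).add (hm2 i hi)) (by norm_num)
      _ ≤ ∑ i ∈ T, (ENNReal.ofReal 1 * eLpNorm (fun x => mollify (k i n) G x - G x) 2 volume +
            ENNReal.ofReal (C i) * eLpNorm (fun x => mollify (k i n) f x - f x) 2 volume) := by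
          refine Finset.sum_le_sum fun i hi =>
            (eLpNorm_add_le (hm1 i hi) (hm2 i hi) (by norm_num)).trans (add_le_add ?_ ?_)
          · refine (eLpNorm_le_ofReal_mul (C := 1)
              (h := fun x => mollify (k i n) G x - G x) fun x => ?_).trans ?_
            · rw [norm_smul, Real.norm_of_nonneg (hχ0 i hi x)]
              exact mul_le_mul_of_nonneg_right (hχle1 i hi x) (norm_nonneg _)
            · exact mul_le_mul_right (eLpNorm_mono_measure _ Measure.restrict_le_self) _
          · refine (eLpNorm_le_ofReal_mul (C := C i)
              (h := fun x => mollify (k i n) f x - f x) fun x => ?_).trans ?_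
            · rw [norm_smul, mul_comm]
              exact mul_le_mul_of_nonneg_right (hC i hi x) (norm_nonneg _)
            · exact mul_le_mul_right (eLpNorm_mono_measure _ Measure.restrict_le_self) _
      _ = _ := Finset.sum_add_distrib
  -- The weights χᵢ are nonnegative with sum at most 1 everywhere, so a bound on u survives both
  -- averaging and gluing, also at points outside Ω and on the bottom.
  have hbd : ∀ K : ℝ, 0 ≤ K → (∀ᵐ x ∂(volume.restrict Ω), |u x| ≤ K) → ∀ n x, |U n x| ≤ K := by
    intro K hK0 hK n x
    have hfK : ∀ᵐ x, ‖f x‖ ≤ K := by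
      filter_upwards [(ae_restrict_iff' hΩ).1 hK] with x hx
      by_cases hxΩ : x ∈ Ω
      · rw [hf, indicator_of_mem hxΩ]
        exact hx hxΩ
      · rw [hf, indicator_of_notMem hxΩ, norm_zero]
        exact hK0
    calc |U n x| ≤ ∑ i ∈ T, |χ i x * mollify (k i n) f x| := Finset.abs_sum_le_sum_abs _ _
      _ ≤ ∑ i ∈ T, χ i x * K := by
          refine Finset.sum_le_sum fun i hi => ?_
          rw [abs_mul, abs_of_nonneg (hχ0 i hi x)]
          obtain ⟨h1, h2, h3, -⟩ := hk i hi
          exact mul_le_mul_of_nonneg_left (norm_mollify_le (h2 n)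
            ((h1 n).1.continuous.integrable_of_hasCompactSupport (h1 n).2) (h3 n) hfK x) (hχ0 i hi x)
      _ = (∑ i ∈ T, χ i x) * K := (Finset.sum_mul _ _ _).symm
      _ ≤ 1 * K := mul_le_mul_of_nonneg_right (hχle x) hK0
      _ = K := one_mul K
  -- L₂ convergence gives almost everywhere convergence along a subsequence; the other properties
  -- are inherited by it.
  have hmeas : TendstoInMeasure (volume.restrict Ω) U atTop u :=
    tendstoInMeasure_of_tendsto_eLpNorm (p := 2) (by norm_num)
      (fun n => (hUt n).1.continuous.aestronglyMeasurable) hu.1.1 hL2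
  obtain ⟨ns, hns, hae⟩ := hmeas.exists_seq_tendsto_ae
  exact ⟨fun n => U (ns n), fun n => hUt _, hL2.comp hns.tendsto_atTop,
    hH1.comp hns.tendsto_atTop, hae, fun K hK0 hK n => hbd K hK0 hK _⟩

end HeatCylinder

/-! ### Limits of products and the chain rule for the convective flux. -/

namespace HeatCylinder

open Filter Topology Metric

section Convergence

variable {α F : Type*} [MeasurableSpace α] {μ : Measure α} [NormedAddCommGroup F]

lemma lintegral_enorm_mul_enorm_le {F' : Type*} [NormedAddCommGroup F'] {p : α → F} {q : α → F'}
    (hp : AEStronglyMeasurable p μ) (hq : AEStronglyMeasurable q μ) :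
    ∫⁻ x, ‖p x‖ₑ * ‖q x‖ₑ ∂μ ≤ eLpNorm p 2 μ * eLpNorm q 2 μ := by
  rw [← ENNReal.pow_le_pow_left_iff (two_ne_zero), mul_pow, eLpNorm_two_sq, eLpNorm_two_sq]
  exact sq_lintegral_mul_le hp.enorm hq.enorm

lemma tendsto_eLpNorm_of_sub {p : ℕ → α → F} {q : α → F} (hp : ∀ n, AEStronglyMeasurable (p n) μ)
    (hq : MemLp q 2 μ) (h : Tendsto (fun n => eLpNorm (fun x => p n x - q x) 2 μ) atTop (𝓝 0)) :
    Tendsto (fun n => eLpNorm (p n) 2 μ) atTop (𝓝 (eLpNorm q 2 μ)) := by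
  have h1 := ENNReal.Tendsto.sub (tendsto_const_nhds (x := eLpNorm q 2 μ) (f := atTop)) h
    (Or.inl hq.eLpNorm_ne_top)
  have h2 := (tendsto_const_nhds (x := eLpNorm q 2 μ) (f := atTop)).add h
  rw [tsub_zero] at h1
  rw [add_zero] at h2
  refine tendsto_of_tendsto_of_tendsto_of_le_of_le h1 h2 (fun n => ?_) fun n => ?_
  · rw [tsub_le_iff_right]
    have e : q = p n - fun x => p n x - q x := by ext x; simp
    calc eLpNorm q 2 μ = eLpNorm (p n - fun x => p n x - q x) 2 μ := by rw [← e]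
      _ ≤ _ := eLpNorm_sub_le (hp n) ((hp n).sub hq.1) (by norm_num)
  · have e : p n = q + fun x => p n x - q x := by ext x; simp
    calc eLpNorm (p n) 2 μ = eLpNorm (q + fun x => p n x - q x) 2 μ := by rw [← e]
      _ ≤ _ := eLpNorm_add_le hq.1 ((hp n).sub hq.1) (by norm_num)

variable [NormedSpace ℝ F]

/-- Write the difference as cₙ(pₙ - p₀) + (cₙ - c₀)p₀: the first part is small by boundedness of cₙ,
the second by dominated convergence. It serves for coefficients such as β'(Uₙ), which converge only
boundedly and almost everywhere. -/
lemma tendsto_eLpNorm_smul_sub {c : ℕ → α → ℝ} {c₀ : α → ℝ} {p : ℕ → α → F} {p₀ : α → F} {C : ℝ}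
    (hcm : ∀ n, AEStronglyMeasurable (c n) μ) (hc : ∀ n x, |c n x| ≤ C)
    (hlim : ∀ᵐ x ∂μ, Tendsto (fun n => c n x) atTop (𝓝 (c₀ x)))
    (hp : ∀ n, AEStronglyMeasurable (p n) μ) (hp₀ : MemLp p₀ 2 μ)
    (h : Tendsto (fun n => eLpNorm (fun x => p n x - p₀ x) 2 μ) atTop (𝓝 0)) :
    Tendsto (fun n => eLpNorm (fun x => c n x • p n x - c₀ x • p₀ x) 2 μ) atTop (𝓝 0) := by
  have hc₀m : AEStronglyMeasurable c₀ μ := aestronglyMeasurable_of_tendsto_ae _ hcm hlim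
  have h1 : Tendsto (fun n => ENNReal.ofReal C * eLpNorm (fun x => p n x - p₀ x) 2 μ) atTop
      (𝓝 0) := by
    have := ENNReal.Tendsto.const_mul (a := ENNReal.ofReal C) h (Or.inr ENNReal.ofReal_ne_top)
    rwa [mul_zero] at this
  have h2 : Tendsto (fun n => eLpNorm (fun x => (c n x - c₀ x) • p₀ x) 2 μ ^ 2) atTop (𝓝 0) := by
    simp_rw [eLpNorm_two_sq]
    have e : (0 : ℝ≥0∞) = ∫⁻ _, 0 ∂μ := by simp
    rw [e]
    refine tendsto_lintegral_of_dominated_convergence'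
      (fun x => ENNReal.ofReal (2 * C) ^ 2 * ‖p₀ x‖ₑ ^ 2) (fun n => ?_) (fun n => ?_) ?_ ?_
    · exact (((hcm n).sub hc₀m).smul hp₀.1).enorm.pow_const 2
    · filter_upwards [hlim] with x hx
      rw [enorm_smul, mul_pow]
      refine mul_le_mul_left (pow_le_pow_left₀ zero_le ?_ 2) _
      rw [← ofReal_norm]
      refine ENNReal.ofReal_le_ofReal ?_
      have hx' : |c₀ x| ≤ C := le_of_tendsto hx.abs (Eventually.of_forall fun n => hc n x)
      calc ‖c n x - c₀ x‖ ≤ |c n x| + |c₀ x| := norm_sub_le _ _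
        _ ≤ 2 * C := by linarith [hc n x]
    · rw [lintegral_const_mul'' _ (hp₀.1.enorm.pow_const 2), ← eLpNorm_two_sq]
      exact ENNReal.mul_ne_top (by finiteness) (ENNReal.pow_ne_top hp₀.eLpNorm_ne_top)
    · filter_upwards [hlim] with x hx
      have h3 : Tendsto (fun n => (c n x - c₀ x) • p₀ x) atTop (𝓝 0) := by
        have := (hx.sub_const (c₀ x)).smul_const (p₀ x)
        rwa [sub_self, zero_smul] at this
      have h4 := ((ENNReal.continuous_pow 2).tendsto _).comp h3.enorm
      simpa [Function.comp_def] using h4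
  have h2' : Tendsto (fun n => eLpNorm (fun x => (c n x - c₀ x) • p₀ x) 2 μ) atTop (𝓝 0) := by
    have := (ENNReal.continuous_rpow_const (y := (1 / 2 : ℝ))).continuousAt.tendsto.comp h2
    simp only [Function.comp_def] at this
    rw [ENNReal.zero_rpow_of_pos (by norm_num)] at this
    refine this.congr fun n => ?_
    rw [← ENNReal.rpow_natCast, ← ENNReal.rpow_mul]
    norm_num
  have h3 := h1.add h2'
  rw [add_zero] at h3
  refine tendsto_of_tendsto_of_tendsto_of_le_of_le tendsto_const_nhds h3 (fun n => zero_le)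
    fun n => ?_
  have e : (fun x => c n x • p n x - c₀ x • p₀ x) =
      (fun x => c n x • (p n x - p₀ x)) + fun x => (c n x - c₀ x) • p₀ x := by
    ext x
    simp only [Pi.add_apply, smul_sub, sub_smul]
    abel
  rw [e]
  refine (eLpNorm_add_le ((hcm n).smul ((hp n).sub hp₀.1)) (((hcm n).sub hc₀m).smul hp₀.1)
    (by norm_num)).trans (add_le_add ?_ le_rfl)
  refine eLpNorm_le_ofReal_mul fun x => ?_
  change ‖c n x • (p n x - p₀ x)‖ ≤ _
  rw [norm_smul]
  exact mul_le_mul_of_nonneg_right (hc n x) (norm_nonneg _)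

lemma integrable_inner_of_memLp {w q : α → E3} (hw : MemLp w 2 μ) (hq : MemLp q 2 μ) :
    Integrable (fun x => inner ℝ (w x) (q x)) μ := by
  refine ⟨hw.1.inner hq.1, ?_⟩
  calc ∫⁻ x, ‖(inner ℝ (w x) (q x) : ℝ)‖ₑ ∂μ ≤ ∫⁻ x, ‖w x‖ₑ * ‖q x‖ₑ ∂μ := by
        refine lintegral_mono fun x => ?_
        rw [← ofReal_norm, ← ofReal_norm, ← ofReal_norm, ← ENNReal.ofReal_mul (norm_nonneg _)]
        exact ENNReal.ofReal_le_ofReal (norm_inner_le_norm _ _)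
    _ ≤ eLpNorm w 2 μ * eLpNorm q 2 μ := lintegral_enorm_mul_enorm_le hw.1 hq.1
    _ < ∞ := ENNReal.mul_lt_top hw.2 hq.2

lemma norm_integral_inner_le {w q : α → E3} (hw : MemLp w 2 μ) (hq : MemLp q 2 μ) :
    ‖∫ x, inner ℝ (w x) (q x) ∂μ‖ ≤ (eLpNorm w 2 μ).toReal * (eLpNorm q 2 μ).toReal := by
  rw [← ENNReal.toReal_mul]
  refine (norm_integral_le_lintegral_norm _).trans (ENNReal.toReal_mono
    (ENNReal.mul_ne_top hw.eLpNorm_ne_top hq.eLpNorm_ne_top) ?_)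
  refine le_trans (lintegral_mono fun x => ?_) (lintegral_enorm_mul_enorm_le hw.1 hq.1)
  rw [← ofReal_norm, ← ofReal_norm, ← ENNReal.ofReal_mul (norm_nonneg _)]
  exact ENNReal.ofReal_le_ofReal (norm_inner_le_norm _ _)

lemma tendsto_integral_inner {w q : α → E3} {p : ℕ → α → E3} (hw : MemLp w 2 μ)
    (hp : ∀ n, MemLp (p n) 2 μ) (hq : MemLp q 2 μ)
    (h : Tendsto (fun n => eLpNorm (fun x => p n x - q x) 2 μ) atTop (𝓝 0)) :
    Tendsto (fun n => ∫ x, inner ℝ (w x) (p n x) ∂μ) atTop (𝓝 (∫ x, inner ℝ (w x) (q x) ∂μ)) := by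
  rw [tendsto_iff_norm_sub_tendsto_zero]
  have h1 : Tendsto (fun n => (eLpNorm w 2 μ).toReal * (eLpNorm (fun x => p n x - q x) 2 μ).toReal)
      atTop (𝓝 0) := by
    have := ((ENNReal.tendsto_toReal ENNReal.zero_ne_top).comp h).const_mul (eLpNorm w 2 μ).toReal
    simpa using this
  refine squeeze_zero (fun n => norm_nonneg _) (fun n => ?_) h1
  rw [← integral_sub (integrable_inner_of_memLp hw (hp n)) (integrable_inner_of_memLp hw hq)]
  simp_rw [← inner_sub_right]
  exact norm_integral_inner_le hw ((hp n).sub hq)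

end Convergence

/-- Chain rule for compositions with smooth functions vanishing at the origin. -/
lemma IsTest.comp_left {β : ℝ → ℝ} (hβ : ContDiff ℝ ((⊤ : ℕ∞) : WithTop ℕ∞) β) (hβ0 : β 0 = 0)
    {u : E3 → ℝ} (hu : IsTest u) : IsTest fun x => β (u x) :=
  ⟨hβ.comp hu.1, hu.2.comp_left (g := β) hβ0⟩

lemma gradient_comp_left {β : ℝ → ℝ} (hβ : Differentiable ℝ β) {u : E3 → ℝ} (hu : IsTest u)
    (x : E3) : gradient (fun x => β (u x)) x = deriv β (u x) • gradient u x := by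
  apply HasGradientAt.gradient
  refine hasGradientAt_of_hasFDerivAt
    ((hβ (u x)).hasDerivAt.comp_hasFDerivAt x (hu.hasGradientAt x).hasFDerivAt) fun v => ?_
  simp [inner_smul_left]

lemma IsTest.memLp {u : E3 → ℝ} (hu : IsTest u) {Ω : Set E3} : MemLp u 2 (volume.restrict Ω) :=
  (hu.1.continuous.memLp_of_hasCompactSupport hu.2).restrict Ω

lemma IsTest.memLp_gradient {u : E3 → ℝ} (hu : IsTest u) {Ω : Set E3} :
    MemLp (gradient u) 2 (volume.restrict Ω) :=
  ((continuous_gradient hu.contDiff_one).memLp_of_hasCompactSupport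
    (hu.2.of_isClosed_subset (isClosed_tsupport _) (tsupport_gradient_subset u))).restrict Ω

/-- If the flux of `v` against the smooth approximations `β ∘ Uₙ` is bounded by `Bₙ → B`, then the
flux `-∫ v·∇(β ∘ u)` is at most `B`. -/
lemma neg_integral_inner_smul_le {Ω : Set E3} {v : E3 → E3} (hv : MemLp v 2 (volume.restrict Ω))
    {u : E3 → ℝ} {g : E3 → E3} (hg : MemLp g 2 (volume.restrict Ω)) {U : ℕ → E3 → ℝ}
    (hU : ∀ n, IsTest (U n))
    (hUg : Tendsto (fun n => eLpNorm (fun x => gradient (U n) x - g x) 2 (volume.restrict Ω))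
      atTop (𝓝 0))
    (hUa : ∀ᵐ x ∂(volume.restrict Ω), Tendsto (fun n => U n x) atTop (𝓝 (u x)))
    {β : ℝ → ℝ} (hβ : ContDiff ℝ ((⊤ : ℕ∞) : WithTop ℕ∞) β) {C : ℝ} (hC : ∀ r, |deriv β r| ≤ C)
    {B : ℕ → ℝ} {B₀ : ℝ} (hB : Tendsto B atTop (𝓝 B₀))
    (h : ∀ n, -∫ x in Ω, inner ℝ (v x) (gradient (fun x => β (U n x)) x) ≤ B n) :
    -∫ x in Ω, inner ℝ (v x) (g x) * deriv β (u x) ≤ B₀ := by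
  have hβ' : Continuous (deriv β) := hβ.continuous_deriv (by simp)
  have hm : ∀ n, AEStronglyMeasurable (fun x => deriv β (U n x)) (volume.restrict Ω) := fun n =>
    (hβ'.comp (hU n).1.continuous).aestronglyMeasurable
  have ha : ∀ᵐ x ∂(volume.restrict Ω),
      Tendsto (fun n => deriv β (U n x)) atTop (𝓝 (deriv β (u x))) := by
    filter_upwards [hUa] with x hx
    exact (hβ'.tendsto _).comp hx
  have hm₀ : AEStronglyMeasurable (fun x => deriv β (u x)) (volume.restrict Ω) :=
    aestronglyMeasurable_of_tendsto_ae _ hm ha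
  have h1 := tendsto_eLpNorm_smul_sub hm (fun n x => hC _) ha
    (fun n => (hU n).memLp_gradient.1) hg hUg
  have hmem : ∀ {q : E3 → E3} {c : E3 → ℝ}, MemLp q 2 (volume.restrict Ω) →
      AEStronglyMeasurable c (volume.restrict Ω) → (∀ x, |c x| ≤ C) →
      MemLp (fun x => c x • q x) 2 (volume.restrict Ω) := fun hq hc hcC =>
    hq.of_le_mul (hc.smul hq.1) (c := C) (Eventually.of_forall fun x => by
      rw [norm_smul]; exact mul_le_mul_of_nonneg_right (hcC x) (norm_nonneg _))
  have h2 := tendsto_integral_inner hv (fun n => hmem (hU n).memLp_gradient (hm n) fun x => hC _)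
    (hmem hg hm₀ fun x => hC _) h1
  have e : ∫ x in Ω, inner ℝ (v x) (g x) * deriv β (u x) =
      ∫ x in Ω, inner ℝ (v x) (deriv β (u x) • g x) :=
    integral_congr_ae (Eventually.of_forall fun x => by
      simp only [inner_smul_right]; ring)
  rw [e]
  refine le_of_tendsto_of_tendsto' h2.neg hB fun n => le_trans (le_of_eq ?_) (h n)
  simp_rw [gradient_comp_left (hβ.differentiable (by simp)) (hU n)]

end HeatCylinder

/-! ### Two bounds for the inflow through the bottom. -/

namespace HeatCylinder

open Filter Topology Metric

lemma abs_sub_le_of_abs_deriv_le {P : ℝ → ℝ} (hP : Differentiable ℝ P) {C : ℝ}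
    (hC : ∀ r, |deriv P r| ≤ C) (x y : ℝ) : |P x - P y| ≤ C * |x - y| :=
  Convex.norm_image_sub_le_of_norm_deriv_le (s := univ) (fun x _ => hP x) (fun x _ => hC x)
    convex_univ (mem_univ y) (mem_univ x)

/-- No integrability of f is required: the integral of a nonintegrable function is 0 by convention,
and otherwise the negative part is dropped. -/
lemma integral_le_toReal_lintegral {α : Type*} [MeasurableSpace α] {μ : Measure α} {f : α → ℝ}
    {q : α → ℝ≥0∞} (hq : ∫⁻ x, q x ∂μ ≠ ∞) (h : ∀ᵐ x ∂μ, ENNReal.ofReal (f x) ≤ q x) :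
    ∫ x, f x ∂μ ≤ (∫⁻ x, q x ∂μ).toReal := by
  by_cases hf : Integrable f μ
  · rw [integral_eq_lintegral_pos_part_sub_lintegral_neg_part hf]
    have : (∫⁻ x, ENNReal.ofReal (f x) ∂μ).toReal ≤ (∫⁻ x, q x ∂μ).toReal :=
      ENNReal.toReal_mono hq (lintegral_mono_ae h)
    linarith [ENNReal.toReal_nonneg (a := ∫⁻ x, ENNReal.ofReal (-f x) ∂μ)]
  · rw [integral_undef hf]
    exact ENNReal.toReal_nonneg

variable {φ₀ : E2 → ℝ} {c₀ a : ℝ}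

/-- Only the inflow contributes positively to the flux of a nonnegative function. -/
lemma neg_integral_flux_le {d₁ d₂ : E2 → ℝ}
    (hd : ∀ᵐ y ∂(volume.restrict (crossSection φ₀ c₀)), 0 ≤ d₁ y ∧ 0 ≤ d₂ y) {v : E3 → E3}
    {ψ : E3 → ℝ} (hψ : ∀ x, 0 ≤ ψ x)
    (hflux : ∫ x in cylinder φ₀ c₀ a, inner ℝ (v x) (gradient ψ x) =
      (∫ y in crossSection φ₀ c₀, d₂ y * ψ (lift y a)) -
        ∫ y in crossSection φ₀ c₀, d₁ y * ψ (lift y (-a))) :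
    -∫ x in cylinder φ₀ c₀ a, inner ℝ (v x) (gradient ψ x) ≤
      ∫ y in crossSection φ₀ c₀, d₁ y * ψ (lift y (-a)) := by
  have h2 : 0 ≤ ∫ y in crossSection φ₀ c₀, d₂ y * ψ (lift y a) :=
    integral_nonneg_of_ae (by
      filter_upwards [hd] with y hy
      exact mul_nonneg hy.2 (hψ _))
  linarith

/-- The smooth approximations inherit |Uₙ| ≤ m at every point, hence β(Uₙ) ≤ m²/2 on the bottom. The
flux of the limit is bounded this way without giving a meaning to the trace of u. -/
lemma flux_le_of_bounded (hsec : IsRegularSection φ₀ c₀) (ha : 0 < a) {d₁ d₂ : E2 → ℝ}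
    (hd : ∀ᵐ y ∂(volume.restrict (crossSection φ₀ c₀)), 0 ≤ d₁ y ∧ 0 ≤ d₂ y)
    (hd₁ : ∫⁻ y in crossSection φ₀ c₀, ‖d₁ y‖ₑ ≠ ∞) {v : E3 → E3}
    (hv : MemLp v 2 (volume.restrict (cylinder φ₀ c₀ a)))
    (hflux : ∀ ψ : E3 → ℝ, IsTest ψ → ∫ x in cylinder φ₀ c₀ a, inner ℝ (v x) (gradient ψ x) =
      (∫ y in crossSection φ₀ c₀, d₂ y * ψ (lift y a)) -
        ∫ y in crossSection φ₀ c₀, d₁ y * ψ (lift y (-a)))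
    {u : E3 → ℝ} {g : E3 → E3} (hu : HasWeakGradient (cylinder φ₀ c₀ a) u g) {m : ℝ} (hm : 0 ≤ m)
    (hum : ∀ᵐ x ∂(volume.restrict (cylinder φ₀ c₀ a)), |u x| ≤ m)
    {β : ℝ → ℝ} (hβ : ContDiff ℝ ((⊤ : ℕ∞) : WithTop ℕ∞) β) (hβ0 : β 0 = 0) (hβp : ∀ r, 0 ≤ β r)
    (hβle : ∀ r, β r ≤ r ^ 2 / 2) {C : ℝ} (hC : ∀ r, |deriv β r| ≤ C) :
    -∫ x in cylinder φ₀ c₀ a, inner ℝ (v x) (g x) * deriv β (u x) ≤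
      m ^ 2 / 2 * (∫⁻ y in crossSection φ₀ c₀, ‖d₁ y‖ₑ).toReal := by
  obtain ⟨U, hU, -, hUg, hUa, hUK⟩ := exists_test_approx hsec ha hu
  refine neg_integral_inner_smul_le hv hu.2.1 hU hUg hUa hβ hC (tendsto_const_nhds (f := atTop))
    fun n => ?_
  refine (neg_integral_flux_le hd (fun x => hβp _) (hflux _ ((hU n).comp_left hβ hβ0))).trans ?_
  have e : m ^ 2 / 2 * (∫⁻ y in crossSection φ₀ c₀, ‖d₁ y‖ₑ).toReal =
      (∫⁻ y in crossSection φ₀ c₀, ENNReal.ofReal (m ^ 2 / 2) * ‖d₁ y‖ₑ).toReal := by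
    rw [lintegral_const_mul' _ _ ENNReal.ofReal_ne_top, ENNReal.toReal_mul,
      ENNReal.toReal_ofReal (by positivity)]
  rw [e]
  refine integral_le_toReal_lintegral ?_ ?_
  · rw [lintegral_const_mul' _ _ ENNReal.ofReal_ne_top]
    exact ENNReal.mul_ne_top ENNReal.ofReal_ne_top hd₁
  · filter_upwards [hd] with y hy
    rw [← ofReal_norm, ← ENNReal.ofReal_mul (by positivity), Real.norm_of_nonneg hy.1, mul_comm]
    refine ENNReal.ofReal_le_ofReal (mul_le_mul_of_nonneg_right ?_ hy.1)
    have h1 := hUK m hm hum n (lift y (-a))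
    have h2 := hβle (U n (lift y (-a)))
    have h3 : U n (lift y (-a)) ^ 2 ≤ m ^ 2 := sq_le_sq' (neg_le_of_abs_le h1) (le_of_abs_le h1)
    linarith

/-- On the bottom β(Uₙ) ≤ P(Uₙ)²/2, and the trace inequality applies to the smooth function P(Uₙ).
Its right-hand side involves only L₂ norms in Ω, which converge. -/
lemma flux_le_of_trace (hsec : IsRegularSection φ₀ c₀) (ha : 0 < a) {δ K : ℝ≥0∞} (hδ : δ ≠ ∞)
    (hK : K ≠ ∞)
    (htrace : ∀ w : E3 → ℝ, ContDiff ℝ 1 w → ∀ d : E2 → ℝ≥0∞,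
      AEMeasurable d (volume.restrict (crossSection φ₀ c₀)) →
      ∫⁻ y in crossSection φ₀ c₀, d y * ‖w (lift y (-a))‖ₑ ^ 2 ≤
        δ * (∫⁻ x in cylinder φ₀ c₀ a, ‖fderiv ℝ w x‖ₑ ^ 2) +
        K * (((∫⁻ y in crossSection φ₀ c₀, d y ^ 3) ^ 2 + ∫⁻ y in crossSection φ₀ c₀, d y) *
          ∫⁻ x in cylinder φ₀ c₀ a, ‖w x‖ₑ ^ 2))
    {d₁ d₂ : E2 → ℝ}
    (hd : ∀ᵐ y ∂(volume.restrict (crossSection φ₀ c₀)), 0 ≤ d₁ y ∧ 0 ≤ d₂ y)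
    (hdm : AEMeasurable (fun y => ‖d₁ y‖ₑ) (volume.restrict (crossSection φ₀ c₀)))
    {D : ℝ≥0∞} (hD : D ≠ ∞) (hd₁ : (∫⁻ y in crossSection φ₀ c₀, ‖d₁ y‖ₑ ^ 3) ^ 2 +
      ∫⁻ y in crossSection φ₀ c₀, ‖d₁ y‖ₑ ≤ D) {v : E3 → E3}
    (hv : MemLp v 2 (volume.restrict (cylinder φ₀ c₀ a)))
    (hflux : ∀ ψ : E3 → ℝ, IsTest ψ → ∫ x in cylinder φ₀ c₀ a, inner ℝ (v x) (gradient ψ x) =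
      (∫ y in crossSection φ₀ c₀, d₂ y * ψ (lift y a)) -
        ∫ y in crossSection φ₀ c₀, d₁ y * ψ (lift y (-a)))
    {u : E3 → ℝ} {g : E3 → E3} (hu : HasWeakGradient (cylinder φ₀ c₀ a) u g)
    {P : ℝ → ℝ} (hP : ContDiff ℝ ((⊤ : ℕ∞) : WithTop ℕ∞) P) (hP0 : P 0 = 0)
    (hP1 : ∀ r, |deriv P r| ≤ 1)
    {β : ℝ → ℝ} (hβ : ContDiff ℝ ((⊤ : ℕ∞) : WithTop ℕ∞) β) (hβ0 : β 0 = 0) (hβp : ∀ r, 0 ≤ β r)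
    (hβle : ∀ r, β r ≤ P r ^ 2 / 2) {C : ℝ} (hC : ∀ r, |deriv β r| ≤ C) :
    -∫ x in cylinder φ₀ c₀ a, inner ℝ (v x) (g x) * deriv β (u x) ≤
      (2⁻¹ * (δ * eLpNorm (fun x => deriv P (u x) • g x) 2 (volume.restrict (cylinder φ₀ c₀ a)) ^ 2 +
        K * (D * eLpNorm (fun x => P (u x)) 2
          (volume.restrict (cylinder φ₀ c₀ a)) ^ 2))).toReal := by
  set μ := volume.restrict (cylinder φ₀ c₀ a) with hμ
  obtain ⟨U, hU, hUu, hUg, hUa, -⟩ := exists_test_approx hsec ha hu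
  have hPd : Differentiable ℝ P := hP.differentiable (by simp)
  have hP' : Continuous (deriv P) := hP.continuous_deriv (by simp)
  have hm : ∀ n, AEStronglyMeasurable (fun x => deriv P (U n x)) μ := fun n =>
    (hP'.comp (hU n).1.continuous).aestronglyMeasurable
  have hua : ∀ᵐ x ∂μ, Tendsto (fun n => deriv P (U n x)) atTop (𝓝 (deriv P (u x))) := by
    filter_upwards [hUa] with x hx
    exact (hP'.tendsto _).comp hx
  have hm₀ : AEStronglyMeasurable (fun x => deriv P (u x)) μ :=
    aestronglyMeasurable_of_tendsto_ae _ hm hua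
  have hG : MemLp (fun x => deriv P (u x) • g x) 2 μ :=
    hu.2.1.of_le_mul (hm₀.smul hu.2.1.1) (c := 1) (Eventually.of_forall fun x => by
      rw [norm_smul]; exact mul_le_mul_of_nonneg_right (hP1 _) (norm_nonneg _))
  have hPle : ∀ x y : ℝ, ‖P x - P y‖ ≤ 1 * ‖x - y‖ := fun x y =>
    abs_sub_le_of_abs_deriv_le hPd hP1 x y
  have hPu : MemLp (fun x => P (u x)) 2 μ :=
    hu.1.of_le_mul (hP.continuous.comp_aestronglyMeasurable hu.1.1) (c := 1)
      (Eventually.of_forall fun x => by simpa [hP0] using hPle (u x) 0)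
  have hw : ∀ n, IsTest fun x => P (U n x) := fun n => (hU n).comp_left hP hP0
  have hlimG : Tendsto (fun n => eLpNorm (gradient fun x => P (U n x)) 2 μ) atTop
      (𝓝 (eLpNorm (fun x => deriv P (u x) • g x) 2 μ)) := by
    refine tendsto_eLpNorm_of_sub (fun n => (hw n).memLp_gradient.1) hG ?_
    have := tendsto_eLpNorm_smul_sub hm (fun n x => hP1 _) hua
      (fun n => (hU n).memLp_gradient.1) hu.2.1 hUg
    refine this.congr fun n => ?_
    simp_rw [gradient_comp_left hPd (hU n)]
  have hlimP : Tendsto (fun n => eLpNorm (fun x => P (U n x)) 2 μ) atTop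
      (𝓝 (eLpNorm (fun x => P (u x)) 2 μ)) := by
    refine tendsto_eLpNorm_of_sub (fun n => (hw n).memLp.1) hPu ?_
    refine tendsto_of_tendsto_of_tendsto_of_le_of_le tendsto_const_nhds hUu (fun n => zero_le)
      fun n => ?_
    exact eLpNorm_mono fun x => by simpa using hPle (U n x) (u x)
  have hlim : Tendsto (fun n => (2⁻¹ * (δ * eLpNorm (gradient fun x => P (U n x)) 2 μ ^ 2 +
        K * (D * eLpNorm (fun x => P (U n x)) 2 μ ^ 2))).toReal) atTop
      (𝓝 (2⁻¹ * (δ * eLpNorm (fun x => deriv P (u x) • g x) 2 μ ^ 2 +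
        K * (D * eLpNorm (fun x => P (u x)) 2 μ ^ 2))).toReal) := by
    have hsq : Continuous fun x : ℝ≥0∞ => x ^ 2 := ENNReal.continuous_pow 2
    have l1 := ENNReal.Tendsto.const_mul (a := δ) ((hsq.tendsto _).comp hlimG) (Or.inr hδ)
    have l2 := ENNReal.Tendsto.const_mul (a := D) ((hsq.tendsto _).comp hlimP) (Or.inr hD)
    have l3 := ENNReal.Tendsto.const_mul (a := K) l2 (Or.inr hK)
    have l4 := ENNReal.Tendsto.const_mul (a := 2⁻¹) (l1.add l3) (Or.inr (by simp))
    refine (ENNReal.tendsto_toReal ?_).comp l4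
    exact ENNReal.mul_ne_top (by simp) (ENNReal.add_ne_top.2
      ⟨ENNReal.mul_ne_top hδ (ENNReal.pow_ne_top hG.eLpNorm_ne_top),
        ENNReal.mul_ne_top hK (ENNReal.mul_ne_top hD (ENNReal.pow_ne_top hPu.eLpNorm_ne_top))⟩)
  refine neg_integral_inner_smul_le hv hu.2.1 hU hUg hUa hβ hC hlim fun n => ?_
  refine (neg_integral_flux_le hd (fun x => hβp _) (hflux _ ((hU n).comp_left hβ hβ0))).trans ?_
  have hfin : (2⁻¹ * (δ * eLpNorm (gradient fun x => P (U n x)) 2 μ ^ 2 +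
        K * (D * eLpNorm (fun x => P (U n x)) 2 μ ^ 2))) ≠ ∞ :=
    ENNReal.mul_ne_top (by simp) (ENNReal.add_ne_top.2
      ⟨ENNReal.mul_ne_top hδ (ENNReal.pow_ne_top (hw n).memLp_gradient.eLpNorm_ne_top),
        ENNReal.mul_ne_top hK (ENNReal.mul_ne_top hD
          (ENNReal.pow_ne_top (hw n).memLp.eLpNorm_ne_top))⟩)
  have hle : ∫⁻ y in crossSection φ₀ c₀, 2⁻¹ * (‖d₁ y‖ₑ * ‖P (U n (lift y (-a)))‖ₑ ^ 2) ≤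
      2⁻¹ * (δ * eLpNorm (gradient fun x => P (U n x)) 2 μ ^ 2 +
        K * (D * eLpNorm (fun x => P (U n x)) 2 μ ^ 2)) := by
    rw [lintegral_const_mul' _ _ (by simp)]
    refine mul_le_mul_right ((htrace _ (hw n).contDiff_one _ hdm).trans ?_) _
    rw [eLpNorm_two_sq, eLpNorm_two_sq]
    refine add_le_add (mul_le_mul_right (lintegral_mono fun x => ?_) _)
      (mul_le_mul_right (mul_le_mul_left hd₁ _) _)
    rw [← ofReal_norm, ← ofReal_norm, norm_gradient]
  refine (integral_le_toReal_lintegral (ne_top_of_le_ne_top hfin hle) ?_).trans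
    (ENNReal.toReal_mono hfin hle)
  filter_upwards [hd] with y hy
  have e2 : (2⁻¹ : ℝ≥0∞) = ENNReal.ofReal 2⁻¹ := by
    rw [ENNReal.ofReal_inv_of_pos two_pos]; simp
  rw [← ofReal_norm, ← ofReal_norm, e2, ← ENNReal.ofReal_pow (norm_nonneg _),
    ← ENNReal.ofReal_mul (norm_nonneg _), ← ENNReal.ofReal_mul (by norm_num),
    Real.norm_of_nonneg hy.1]
  refine ENNReal.ofReal_le_ofReal ?_
  have h2 := mul_le_mul_of_nonneg_left (hβle (U n (lift y (-a)))) hy.1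
  rw [Real.norm_eq_abs, sq_abs]
  linarith

end HeatCylinder

/-! ### The weak formulation: limits in the test function, one null set of times. -/

namespace HeatCylinder

open Filter Topology Metric

/-- There are countably many test functions that approximate every test function in `C¹(K)`. -/
lemma exists_countable_tests {K : Set E3} (hK : IsCompact K) :
    ∃ D : ℕ → E3 → ℝ, (∀ n, IsTest (D n)) ∧ ∀ ψ : E3 → ℝ, IsTest ψ →
      ∃ (m : ℕ → ℕ) (ε : ℕ → ℝ), Tendsto ε atTop (𝓝 0) ∧
        ∀ j, ∀ x ∈ K, |D (m j) x - ψ x| ≤ ε j ∧ ‖gradient (D (m j)) x - gradient ψ x‖ ≤ ε j := by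
  -- The pair (ψ, ∇ψ) places test functions in the second countable space C(K, ℝ × E3); the induced
  -- topology is second countable, so a dense sequence exists.
  have : CompactSpace K := isCompact_iff_compactSpace.1 hK
  let X : Type := {ψ : E3 → ℝ // IsTest ψ}
  let J : X → C(K, ℝ × E3) := fun ψ =>
    ⟨fun x => (ψ.1 x, gradient ψ.1 x), (ψ.2.1.continuous.prodMk
      (continuous_gradient ψ.2.contDiff_one)).comp continuous_subtype_val⟩
  let : TopologicalSpace X := TopologicalSpace.induced J inferInstance
  have hJ : IsInducing J := ⟨rfl⟩
  have : SecondCountableTopology X := hJ.secondCountableTopology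
  have : Nonempty X := ⟨⟨fun _ => 0, contDiff_const, HasCompactSupport.zero⟩⟩
  refine ⟨fun n => (TopologicalSpace.denseSeq X n).1, fun n => (TopologicalSpace.denseSeq X n).2,
    fun ψ hψ => ?_⟩
  obtain ⟨y, hy, hlim⟩ := mem_closure_iff_seq_limit.1
    (TopologicalSpace.denseRange_denseSeq X (⟨ψ, hψ⟩ : X))
  choose m hm using hy
  refine ⟨m, fun j => dist (J (y j)) (J ⟨ψ, hψ⟩), ?_, fun j x hx => ?_⟩
  · exact tendsto_iff_dist_tendsto_zero.1 ((hJ.continuous.tendsto _).comp hlim)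
  · have h := (J (y j)).dist_apply_le_dist (g := J ⟨ψ, hψ⟩) ⟨x, hx⟩
    rw [Prod.dist_eq, max_le_iff, Real.dist_eq] at h
    change |(TopologicalSpace.denseSeq X (m j)).1 x - ψ x| ≤ _ ∧
      ‖gradient (TopologicalSpace.denseSeq X (m j)).1 x - gradient ψ x‖ ≤ _
    rw [hm, ← dist_eq_norm]
    exact h

/-- The spatial part of the weak formulation, tested with `q` whose gradient is `p`. -/
noncomputable def pairing (μ : Measure E3) (κ : ℝ) (F : ℝ × E3 → ℝ) (G : ℝ × E3 → E3) (q : E3 → ℝ)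
    (p : E3 → E3) (r : ℝ) : ℝ :=
  ∫ x, (F (r, x) * q x + κ * inner ℝ (G (r, x)) (p x)) ∂μ

section Pairing

variable {μ : Measure E3} {κ : ℝ} {F : ℝ × E3 → ℝ} {G : ℝ × E3 → E3}

lemma ae_integrable_slices [SFinite μ] (hF : Integrable F (volume.prod μ)) (hG : MemLp G 2 (volume.prod μ)) :
    ∀ᵐ r : ℝ, Integrable (fun x => F (r, x)) μ ∧ MemLp (fun x => G (r, x)) 2 μ := by
  have h1 := hG.1.prodMk_left
  have h2 : Integrable (fun z => ‖G z‖ ^ 2) (volume.prod μ) := hG.integrable_norm_pow (by norm_num)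
  filter_upwards [hF.prod_right_ae, h1, h2.prod_right_ae] with r hr hr1 hr2
  exact ⟨hr, (memLp_two_iff_integrable_sq_norm hr1).2 hr2⟩

lemma integrable_pairing_integrand {f : E3 → ℝ} {w : E3 → E3} (hf : Integrable f μ)
    (hw : MemLp w 2 μ) {q : E3 → ℝ} {p : E3 → E3} {C : ℝ} (hq : AEStronglyMeasurable q μ)
    (hqC : ∀ᵐ x ∂μ, |q x| ≤ C) (hp : MemLp p 2 μ) :
    Integrable (fun x => f x * q x) μ ∧ Integrable (fun x => κ * inner ℝ (w x) (p x)) μ :=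
  ⟨hf.mul_bdd hq hqC, (integrable_inner_of_memLp hw hp).const_mul κ⟩

lemma abs_inner_le_sq_add_sq (x y : E3) : |inner ℝ x y| ≤ ‖x‖ ^ 2 + ‖y‖ ^ 2 := by
  have := abs_real_inner_le_norm x y
  nlinarith [sq_nonneg (‖x‖ - ‖y‖), sq_nonneg ‖x‖, sq_nonneg ‖y‖]

/-- A bound that is uniform over test pairs with a common sup bound and a common L₂ bound; it
provides the majorant in time for dominated convergence. -/
lemma norm_pairing_le {r : ℝ} (hf : Integrable (fun x => F (r, x)) μ)
    (hw : MemLp (fun x => G (r, x)) 2 μ) {q : E3 → ℝ} {p : E3 → E3} {C : ℝ}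
    (hqC : ∀ᵐ x ∂μ, |q x| ≤ C) (hp : MemLp p 2 μ) :
    ‖pairing μ κ F G q p r‖ ≤
      C * (∫ x, ‖F (r, x)‖ ∂μ) + |κ| * ((∫ x, ‖G (r, x)‖ ^ 2 ∂μ) + ∫ x, ‖p x‖ ^ 2 ∂μ) := by
  have i1 : Integrable (fun x => ‖G (r, x)‖ ^ 2) μ := hw.integrable_norm_pow (by norm_num)
  have i2 : Integrable (fun x => ‖p x‖ ^ 2) μ := hp.integrable_norm_pow (by norm_num)
  have i3 : Integrable (fun x => |κ| * (‖G (r, x)‖ ^ 2 + ‖p x‖ ^ 2)) μ := (i1.add i2).const_mul _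
  rw [← integral_add i1 i2, ← integral_const_mul, ← integral_const_mul,
    ← integral_add (hf.norm.const_mul C) i3]
  refine norm_integral_le_of_norm_le ((hf.norm.const_mul C).add i3) ?_
  filter_upwards [hqC] with x hx
  refine (norm_add_le _ _).trans (add_le_add ?_ ?_)
  · rw [norm_mul, mul_comm]
    exact mul_le_mul_of_nonneg_right hx (norm_nonneg _)
  · rw [norm_mul]
    exact mul_le_mul_of_nonneg_left (abs_inner_le_sq_add_sq _ _) (abs_nonneg _)

lemma aestronglyMeasurable_pairing [SFinite μ] (hF : Integrable F (volume.prod μ))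
    (hG : MemLp G 2 (volume.prod μ)) {q : E3 → ℝ} {p : E3 → E3} (hq : AEStronglyMeasurable q μ)
    (hp : AEStronglyMeasurable p μ) :
    AEStronglyMeasurable (pairing μ κ F G q p) volume := by
  have h : AEStronglyMeasurable (fun z : ℝ × E3 => F z * q z.2 + κ * inner ℝ (G z) (p z.2))
      (volume.prod μ) :=
    (hF.1.mul hq.comp_snd).add ((hG.1.inner hp.comp_snd).const_mul κ)
  exact h.integral_prod_right'

/-- A dominating function for the pairing. -/
lemma intervalIntegrable_bound [SFinite μ] (hF : Integrable F (volume.prod μ))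
    (hG : MemLp G 2 (volume.prod μ)) (C M a b : ℝ) :
    IntervalIntegrable (fun r => C * (∫ x, ‖F (r, x)‖ ∂μ) +
      |κ| * ((∫ x, ‖G (r, x)‖ ^ 2 ∂μ) + M)) volume a b := by
  have h2 : Integrable (fun z => ‖G z‖ ^ 2) (volume.prod μ) := hG.integrable_norm_pow (by norm_num)
  have i1 : Integrable (fun r => ∫ x, ‖F (r, x)‖ ∂μ) volume := hF.norm.integral_prod_left
  have i2 : Integrable (fun r => ∫ x, ‖G (r, x)‖ ^ 2 ∂μ) volume := h2.integral_prod_left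
  exact (i1.intervalIntegrable.const_mul C).add
    ((i2.intervalIntegrable.add intervalIntegrable_const).const_mul _)

lemma intervalIntegrable_pairing [SFinite μ] (hF : Integrable F (volume.prod μ))
    (hG : MemLp G 2 (volume.prod μ)) {q : E3 → ℝ} {p : E3 → E3} {C : ℝ}
    (hq : AEStronglyMeasurable q μ) (hqC : ∀ᵐ x ∂μ, |q x| ≤ C) (hp : MemLp p 2 μ) (a b : ℝ) :
    IntervalIntegrable (pairing μ κ F G q p) volume a b := by
  refine (intervalIntegrable_bound (κ := κ) hF hG C (∫ x, ‖p x‖ ^ 2 ∂μ) a b).mono_fun'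
    (aestronglyMeasurable_pairing hF hG hq hp.1).restrict (ae_restrict_of_ae ?_)
  filter_upwards [ae_integrable_slices hF hG] with r hr
  exact norm_pairing_le hr.1 hr.2 hqC hp

/-- Bounded a.e. convergence of `qₙ` with `L²` convergence of the gradients suffices to pass to the
limit in the weak formulation. -/
lemma tendsto_integral_pairing [SFinite μ] (hF : Integrable F (volume.prod μ))
    (hG : MemLp G 2 (volume.prod μ)) {Q : ℕ → E3 → ℝ} {q : E3 → ℝ} {p : ℕ → E3 → E3} {p₀ : E3 → E3}
    {C : ℝ} (hQm : ∀ n, AEStronglyMeasurable (Q n) μ) (hQC : ∀ n, ∀ᵐ x ∂μ, |Q n x| ≤ C)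
    (hQ : ∀ᵐ x ∂μ, Tendsto (fun n => Q n x) atTop (𝓝 (q x))) (hp : ∀ n, MemLp (p n) 2 μ)
    (hp₀ : MemLp p₀ 2 μ)
    (hlim : Tendsto (fun n => eLpNorm (fun x => p n x - p₀ x) 2 μ) atTop (𝓝 0)) (a b : ℝ) :
    Tendsto (fun n => ∫ r in a..b, pairing μ κ F G (Q n) (p n) r) atTop
      (𝓝 (∫ r in a..b, pairing μ κ F G q p₀ r)) := by
  have hq : AEStronglyMeasurable q μ := aestronglyMeasurable_of_tendsto_ae _ hQm hQ
  have hQC' : ∀ᵐ x ∂μ, ∀ n, |Q n x| ≤ C := ae_all_iff.2 hQC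
  have hqC : ∀ᵐ x ∂μ, |q x| ≤ C := by
    filter_upwards [hQ, hQC'] with x hx hx'
    exact le_of_tendsto hx.abs (Eventually.of_forall hx')
  obtain ⟨M, hM⟩ : ∃ M : ℝ, ∀ n, ∫ x, ‖p n x‖ ^ 2 ∂μ ≤ M := by
    have h1 := ((ENNReal.tendsto_toReal hp₀.eLpNorm_ne_top).comp
      (tendsto_eLpNorm_of_sub (fun n => (hp n).1) hp₀ hlim)).pow 2
    obtain ⟨M, hM⟩ := h1.bddAbove_range
    refine ⟨M, fun n => le_trans (le_of_eq ?_) (hM ⟨n, rfl⟩)⟩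
    simp only [Function.comp_apply]
    rw [← ENNReal.toReal_pow, eLpNorm_two_sq, integral_eq_lintegral_of_nonneg_ae
      (Eventually.of_forall fun x => by positivity) (((hp n).integrable_norm_pow (p := 2) (by norm_num)).1)]
    congr 1
    refine lintegral_congr fun x => ?_
    rw [ENNReal.ofReal_pow (norm_nonneg _), ofReal_norm]
  refine intervalIntegral.tendsto_integral_filter_of_dominated_convergence
    (fun r => C * (∫ x, ‖F (r, x)‖ ∂μ) + |κ| * ((∫ x, ‖G (r, x)‖ ^ 2 ∂μ) + M))
    (Eventually.of_forall fun n => (aestronglyMeasurable_pairing hF hG (hQm n) (hp n).1).restrict)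
    (Eventually.of_forall fun n => ?_) (intervalIntegrable_bound hF hG C M a b) ?_
  · filter_upwards [ae_integrable_slices hF hG] with r hr _
    refine (norm_pairing_le hr.1 hr.2 (hQC n) (hp n)).trans ?_
    gcongr
    exact hM n
  · filter_upwards [ae_integrable_slices hF hG] with r hr _
    have e : ∀ {q' : E3 → ℝ} {p' : E3 → E3}, AEStronglyMeasurable q' μ → (∀ᵐ x ∂μ, |q' x| ≤ C) →
        MemLp p' 2 μ → pairing μ κ F G q' p' r =
          (∫ x, F (r, x) * q' x ∂μ) + κ * ∫ x, inner ℝ (G (r, x)) (p' x) ∂μ := by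
      intro q' p' h1 h2 h3
      obtain ⟨i1, i2⟩ := integrable_pairing_integrand (κ := κ) hr.1 hr.2 h1 h2 h3
      rw [pairing, integral_add i1 i2, integral_const_mul]
    rw [e hq hqC hp₀]
    simp_rw [fun n => e (hQm n) (hQC n) (hp n)]
    refine Tendsto.add ?_ ((tendsto_integral_inner hr.2 hp hp₀ hlim).const_mul κ)
    refine tendsto_integral_of_dominated_convergence (fun x => ‖F (r, x)‖ * C)
      (fun n => hr.1.1.mul (hQm n)) (hr.1.norm.mul_const C) (fun n => ?_) ?_
    · filter_upwards [hQC n] with x hx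
      rw [norm_mul]
      exact mul_le_mul_of_nonneg_left hx (norm_nonneg _)
    · filter_upwards [hQ] with x hx
      exact hx.const_mul _

lemma tendsto_integral_mul_of_bounded {w : E3 → ℝ} (hw : Integrable w μ) {Q : ℕ → E3 → ℝ}
    {q : E3 → ℝ} {C : ℝ} (hQm : ∀ n, AEStronglyMeasurable (Q n) μ)
    (hQC : ∀ n, ∀ᵐ x ∂μ, |Q n x| ≤ C)
    (hQ : ∀ᵐ x ∂μ, Tendsto (fun n => Q n x) atTop (𝓝 (q x))) :
    Tendsto (fun n => ∫ x, w x * Q n x ∂μ) atTop (𝓝 (∫ x, w x * q x ∂μ)) := by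
  refine tendsto_integral_of_dominated_convergence (fun x => ‖w x‖ * C)
    (fun n => hw.1.mul (hQm n)) (hw.norm.mul_const C) (fun n => ?_) ?_
  · filter_upwards [hQC n] with x hx
    rw [norm_mul]
    exact mul_le_mul_of_nonneg_left hx (norm_nonneg _)
  · filter_upwards [hQ] with x hx
    exact hx.const_mul _

end Pairing

/-- The exceptional null set of times in the weak formulation does not depend on the test
function. -/
lemma ae_forall_test {Ω : Set E3} (hΩb : Bornology.IsBounded Ω) {κ : ℝ}
    {F : ℝ × E3 → ℝ} {G : ℝ × E3 → E3} (hF : Integrable F (volume.prod (volume.restrict Ω)))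
    (hG : MemLp G 2 (volume.prod (volume.restrict Ω))) {ν : Measure ℝ} {θ : ℝ → E3 → ℝ}
    {θ₀ : E3 → ℝ} (hθ : ∀ᵐ s ∂ν, Integrable (θ s) (volume.restrict Ω))
    (hθ₀ : Integrable θ₀ (volume.restrict Ω))
    (h : ∀ ψ : E3 → ℝ, IsTest ψ → ∀ᵐ s ∂ν, ∫ x in Ω, θ s x * ψ x = (∫ x in Ω, θ₀ x * ψ x) -
      ∫ r in (0 : ℝ)..s, pairing (volume.restrict Ω) κ F G ψ (gradient ψ) r) :
    ∀ᵐ s ∂ν, ∀ ψ : E3 → ℝ, IsTest ψ → ∫ x in Ω, θ s x * ψ x = (∫ x in Ω, θ₀ x * ψ x) -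
      ∫ r in (0 : ℝ)..s, pairing (volume.restrict Ω) κ F G ψ (gradient ψ) r := by
  -- Fix a time at which the identity holds for all members of the countable family. Both sides pass
  -- to the limit under C¹ convergence on the closure of Ω, which yields every test function at that
  -- time.
  obtain ⟨D, hD, hDd⟩ := exists_countable_tests hΩb.isCompact_closure
  have : IsFiniteMeasure (volume.restrict Ω) :=
    ⟨by rw [Measure.restrict_apply_univ]; exact hΩb.measure_lt_top⟩
  filter_upwards [hθ, ae_all_iff.2 fun n => h (D n) (hD n)] with s hs hsn ψ hψ
  obtain ⟨m, ε, hε, hm⟩ := hDd ψ hψ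
  have hcl : ∀ᵐ x ∂(volume.restrict Ω), x ∈ closure Ω :=
    (ae_restrict_mem isClosed_closure.measurableSet).filter_mono
      (ae_mono (Measure.restrict_mono subset_closure le_rfl))
  obtain ⟨C₁, hC₁⟩ := hψ.2.exists_bound_of_continuous hψ.1.continuous
  obtain ⟨E, hE⟩ := hε.bddAbove_range
  have hQm : ∀ n, AEStronglyMeasurable (D (m n)) (volume.restrict Ω) := fun n =>
    (hD _).1.continuous.aestronglyMeasurable
  have hQC : ∀ n, ∀ᵐ x ∂(volume.restrict Ω), |D (m n) x| ≤ C₁ + E := by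
    intro n
    filter_upwards [hcl] with x hx
    have h1 := (hm n x hx).1.trans (hE ⟨n, rfl⟩)
    have h2 : |ψ x| ≤ C₁ := hC₁ x
    calc |D (m n) x| = |ψ x + (D (m n) x - ψ x)| := by rw [add_sub_cancel]
      _ ≤ C₁ + E := (abs_add_le _ _).trans (add_le_add h2 h1)
  have hQ : ∀ᵐ x ∂(volume.restrict Ω), Tendsto (fun n => D (m n) x) atTop (𝓝 (ψ x)) := by
    filter_upwards [hcl] with x hx
    rw [tendsto_iff_dist_tendsto_zero]
    exact squeeze_zero (fun _ => dist_nonneg) (fun n => (hm n x hx).1) hε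
  have hlim : Tendsto (fun n => eLpNorm (fun x => gradient (D (m n)) x - gradient ψ x) 2
      (volume.restrict Ω)) atTop (𝓝 0) := by
    have h1 : Tendsto (fun n => ENNReal.ofReal (ε n) * eLpNorm (fun _ => (1 : ℝ)) 2
        (volume.restrict Ω)) atTop (𝓝 0) := by
      have := ENNReal.Tendsto.mul_const (b := eLpNorm (fun _ : E3 => (1 : ℝ)) 2 (volume.restrict Ω))
        (ENNReal.tendsto_ofReal hε) (Or.inr (memLp_const 1).eLpNorm_ne_top)
      simpa using this
    refine tendsto_of_tendsto_of_tendsto_of_le_of_le tendsto_const_nhds h1 (fun n => zero_le)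
      fun n => ?_
    refine eLpNorm_le_mul_eLpNorm_of_ae_le_mul ?_ 2
    filter_upwards [hcl] with x hx
    simpa using (hm n x hx).2
  have l1 := tendsto_integral_mul_of_bounded hs hQm hQC hQ
  have l2 := tendsto_integral_mul_of_bounded hθ₀ hQm hQC hQ
  have l3 := tendsto_integral_pairing (κ := κ) hF hG hQm hQC hQ
    (fun n => (hD (m n)).memLp_gradient) hψ.memLp_gradient hlim 0 s
  exact tendsto_nhds_unique l1 ((l2.sub l3).congr fun n => (hsn (m n)).symm)

end HeatCylinder

/-! ### Time increments tested with convex functions, and translation errors. -/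

namespace HeatCylinder

open Filter Topology Metric

lemma integrable_comp_of_abs_deriv_le {α : Type*} [MeasurableSpace α] {μ : Measure α} {β : ℝ → ℝ}
    (hβ : Differentiable ℝ β) (hβ0 : β 0 = 0) {C : ℝ} (hC : ∀ r, |deriv β r| ≤ C) {w : α → ℝ}
    (hw : Integrable w μ) : Integrable (fun x => β (w x)) μ :=
  (hw.norm.const_mul C).mono' (hβ.continuous.comp_aestronglyMeasurable hw.1)
    (Eventually.of_forall fun x => by
      simpa [hβ0] using abs_sub_le_of_abs_deriv_le hβ hC (w x) 0)

/-- Testing the increment of the weak formulation with `β' ∘ w`, for convex `β`. -/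
lemma integral_sub_le_of_increment {φ₀ : E2 → ℝ} {c₀ a : ℝ} (hsec : IsRegularSection φ₀ c₀)
    (ha : 0 < a) {κ : ℝ} {F : ℝ × E3 → ℝ} {G : ℝ × E3 → E3}
    (hF : Integrable F (volume.prod (volume.restrict (cylinder φ₀ c₀ a))))
    (hG : MemLp G 2 (volume.prod (volume.restrict (cylinder φ₀ c₀ a))))
    {w w' : E3 → ℝ} {gw : E3 → E3} (hw : HasWeakGradient (cylinder φ₀ c₀ a) w gw)
    (hw' : MemLp w' 2 (volume.restrict (cylinder φ₀ c₀ a))) {s' s : ℝ}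
    (hdiff : ∀ ψ : E3 → ℝ, IsTest ψ → (∫ x in cylinder φ₀ c₀ a, w x * ψ x) -
      ∫ x in cylinder φ₀ c₀ a, w' x * ψ x =
      -∫ r in s'..s, pairing (volume.restrict (cylinder φ₀ c₀ a)) κ F G ψ (gradient ψ) r)
    {β : ℝ → ℝ} (hβ : ContDiff ℝ ((⊤ : ℕ∞) : WithTop ℕ∞) β) (hβ0 : β 0 = 0) (hβ0' : deriv β 0 = 0)
    {C C₂ : ℝ} (hC : ∀ r, |deriv β r| ≤ C) (hC₂ : ∀ r, |deriv (deriv β) r| ≤ C₂)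
    (hconv : ∀ x y, β x - β y ≤ deriv β x * (x - y)) :
    (∫ x in cylinder φ₀ c₀ a, β (w x)) - ∫ x in cylinder φ₀ c₀ a, β (w' x) ≤
      -∫ r in s'..s, pairing (volume.restrict (cylinder φ₀ c₀ a)) κ F G
        (fun x => deriv β (w x)) (fun x => deriv (deriv β) (w x) • gw x) r := by
  have hfin : IsFiniteMeasure (volume.restrict (cylinder φ₀ c₀ a)) :=
    ⟨by rw [Measure.restrict_apply_univ]; exact (isBounded_cylinder hsec).measure_lt_top⟩
  set μ := volume.restrict (cylinder φ₀ c₀ a)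
  -- The tests are β'(Uₙ) with Uₙ smooth and converging to w; β'(0) = 0 keeps their supports
  -- compact. In the limit the test is β'(w), and convexity gives β(w) - β(w') ≤ β'(w)(w - w'). Only
  -- the later state w needs a gradient.
  obtain ⟨U, hU, -, hUg, hUa, -⟩ := exists_test_approx hsec ha hw
  have hβ' : ContDiff ℝ ((⊤ : ℕ∞) : WithTop ℕ∞) (deriv β) := (contDiff_infty_iff_deriv.1 hβ).2
  have hβ'' : Continuous (deriv (deriv β)) := hβ'.continuous_deriv (by simp)
  have hwi : Integrable w μ := hw.1.integrable (by norm_num)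
  have hwi' : Integrable w' μ := hw'.integrable (by norm_num)
  have ht : ∀ n, IsTest fun x => deriv β (U n x) := fun n => (hU n).comp_left hβ' hβ0'
  have hm2 : ∀ n, AEStronglyMeasurable (fun x => deriv (deriv β) (U n x)) μ := fun n =>
    (hβ''.comp (hU n).1.continuous).aestronglyMeasurable
  have ha1 : ∀ᵐ x ∂μ, Tendsto (fun n => deriv β (U n x)) atTop (𝓝 (deriv β (w x))) := by
    filter_upwards [hUa] with x hx
    exact (hβ'.continuous.tendsto _).comp hx
  have ha2 : ∀ᵐ x ∂μ,
      Tendsto (fun n => deriv (deriv β) (U n x)) atTop (𝓝 (deriv (deriv β) (w x))) := by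
    filter_upwards [hUa] with x hx
    exact (hβ''.tendsto _).comp hx
  have hlim : Tendsto (fun n => eLpNorm (fun x => gradient (fun x => deriv β (U n x)) x -
      deriv (deriv β) (w x) • gw x) 2 μ) atTop (𝓝 0) := by
    refine (tendsto_eLpNorm_smul_sub hm2 (fun n x => hC₂ _) ha2
      (fun n => (hU n).memLp_gradient.1) hw.2.1 hUg).congr fun n => ?_
    simp_rw [gradient_comp_left (hβ'.differentiable (by simp)) (hU n)]
  have hp₀ : MemLp (fun x => deriv (deriv β) (w x) • gw x) 2 μ :=
    hw.2.1.of_le_mul ((hβ''.comp_aestronglyMeasurable hw.1.1).smul hw.2.1.1) (c := C₂)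
      (Eventually.of_forall fun x => by
        rw [norm_smul]; exact mul_le_mul_of_nonneg_right (hC₂ _) (norm_nonneg _))
  have hm1 : ∀ n, AEStronglyMeasurable (fun x => deriv β (U n x)) μ := fun n =>
    (ht n).1.continuous.aestronglyMeasurable
  have hb1 : ∀ n, ∀ᵐ x ∂μ, |deriv β (U n x)| ≤ C := fun n => Eventually.of_forall fun x => hC _
  have l1 := (tendsto_integral_mul_of_bounded hwi hm1 hb1 ha1).sub
    (tendsto_integral_mul_of_bounded hwi' hm1 hb1 ha1)
  have l2 := (tendsto_integral_pairing (κ := κ) hF hG hm1 hb1 ha1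
    (fun n => (ht n).memLp_gradient) hp₀ hlim s' s).neg
  have e := tendsto_nhds_unique l1 (l2.congr fun n => (hdiff _ (ht n)).symm)
  rw [← e]
  have hmw : AEStronglyMeasurable (fun x => deriv β (w x)) μ :=
    hβ'.continuous.comp_aestronglyMeasurable hw.1.1
  have hbw : ∀ᵐ x ∂μ, ‖deriv β (w x)‖ ≤ C := Eventually.of_forall fun x => hC _
  have hβd : Differentiable ℝ β := hβ.differentiable (by simp)
  rw [← integral_sub (integrable_comp_of_abs_deriv_le hβd hβ0 hC hwi)
    (integrable_comp_of_abs_deriv_le hβd hβ0 hC hwi'),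
    ← integral_sub (hwi.mul_bdd hmw hbw) (hwi'.mul_bdd hmw hbw)]
  refine integral_mono ((integrable_comp_of_abs_deriv_le hβd hβ0 hC hwi).sub
    (integrable_comp_of_abs_deriv_le hβd hβ0 hC hwi'))
    ((hwi.mul_bdd hmw hbw).sub (hwi'.mul_bdd hmw hbw)) fun x => ?_
  have := hconv (w x) (w' x)
  simp only
  linarith

/-- The time average of the pairing differs from its value at `s` by translation errors. -/
lemma ofReal_pairing_sub_le {μ : Measure E3} [SFinite μ] {κ : ℝ} {F : ℝ × E3 → ℝ}
    {G : ℝ × E3 → E3} (hF : Integrable F (volume.prod μ)) (hG : MemLp G 2 (volume.prod μ))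
    {q : E3 → ℝ} {p : E3 → E3} {C : ℝ} (hq : AEStronglyMeasurable q μ) (hqC : ∀ᵐ x ∂μ, |q x| ≤ C)
    (hp : MemLp p 2 μ) {s h : ℝ} (hh : 0 < h)
    (hs : Integrable (fun x => F (s, x)) μ ∧ MemLp (fun x => G (s, x)) 2 μ) :
    ENNReal.ofReal (-(∫ r in (s - h)..s, pairing μ κ F G q p r) + h * pairing μ κ F G q p s) ≤
      ∫⁻ σ in Ioo 0 h, ∫⁻ x, (ENNReal.ofReal C * ‖F (s - σ, x) - F (s, x)‖ₑ +
        ‖κ‖ₑ * (‖G (s - σ, x) - G (s, x)‖ₑ * ‖p x‖ₑ)) ∂μ := by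
  have hi : IntervalIntegrable (fun σ => pairing μ κ F G q p (s - σ)) volume 0 h := by
    have := (intervalIntegrable_pairing (κ := κ) hF hG hq hqC hp (s - 0) (s - h)).comp_sub_left s
    simpa using this
  -- The test pair is frozen at time s, so the discrepancy is an integral over σ ∈ (0, h) of
  -- backward differences of F and G alone.
  have e1 : -(∫ r in (s - h)..s, pairing μ κ F G q p r) + h * pairing μ κ F G q p s =
      ∫ σ in (0 : ℝ)..h, (pairing μ κ F G q p s - pairing μ κ F G q p (s - σ)) := by
    rw [intervalIntegral.integral_sub intervalIntegrable_const hi,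
      intervalIntegral.integral_comp_sub_left (fun r => pairing μ κ F G q p r),
      intervalIntegral.integral_const]
    simp only [sub_zero, smul_eq_mul]
    ring
  rw [e1, intervalIntegral.integral_of_le hh.le, integral_Ioc_eq_integral_Ioo]
  refine (Real.ofReal_le_enorm _).trans ((enorm_integral_le_lintegral_enorm _).trans ?_)
  have hsl : ∀ᵐ σ : ℝ, Integrable (fun x => F (s - σ, x)) μ ∧ MemLp (fun x => G (s - σ, x)) 2 μ :=
    (quasiMeasurePreserving_sub_left volume s).ae (ae_integrable_slices hF hG)
  refine lintegral_mono_ae (ae_restrict_of_ae ?_)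
  filter_upwards [hsl] with σ hσ
  obtain ⟨i1, i2⟩ := integrable_pairing_integrand (κ := κ) hs.1 hs.2 hq hqC hp
  obtain ⟨j1, j2⟩ := integrable_pairing_integrand (κ := κ) hσ.1 hσ.2 hq hqC hp
  have i3 : Integrable (fun x => F (s, x) * q x + κ * inner ℝ (G (s, x)) (p x)) μ := i1.add i2
  have j3 : Integrable (fun x => F (s - σ, x) * q x + κ * inner ℝ (G (s - σ, x)) (p x)) μ :=
    j1.add j2
  rw [pairing, pairing, ← integral_sub i3 j3]
  refine (enorm_integral_le_lintegral_enorm _).trans (lintegral_mono_ae ?_)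
  filter_upwards [hqC] with x hx
  have e2 : F (s, x) * q x + κ * inner ℝ (G (s, x)) (p x) -
      (F (s - σ, x) * q x + κ * inner ℝ (G (s - σ, x)) (p x)) =
      -(q x * (F (s - σ, x) - F (s, x))) + -(κ * inner ℝ (G (s - σ, x) - G (s, x)) (p x)) := by
    rw [inner_sub_left]; ring
  rw [e2]
  refine (enorm_add_le _ _).trans (add_le_add ?_ ?_)
  · rw [enorm_neg, enorm_mul]
    refine mul_le_mul_left ?_ _
    rw [← ofReal_norm]
    exact ENNReal.ofReal_le_ofReal hx
  · rw [enorm_neg, enorm_mul]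
    refine mul_le_mul_right ?_ _
    rw [← ofReal_norm, ← ofReal_norm, ← ofReal_norm, ← ENNReal.ofReal_mul (norm_nonneg _)]
    exact ENNReal.ofReal_le_ofReal (norm_inner_le_norm _ _)

/-- The accumulated translation error over `ℝ × E3`, per unit of the averaging length. -/
lemma exists_translation_error_le {F : ℝ × E3 → ℝ} {G p : ℝ × E3 → E3}
    (hF : Integrable F volume) (hG : MemLp G 2 volume) (hp : MemLp p 2 volume) (κ C : ℝ)
    {ε : ℝ≥0∞} (hε : 0 < ε) :
    ∃ η > 0, ∀ h, 0 < h → h < η →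
      ∫⁻ s : ℝ, ∫⁻ σ in Ioo 0 h, ∫⁻ x, (ENNReal.ofReal C * ‖F (s - σ, x) - F (s, x)‖ₑ +
        ‖κ‖ₑ * (‖G (s - σ, x) - G (s, x)‖ₑ * ‖p (s, x)‖ₑ)) ≤ ε * ENNReal.ofReal h := by
  have hF1 : MemLp F 1 volume := memLp_one_iff_integrable.2 hF
  have hι : Continuous fun σ : ℝ => ((σ, 0) : ℝ × E3) := by fun_prop
  have hι0 : Tendsto (fun σ : ℝ => ((σ, 0) : ℝ × E3)) (𝓝 0) (𝓝 0) := hι.tendsto' _ _ rfl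
  have hH : (volume : Measure (ℝ × E3)).IsAddHaarMeasure :=
    inferInstanceAs ((volume : Measure ℝ).prod (volume : Measure E3)).IsAddHaarMeasure
  -- Translations are used in the time direction only, in L₁ for F and in L₂ for G. For each σ below
  -- η the error, integrated over space and time, is less than ε, and integrating over σ ∈ (0, h)
  -- gives εh.
  have lF := (tendsto_eLpNorm_translate (p := 1) (by norm_num) hF1).comp hι0
  have lG := (tendsto_eLpNorm_translate (p := 2) (by norm_num) hG).comp hι0
  have l1 := ENNReal.Tendsto.const_mul (a := ENNReal.ofReal C) lF (Or.inr ENNReal.ofReal_ne_top)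
  have l2 := ENNReal.Tendsto.const_mul (a := ‖κ‖ₑ)
    (ENNReal.Tendsto.mul_const (b := eLpNorm p 2 volume) lG (Or.inr hp.eLpNorm_ne_top))
    (Or.inr enorm_ne_top)
  have l3 := l1.add l2
  simp only [mul_zero, zero_mul, add_zero] at l3
  obtain ⟨η, hη, hηε⟩ := Metric.eventually_nhds_iff.1 (l3.eventually (gt_mem_nhds hε))
  refine ⟨η, hη, fun h hh hhη => ?_⟩
  have q1 : Measure.QuasiMeasurePreserving
      (fun z : (ℝ × ℝ) × E3 => (z.1.1 - z.1.2, z.2))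
      (((volume : Measure ℝ).prod volume).prod volume) (volume.prod volume) :=
    QuasiMeasurePreserving.prodMap (quasiMeasurePreserving_sub volume volume) (Measure.QuasiMeasurePreserving.id _)
  have q2 : Measure.QuasiMeasurePreserving
      (fun z : (ℝ × ℝ) × E3 => (z.1.1, z.2))
      (((volume : Measure ℝ).prod volume).prod volume) (volume.prod volume) :=
    QuasiMeasurePreserving.prodMap Measure.quasiMeasurePreserving_fst (Measure.QuasiMeasurePreserving.id _)
  have hm : AEMeasurable (fun z : (ℝ × ℝ) × E3 =>
      ENNReal.ofReal C * ‖F (z.1.1 - z.1.2, z.2) - F (z.1.1, z.2)‖ₑ +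
        ‖κ‖ₑ * (‖G (z.1.1 - z.1.2, z.2) - G (z.1.1, z.2)‖ₑ * ‖p (z.1.1, z.2)‖ₑ))
      (((volume : Measure ℝ).prod volume).prod volume) :=
    (((hF.1.comp_quasiMeasurePreserving q1).sub
      (hF.1.comp_quasiMeasurePreserving q2)).enorm.const_mul _).add
    ((((hG.1.comp_quasiMeasurePreserving q1).sub
      (hG.1.comp_quasiMeasurePreserving q2)).enorm.mul
      (hp.1.comp_quasiMeasurePreserving q2).enorm).const_mul _)
  rw [lintegral_lintegral_swap (hm.lintegral_prod_right'.mono_measure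
    (Measure.prod_mono le_rfl Measure.restrict_le_self))]
  calc _ ≤ ∫⁻ σ in Ioo 0 h, ε := by
        refine setLIntegral_mono' measurableSet_Ioo fun σ hσ => ?_
        have hlt := hηε (y := σ) (by
          rw [Real.dist_eq, sub_zero, abs_of_pos hσ.1]; exact hσ.2.trans hhη)
        refine le_trans ?_ hlt.le
        have qσ : Measure.QuasiMeasurePreserving (fun z : ℝ × E3 => z - (σ, 0)) volume volume :=
          (measurePreserving_sub_right volume ((σ, 0) : ℝ × E3)).quasiMeasurePreserving
        have mF : AEStronglyMeasurable (fun z : ℝ × E3 => F (z - (σ, 0)) - F z) volume :=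
          (hF.1.comp_quasiMeasurePreserving qσ).sub hF.1
        have mG : AEStronglyMeasurable (fun z : ℝ × E3 => G (z - (σ, 0)) - G z) volume :=
          (hG.1.comp_quasiMeasurePreserving qσ).sub hG.1
        have mGp : AEMeasurable (fun z : ℝ × E3 => ‖G (z - (σ, 0)) - G z‖ₑ * ‖p z‖ₑ) volume :=
          mG.enorm.mul hp.1.enorm
        have mt : AEMeasurable (fun z : ℝ × E3 => ENNReal.ofReal C * ‖F (z - (σ, 0)) - F z‖ₑ +
            ‖κ‖ₑ * (‖G (z - (σ, 0)) - G z‖ₑ * ‖p z‖ₑ)) volume :=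
          (mF.enorm.const_mul _).add (mGp.const_mul _)
        have e : ∫⁻ s : ℝ, ∫⁻ x : E3, (ENNReal.ofReal C * ‖F (s - σ, x) - F (s, x)‖ₑ +
            ‖κ‖ₑ * (‖G (s - σ, x) - G (s, x)‖ₑ * ‖p (s, x)‖ₑ)) =
            ∫⁻ z : ℝ × E3, (ENNReal.ofReal C * ‖F (z - (σ, 0)) - F z‖ₑ +
            ‖κ‖ₑ * (‖G (z - (σ, 0)) - G z‖ₑ * ‖p z‖ₑ)) := by
          rw [Measure.volume_eq_prod, lintegral_prod
            (fun z : ℝ × E3 => ENNReal.ofReal C * ‖F (z - (σ, 0)) - F z‖ₑ +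
              ‖κ‖ₑ * (‖G (z - (σ, 0)) - G z‖ₑ * ‖p z‖ₑ)) mt]
          simp only [Prod.mk_sub_mk, sub_zero]
        rw [e, lintegral_add_left' (mF.enorm.const_mul _), lintegral_const_mul'' _ mF.enorm,
          lintegral_const_mul'' _ mGp]
        refine add_le_add ?_ (mul_le_mul_right (lintegral_enorm_mul_enorm_le mG hp.1) _)
        simp only [Function.comp_apply]
        rw [eLpNorm_one_eq_lintegral_enorm]
    _ = ε * ENNReal.ofReal h := by
        rw [lintegral_const, Measure.restrict_apply_univ, Real.volume_Ioo, sub_zero]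

end HeatCylinder

/-! ### The entropy inequality. -/

namespace HeatCylinder

open Filter Topology Metric

lemma pairing_eq_zero {μ : Measure E3} {κ : ℝ} {F : ℝ × E3 → ℝ} {G : ℝ × E3 → E3} {q : E3 → ℝ}
    {p : E3 → E3} {r : ℝ} (hF : ∀ x, F (r, x) = 0) (hG : ∀ x, G (r, x) = 0) :
    pairing μ κ F G q p r = 0 := by
  simp [pairing, hF, hG]

lemma integral_pairing_nonpos {μ : Measure E3} {κ : ℝ} {F : ℝ × E3 → ℝ} {G : ℝ × E3 → E3}
    {q : E3 → ℝ} {p : E3 → E3} (hF : ∀ r ≤ 0, ∀ x, F (r, x) = 0) (hG : ∀ r ≤ 0, ∀ x, G (r, x) = 0)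
    {s : ℝ} (hs : s ≤ 0) : ∫ r in (0 : ℝ)..s, pairing μ κ F G q p r = 0 := by
  rw [intervalIntegral.integral_symm, neg_eq_zero]
  refine intervalIntegral.integral_zero_ae (Eventually.of_forall fun r hr => ?_)
  rw [uIoc_of_le hs] at hr
  exact pairing_eq_zero (hF r hr.2) (hG r hr.2)

/-- A real function whose averaged increments are controlled satisfies the limit inequality at
every differentiability point of its primitive. -/
lemma le_of_forall_increment_le {Φ : ℝ → ℝ} {Φ₀ J s₁ : ℝ} (hs₁ : 0 < s₁)
    (hd : HasDerivAt (fun s => ∫ r in (0 : ℝ)..s, Φ r) (Φ s₁) s₁)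
    (h : ∀ ε : ℝ, 0 < ε → ∃ η > 0, ∀ h, 0 < h → h < η → h < s₁ →
      (∫ r in (0 : ℝ)..s₁, Φ r) - (∫ r in (0 : ℝ)..(s₁ - h), Φ r) - h * Φ₀ + h * J ≤ ε * h) :
    Φ s₁ + J ≤ Φ₀ := by
  refine le_of_forall_pos_le_add fun ε hε => ?_
  obtain ⟨η, hη, H⟩ := h ε hε
  have l1 : Tendsto (fun h : ℝ => s₁ - h) (𝓝[>] 0) (𝓝[≠] s₁) := by
    refine tendsto_nhdsWithin_iff.2 ⟨?_, ?_⟩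
    · have : Tendsto (fun h : ℝ => s₁ - h) (𝓝 0) (𝓝 s₁) := by
        have hc : Continuous fun h : ℝ => s₁ - h := by fun_prop
        simpa using hc.tendsto 0
      exact this.mono_left nhdsWithin_le_nhds
    · filter_upwards [self_mem_nhdsWithin] with h hh
      have : 0 < h := hh
      simp only [mem_compl_iff, mem_singleton_iff]
      linarith
  have l2 := (hasDerivAt_iff_tendsto_slope.1 hd).comp l1
  have l3 : Φ s₁ ≤ ε + Φ₀ - J := by
    refine le_of_tendsto l2 ?_
    filter_upwards [self_mem_nhdsWithin,
      nhdsWithin_le_nhds (Iio_mem_nhds hη), nhdsWithin_le_nhds (Iio_mem_nhds hs₁)] with h h0 h1 h2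
    have h0' : 0 < h := h0
    have h3 := H h h0' h1 h2
    simp only [Function.comp_apply, slope_def_field]
    rw [show s₁ - h - s₁ = -h by ring, div_neg, ← neg_div, div_le_iff₀ h0']
    linarith
  linarith

/-- Entropy inequality for the weak solution: for smooth convex `β` with bounded derivatives,
`∫ β(θ(s)) + ∫₀ˢ ∫ (v·∇θ β'(θ) + κ β''(θ) |∇θ|²) ≤ ∫ β(θ₀)`. -/
lemma ae_entropy_le {φ₀ : E2 → ℝ} {c₀ a : ℝ} (hsec : IsRegularSection φ₀ c₀) (ha : 0 < a) {κ T : ℝ}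
    {F : ℝ × E3 → ℝ} {G : ℝ × E3 → E3} (hF : Integrable F volume) (hG : MemLp G 2 volume)
    (hF0 : ∀ r ≤ 0, ∀ x, F (r, x) = 0) (hG0 : ∀ r ≤ 0, ∀ x, G (r, x) = 0) {θ : ℝ → E3 → ℝ}
    (hθm : AEStronglyMeasurable (Function.uncurry θ)
      ((volume.restrict (Ioo 0 T)).prod (volume.restrict (cylinder φ₀ c₀ a))))
    {θ₀ : E3 → ℝ} (hθ₀ : MemLp θ₀ 2 (volume.restrict (cylinder φ₀ c₀ a)))
    (hw : ∀ᵐ s ∂(volume.restrict (Ioo 0 T)),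
      HasWeakGradient (cylinder φ₀ c₀ a) (θ s) fun x => G (s, x))
    (heq : ∀ᵐ s ∂(volume.restrict (Ioo 0 T)), ∀ ψ : E3 → ℝ, IsTest ψ →
      ∫ x in cylinder φ₀ c₀ a, θ s x * ψ x = (∫ x in cylinder φ₀ c₀ a, θ₀ x * ψ x) -
        ∫ r in (0 : ℝ)..s, pairing (volume.restrict (cylinder φ₀ c₀ a)) κ F G ψ (gradient ψ) r)
    {β : ℝ → ℝ} (hβ : ContDiff ℝ ((⊤ : ℕ∞) : WithTop ℕ∞) β) (hβ0 : β 0 = 0) (hβ0' : deriv β 0 = 0)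
    {C C₂ : ℝ} (hC : ∀ r, |deriv β r| ≤ C) (hC₂ : ∀ r, |deriv (deriv β) r| ≤ C₂)
    (hconv : ∀ x y, β x - β y ≤ deriv β x * (x - y))
    (hΦ : IntegrableOn (fun s => ∫ x in cylinder φ₀ c₀ a, β (θ s x)) (Ioo 0 T)) :
    IntegrableOn (fun s => pairing (volume.restrict (cylinder φ₀ c₀ a)) κ F G
        (fun x => deriv β (θ s x)) (fun x => deriv (deriv β) (θ s x) • G (s, x)) s) (Ioo 0 T) ∧
    ∀ᵐ s₁ ∂(volume.restrict (Ioo 0 T)), (∫ x in cylinder φ₀ c₀ a, β (θ s₁ x)) +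
      (∫ s in (0 : ℝ)..s₁, pairing (volume.restrict (cylinder φ₀ c₀ a)) κ F G
        (fun x => deriv β (θ s x)) (fun x => deriv (deriv β) (θ s x) • G (s, x)) s) ≤
      ∫ x in cylinder φ₀ c₀ a, β (θ₀ x) := by
  set Ω := cylinder φ₀ c₀ a with hΩdef
  have hΩ : MeasurableSet Ω := (isOpen_cylinder hsec.smooth.continuous).measurableSet
  set μ := volume.restrict Ω with hμ
  have hβ' : ContDiff ℝ ((⊤ : ℕ∞) : WithTop ℕ∞) (deriv β) := (contDiff_infty_iff_deriv.1 hβ).2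
  have hβ'' : Continuous (deriv (deriv β)) := hβ'.continuous_deriv (by simp)
  have hle : (volume : Measure ℝ).prod μ ≤ volume :=
    Measure.prod_mono le_rfl Measure.restrict_le_self
  have hFμ : Integrable F (volume.prod μ) := hF.mono_measure hle
  have hGμ : MemLp G 2 (volume.prod μ) := hG.mono_measure hle
  have hleT : (volume.restrict (Ioo 0 T)).prod μ ≤ (volume : Measure (ℝ × E3)) :=
    Measure.prod_mono Measure.restrict_le_self Measure.restrict_le_self
  have hFT := hF.mono_measure hleT
  have hGT := hG.mono_measure hleT
  have hpT : MemLp (fun z : ℝ × E3 => deriv (deriv β) (θ z.1 z.2) • G z) 2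
      ((volume.restrict (Ioo 0 T)).prod μ) :=
    hGT.of_le_mul ((hβ''.comp_aestronglyMeasurable hθm).smul hGT.1) (c := C₂)
      (Eventually.of_forall fun z => by
        rw [norm_smul]; exact mul_le_mul_of_nonneg_right (hC₂ _) (norm_nonneg _))
  set j : ℝ → ℝ := fun s => pairing μ κ F G
    (fun x => deriv β (θ s x)) (fun x => deriv (deriv β) (θ s x) • G (s, x)) s with hj
  have hjint : IntegrableOn j (Ioo 0 T) := by
    have h1 : Integrable (fun z : ℝ × E3 => F z * deriv β (θ z.1 z.2) +
        κ * inner ℝ (G z) (deriv (deriv β) (θ z.1 z.2) • G z))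
        ((volume.restrict (Ioo 0 T)).prod μ) :=
      (hFT.mul_bdd (hβ'.continuous.comp_aestronglyMeasurable hθm)
        (Eventually.of_forall fun z => hC _)).add ((integrable_inner_of_memLp hGT hpT).const_mul κ)
    exact h1.integral_prod_left
  refine ⟨hjint, ?_⟩
  set p : ℝ × E3 → E3 :=
    (Ioo 0 T ×ˢ Ω).indicator fun z => deriv (deriv β) (θ z.1 z.2) • G z with hp
  have hp2 : MemLp p 2 volume := by
    refine (memLp_indicator_iff_restrict (measurableSet_Ioo.prod hΩ)).2 ?_
    rw [Measure.volume_eq_prod, ← Measure.prod_restrict]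
    exact hpT
  -- Continue θ by θ₀ to nonpositive times, where F and G vanish: the weak identity persists, and
  -- backward increments from times s < h reach the initial value.
  set θ' : ℝ → E3 → ℝ := fun s => if s ≤ 0 then θ₀ else θ s with hθ'
  set Φ : ℝ → ℝ := fun s => ∫ x, β (θ s x) ∂μ with hΦdef
  set Φ₀ : ℝ := ∫ x, β (θ₀ x) ∂μ with hΦ₀
  have hgood : ∀ᵐ s : ℝ, s < T → MemLp (θ' s) 2 μ ∧ ∀ ψ : E3 → ℝ, IsTest ψ →
      ∫ x, θ' s x * ψ x ∂μ = (∫ x, θ₀ x * ψ x ∂μ) -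
        ∫ r in (0 : ℝ)..s, pairing μ κ F G ψ (gradient ψ) r := by
    filter_upwards [(ae_restrict_iff' measurableSet_Ioo).1 hw,
      (ae_restrict_iff' measurableSet_Ioo).1 heq] with s h1 h2 hsT
    by_cases hs : s ≤ 0
    · have e : θ' s = θ₀ := if_pos hs
      rw [e]
      refine ⟨hθ₀, fun ψ _ => ?_⟩
      rw [integral_pairing_nonpos hF0 hG0 hs, sub_zero]
    · have e : θ' s = θ s := if_neg hs
      rw [e]
      exact ⟨(h1 ⟨not_le.1 hs, hsT⟩).1, h2 ⟨not_le.1 hs, hsT⟩⟩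
  -- At almost every time s the increment over (s - h, s) is tested with β'(θ(s)). Replacing the
  -- pairing at earlier times by its value j(s) costs only translation errors.
  have hZ : ∀ h : ℝ, 0 < h → ∀ᵐ s : ℝ, s ∈ Ioo 0 T →
      ENNReal.ofReal (Φ s - (∫ x, β (θ' (s - h) x) ∂μ) + h * j s) ≤
      ∫⁻ σ in Ioo 0 h, ∫⁻ x, (ENNReal.ofReal C * ‖F (s - σ, x) - F (s, x)‖ₑ +
        ‖κ‖ₑ * (‖G (s - σ, x) - G (s, x)‖ₑ * ‖p (s, x)‖ₑ)) := by
    intro h hh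
    filter_upwards [(ae_restrict_iff' measurableSet_Ioo).1 hw, hgood,
      (measurePreserving_sub_right volume h).quasiMeasurePreserving.ae hgood,
      ae_integrable_slices hFμ hGμ] with s h1 h2 h3 h4 hs
    have e : θ' s = θ s := if_neg (not_le.2 hs.1)
    have h2' := h2 hs.2
    rw [e] at h2'
    have h3' := h3 (by linarith [hs.2])
    have hws := h1 hs
    have hq : AEStronglyMeasurable (fun x => deriv β (θ s x)) μ :=
      hβ'.continuous.comp_aestronglyMeasurable hws.1.1
    have hqC : ∀ᵐ x ∂μ, |deriv β (θ s x)| ≤ C := Eventually.of_forall fun x => hC _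
    have hps : MemLp (fun x => deriv (deriv β) (θ s x) • G (s, x)) 2 μ :=
      hws.2.1.of_le_mul ((hβ''.comp_aestronglyMeasurable hws.1.1).smul hws.2.1.1) (c := C₂)
        (Eventually.of_forall fun x => by
          rw [norm_smul]; exact mul_le_mul_of_nonneg_right (hC₂ _) (norm_nonneg _))
    have hinc := integral_sub_le_of_increment (κ := κ) hsec ha hFμ hGμ hws h3'.1 (s' := s - h)
      (s := s) (fun ψ hψ => by
        have hint : ∀ b b', IntervalIntegrable (pairing μ κ F G ψ (gradient ψ)) volume b b' := by
          obtain ⟨C₁, hC₁⟩ := hψ.2.exists_bound_of_continuous hψ.1.continuous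
          exact intervalIntegrable_pairing hFμ hGμ hψ.1.continuous.aestronglyMeasurable
            (Eventually.of_forall hC₁) hψ.memLp_gradient
        rw [h2'.2 ψ hψ, h3'.2 ψ hψ,
          ← intervalIntegral.integral_interval_sub_left (hint 0 s) (hint 0 (s - h))]
        ring) hβ hβ0 hβ0' hC hC₂ hconv
    refine (ENNReal.ofReal_le_ofReal (add_le_add_left hinc _)).trans
      ((ofReal_pairing_sub_le hFμ hGμ hq hqC hps hh h4).trans ?_)
    refine lintegral_mono fun σ => ?_
    refine le_trans (le_of_eq ?_) (lintegral_mono' (Measure.restrict_le_self (s := Ω)) le_rfl)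
    refine setLIntegral_congr_fun hΩ fun x hx => ?_
    have : p (s, x) = deriv (deriv β) (θ s x) • G (s, x) :=
      indicator_of_mem (show (s, x) ∈ Ioo 0 T ×ˢ Ω from ⟨hs, hx⟩) _
    simp only [this]
  have hΦ' : ∀ b ∈ Icc 0 T, IntervalIntegrable Φ volume 0 b := fun b hb => by
    rw [intervalIntegrable_iff_integrableOn_Ioo_of_le hb.1]
    exact hΦ.mono_set (Ioo_subset_Ioo_right hb.2)
  have hder : ∀ᵐ s : ℝ, s ∈ Ioo 0 T → HasDerivAt (fun s => ∫ r in (0 : ℝ)..s, Φ r) (Φ s) s := by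
    rcases le_or_gt T 0 with hT | hT
    · exact Eventually.of_forall fun s hs => absurd (hs.1.trans hs.2) (not_lt.2 hT)
    · filter_upwards [(hΦ' T ⟨hT.le, le_rfl⟩).ae_hasDerivAt_integral] with s hs hsT
      refine hs ?_ 0 left_mem_uIcc
      rw [uIcc_of_le hT.le]
      exact Ioo_subset_Icc_self hsT
  refine (ae_restrict_iff' measurableSet_Ioo).2 ?_
  filter_upwards [hder] with s₁ hds hs₁
  refine le_of_forall_increment_le hs₁.1 (hds hs₁) fun ε hε => ?_
  obtain ⟨η, hη, herr⟩ := exists_translation_error_le hF hG hp2 κ C (ENNReal.ofReal_pos.2 hε)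
  refine ⟨η, hη, fun h hh hhη hhs => ?_⟩
  have herr' := herr h hh hhη
  have hj₁ : IntervalIntegrable j volume 0 s₁ := by
    rw [intervalIntegrable_iff_integrableOn_Ioo_of_le hs₁.1.le]
    exact hjint.mono_set (Ioo_subset_Ioo_right hs₁.2.le)
  set Φ' : ℝ → ℝ := fun s => ∫ x, β (θ' s x) ∂μ with hΦ'def
  have eneg : ∀ s ≤ 0, Φ' s = Φ₀ := fun s hs => by
    simp only [hΦ'def, hθ', if_pos hs, hΦ₀]
  have epos : ∀ s, 0 < s → Φ' s = Φ s := fun s hs => by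
    simp only [hΦ'def, hθ', if_neg (not_le.2 hs), hΦdef]
  have i1 : IntervalIntegrable Φ' volume (-h) 0 := by
    refine (intervalIntegrable_const (c := Φ₀)).congr ?_
    intro s hs
    rw [uIoc_of_le (by linarith)] at hs
    exact (eneg s hs.2).symm
  have hmem : s₁ - h ∈ Icc 0 T := ⟨by linarith, by linarith [hs₁.2]⟩
  have i2 : IntervalIntegrable Φ' volume 0 (s₁ - h) := by
    refine (hΦ' _ hmem).congr ?_
    intro s hs
    rw [uIoc_of_le hmem.1] at hs
    exact (epos s hs.1).symm
  have e1 : ∫ s in (-h)..(0 : ℝ), Φ' s = h * Φ₀ := by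
    rw [intervalIntegral.integral_congr (g := fun _ => Φ₀)]
    · simp
    · intro s hs
      rw [uIcc_of_le (by linarith)] at hs
      exact eneg s hs.2
  have e2 : ∫ s in (0 : ℝ)..(s₁ - h), Φ' s = ∫ s in (0 : ℝ)..(s₁ - h), Φ s := by
    refine intervalIntegral.integral_congr_ae (Eventually.of_forall fun s hs => ?_)
    rw [uIoc_of_le hmem.1] at hs
    exact epos s hs.1
  have e3 : ∫ s in (0 : ℝ)..s₁, Φ' (s - h) = h * Φ₀ + ∫ s in (0 : ℝ)..(s₁ - h), Φ s := by
    rw [intervalIntegral.integral_comp_sub_right (fun s => Φ' s), zero_sub,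
      ← intervalIntegral.integral_add_adjacent_intervals i1 i2, e1, e2]
  have i3 : IntervalIntegrable (fun s => Φ' (s - h)) volume 0 s₁ := by
    have := (i1.trans i2).comp_sub_right h
    simpa using this
  -- Integrated over (0, s₁), the increments Φ(s) - Φ'(s - h) telescope to the integral of Φ over
  -- (s₁ - h, s₁) minus hΦ₀. Division by h and Lebesgue differentiation then give the inequality at
  -- s₁.
  have e4 : (∫ r in (0 : ℝ)..s₁, Φ r) - (∫ r in (0 : ℝ)..(s₁ - h), Φ r) - h * Φ₀ +
      h * (∫ s in (0 : ℝ)..s₁, j s) = ∫ s in (0 : ℝ)..s₁, (Φ s - Φ' (s - h) + h * j s) := by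
    rw [intervalIntegral.integral_add ((hΦ' s₁ ⟨hs₁.1.le, hs₁.2.le⟩).sub i3) (hj₁.const_mul h),
      intervalIntegral.integral_sub (hΦ' s₁ ⟨hs₁.1.le, hs₁.2.le⟩) i3, e3,
      intervalIntegral.integral_const_mul]
    ring
  rw [e4, intervalIntegral.integral_of_le hs₁.1.le, integral_Ioc_eq_integral_Ioo]
  have hfin : ENNReal.ofReal ε * ENNReal.ofReal h ≠ ∞ := by finiteness
  have hle2 : ∫⁻ s in Ioo 0 s₁, ∫⁻ σ in Ioo 0 h, ∫⁻ x,
      (ENNReal.ofReal C * ‖F (s - σ, x) - F (s, x)‖ₑ +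
        ‖κ‖ₑ * (‖G (s - σ, x) - G (s, x)‖ₑ * ‖p (s, x)‖ₑ)) ≤
      ENNReal.ofReal ε * ENNReal.ofReal h :=
    (lintegral_mono' Measure.restrict_le_self le_rfl).trans herr'
  refine (integral_le_toReal_lintegral (ne_top_of_le_ne_top hfin hle2) ?_).trans
    ((ENNReal.toReal_mono hfin hle2).trans (le_of_eq ?_))
  · filter_upwards [ae_restrict_of_ae (hZ h hh), ae_restrict_mem measurableSet_Ioo] with s hs hs'
    exact hs ⟨hs'.1, hs'.2.trans hs₁.2⟩
  · rw [ENNReal.toReal_mul, ENNReal.toReal_ofReal hε.le, ENNReal.toReal_ofReal hh.le]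

end HeatCylinder

/-! ### Entropies of linear growth, and the smooth excess function. -/

namespace HeatCylinder

open Filter Topology Metric

/-- Convex function with quadratic behaviour at the origin and linear growth at infinity. -/
noncomputable def softSq (x : ℝ) : ℝ := √(1 + x ^ 2) - 1

lemma one_le_sqrt_one_add_sq (x : ℝ) : 1 ≤ √(1 + x ^ 2) := by
  rw [Real.one_le_sqrt]; nlinarith [sq_nonneg x]

lemma contDiff_softSq : ContDiff ℝ ((⊤ : ℕ∞) : WithTop ℕ∞) softSq :=
  ((contDiff_const.add (contDiff_id.pow 2)).sqrt fun x => by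
    have := sq_nonneg x
    simp only [id]
    positivity).sub contDiff_const

lemma hasDerivAt_sqrt_one_add_sq (x : ℝ) :
    HasDerivAt (fun x : ℝ => √(1 + x ^ 2)) (x / √(1 + x ^ 2)) x := by
  have h1 : HasDerivAt (fun x : ℝ => 1 + x ^ 2) (2 * x) x := by
    have := (hasDerivAt_pow 2 x).const_add 1
    simpa using this
  have h2 := h1.sqrt (by positivity)
  rwa [mul_div_mul_left _ _ two_ne_zero] at h2

lemma deriv_softSq (x : ℝ) : deriv softSq x = x / √(1 + x ^ 2) :=
  ((hasDerivAt_sqrt_one_add_sq x).sub_const 1).deriv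

lemma deriv_deriv_softSq (x : ℝ) : deriv (deriv softSq) x = 1 / √(1 + x ^ 2) ^ 3 := by
  have e : deriv softSq = fun x => x / √(1 + x ^ 2) := funext deriv_softSq
  rw [e]
  have h0 : √(1 + x ^ 2) ≠ 0 := by have := one_le_sqrt_one_add_sq x; positivity
  have h := (hasDerivAt_id x).div (hasDerivAt_sqrt_one_add_sq x) h0
  refine h.deriv.trans ?_
  have h1 : √(1 + x ^ 2) ^ 2 = 1 + x ^ 2 := Real.sq_sqrt (by positivity)
  simp only [id]
  field_simp
  linarith

/-- The rationalized form shows both the bound by x²/2 and, after rescaling, the convergence to it.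
-/
lemma softSq_eq (x : ℝ) : softSq x = x ^ 2 / (√(1 + x ^ 2) + 1) := by
  have h0 := one_le_sqrt_one_add_sq x
  rw [softSq, eq_div_iff (by positivity)]
  have h1 : √(1 + x ^ 2) ^ 2 = 1 + x ^ 2 := Real.sq_sqrt (by positivity)
  linarith [h1, sq_nonneg x, (by ring : (√(1 + x ^ 2) - 1) * (√(1 + x ^ 2) + 1) = √(1 + x ^ 2) ^ 2 - 1)]

lemma softSq_nonneg (x : ℝ) : 0 ≤ softSq x := sub_nonneg.2 (one_le_sqrt_one_add_sq x)

lemma softSq_le (x : ℝ) : softSq x ≤ x ^ 2 / 2 := by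
  rw [softSq_eq]
  exact div_le_div_of_nonneg_left (sq_nonneg x) two_pos (by linarith [one_le_sqrt_one_add_sq x])

lemma abs_deriv_softSq_le (x : ℝ) : |deriv softSq x| ≤ 1 := by
  have h0 := one_le_sqrt_one_add_sq x
  rw [deriv_softSq, abs_div, abs_of_pos (a := √(1 + x ^ 2)) (by positivity), div_le_one (by positivity)]
  exact Real.abs_le_sqrt (by linarith)

lemma deriv_deriv_softSq_nonneg (x : ℝ) : 0 ≤ deriv (deriv softSq) x := by
  rw [deriv_deriv_softSq]; positivity

lemma deriv_deriv_softSq_le (x : ℝ) : deriv (deriv softSq) x ≤ 1 := by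
  have h0 := one_le_sqrt_one_add_sq x
  rw [deriv_deriv_softSq, div_le_one (by positivity)]
  exact one_le_pow₀ h0

lemma deriv_softSq_mul_nonneg {x y : ℝ} (h : 0 ≤ x * y) : 0 ≤ deriv softSq x * y := by
  have h0 := one_le_sqrt_one_add_sq x
  rw [deriv_softSq, div_mul_eq_mul_div]
  positivity

lemma tendsto_div_natCast_add_one (x : ℝ) :
    Tendsto (fun k : ℕ => x / ((k : ℝ) + 1)) atTop (𝓝 0) := by
  have := (tendsto_one_div_add_atTop_nhds_zero_nat (𝕜 := ℝ)).const_mul x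
  simpa [div_eq_mul_inv] using this

lemma tendsto_deriv_deriv_softSq (x : ℝ) :
    Tendsto (fun k : ℕ => deriv (deriv softSq) (x / ((k : ℝ) + 1))) atTop (𝓝 1) := by
  have hc : Continuous (deriv (deriv softSq)) :=
    (contDiff_infty_iff_deriv.1 contDiff_softSq).2.continuous_deriv (by simp)
  have := (hc.tendsto 0).comp (tendsto_div_natCast_add_one x)
  rw [deriv_deriv_softSq] at this
  simpa [Function.comp_def] using this

/-- Convex functions of linear growth increasing to `P² / 2`. -/
noncomputable def entropy (P : ℝ → ℝ) (k : ℕ) (r : ℝ) : ℝ :=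
  ((k : ℝ) + 1) ^ 2 * softSq (P r / ((k : ℝ) + 1))

section Entropy

variable {P : ℝ → ℝ} (k : ℕ)

lemma contDiff_entropy (hP : ContDiff ℝ ((⊤ : ℕ∞) : WithTop ℕ∞) P) :
    ContDiff ℝ ((⊤ : ℕ∞) : WithTop ℕ∞) (entropy P k) :=
  contDiff_const.mul (contDiff_softSq.comp (hP.div_const _))

lemma entropy_nonneg (r : ℝ) : 0 ≤ entropy P k r := by
  have := softSq_nonneg (P r / ((k : ℝ) + 1))
  unfold entropy
  positivity

lemma entropy_le (r : ℝ) : entropy P k r ≤ P r ^ 2 / 2 := by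
  have h := mul_le_mul_of_nonneg_left (softSq_le (P r / ((k : ℝ) + 1)))
    (sq_nonneg ((k : ℝ) + 1))
  refine h.trans (le_of_eq ?_)
  field_simp

lemma entropy_zero (h : P 0 = 0) : entropy P k 0 = 0 := by
  simp [entropy, h, softSq]

lemma tendsto_entropy (r : ℝ) : Tendsto (fun k => entropy P k r) atTop (𝓝 (P r ^ 2 / 2)) := by
  have e : ∀ k : ℕ, entropy P k r = P r ^ 2 / (√(1 + (P r / ((k : ℝ) + 1)) ^ 2) + 1) := by
    intro k
    rw [entropy, softSq_eq]
    have := one_le_sqrt_one_add_sq (P r / ((k : ℝ) + 1))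
    field_simp
  simp_rw [e]
  have hc : Continuous fun x : ℝ => P r ^ 2 / (√(1 + x ^ 2) + 1) :=
    continuous_const.div (by fun_prop) fun x => by positivity
  have := (hc.tendsto 0).comp (tendsto_div_natCast_add_one (P r))
  norm_num [Function.comp_def] at this
  exact this

lemma deriv_entropy (hP : Differentiable ℝ P) : deriv (entropy P k) =
    fun r => ((k : ℝ) + 1) * deriv softSq (P r / ((k : ℝ) + 1)) * deriv P r := by
  ext r
  have h1 : HasDerivAt softSq (deriv softSq (P r / ((k : ℝ) + 1))) (P r / ((k : ℝ) + 1)) :=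
    (contDiff_softSq.differentiable (by simp) _).hasDerivAt
  have h2 := (h1.comp r ((hP r).hasDerivAt.div_const ((k : ℝ) + 1))).const_mul (((k : ℝ) + 1) ^ 2)
  refine h2.deriv.trans ?_
  field_simp

lemma deriv_entropy_zero (hP : Differentiable ℝ P) (h : P 0 = 0) : deriv (entropy P k) 0 = 0 := by
  rw [deriv_entropy k hP]
  simp [h, deriv_softSq]

/-- For each k the derivative is bounded, so it can multiply the merely integrable v·∇θ. The bound
may grow with k, since the flux estimates do not involve it. -/
lemma abs_deriv_entropy_le (hP : Differentiable ℝ P) (hP1 : ∀ r, |deriv P r| ≤ 1) (r : ℝ) :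
    |deriv (entropy P k) r| ≤ (k : ℝ) + 1 := by
  rw [deriv_entropy k hP]
  simp only [abs_mul]
  rw [abs_of_pos (by positivity : (0 : ℝ) < (k : ℝ) + 1)]
  have h1 := abs_deriv_softSq_le (P r / ((k : ℝ) + 1))
  have h2 := mul_le_mul h1 (hP1 r) (abs_nonneg _) zero_le_one
  rw [mul_assoc]
  nlinarith [(by positivity : (0 : ℝ) < (k : ℝ) + 1)]

lemma deriv_deriv_entropy (hP : ContDiff ℝ ((⊤ : ℕ∞) : WithTop ℕ∞) P) (r : ℝ) :
    deriv (deriv (entropy P k)) r =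
      deriv (deriv softSq) (P r / ((k : ℝ) + 1)) * deriv P r ^ 2 +
        ((k : ℝ) + 1) * (deriv softSq (P r / ((k : ℝ) + 1)) * deriv (deriv P) r) := by
  have hPd : Differentiable ℝ P := hP.differentiable (by simp)
  rw [deriv_entropy k hPd]
  have hs : ContDiff ℝ ((⊤ : ℕ∞) : WithTop ℕ∞) (deriv softSq) :=
    (contDiff_infty_iff_deriv.1 contDiff_softSq).2
  have h1 : HasDerivAt (deriv softSq) (deriv (deriv softSq) (P r / ((k : ℝ) + 1)))
      (P r / ((k : ℝ) + 1)) := (hs.differentiable (by simp) _).hasDerivAt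
  have h2 : HasDerivAt (deriv P) (deriv (deriv P) r) r :=
    ((contDiff_infty_iff_deriv.1 hP).2.differentiable (by simp) _).hasDerivAt
  have h3 := ((h1.comp r ((hPd r).hasDerivAt.div_const ((k : ℝ) + 1))).const_mul
    ((k : ℝ) + 1)).mul h2
  refine h3.deriv.trans ?_
  simp only [Function.comp_apply]
  field_simp

/-- The derivative of `softSq` has the sign of its argument, so the term with P'' is nonnegative
when P·P'' ≥ 0. What remains tends to P'² as k → ∞. -/
lemma le_deriv_deriv_entropy (hP : ContDiff ℝ ((⊤ : ℕ∞) : WithTop ℕ∞) P)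
    (hPP : ∀ r, 0 ≤ P r * deriv (deriv P) r) (r : ℝ) :
    deriv (deriv softSq) (P r / ((k : ℝ) + 1)) * deriv P r ^ 2 ≤ deriv (deriv (entropy P k)) r := by
  rw [deriv_deriv_entropy k hP]
  have h : 0 ≤ P r / ((k : ℝ) + 1) * deriv (deriv P) r := by
    rw [div_mul_eq_mul_div]
    exact div_nonneg (hPP r) (by positivity)
  have := deriv_softSq_mul_nonneg h
  have : 0 ≤ ((k : ℝ) + 1) * (deriv softSq (P r / ((k : ℝ) + 1)) * deriv (deriv P) r) := by
    positivity
  linarith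

lemma abs_deriv_deriv_entropy_le (hP : ContDiff ℝ ((⊤ : ℕ∞) : WithTop ℕ∞) P)
    (hP1 : ∀ r, |deriv P r| ≤ 1) {C : ℝ} (hC : ∀ r, |deriv (deriv P) r| ≤ C) (r : ℝ) :
    |deriv (deriv (entropy P k)) r| ≤ 1 + ((k : ℝ) + 1) * C := by
  rw [deriv_deriv_entropy k hP]
  refine (abs_add_le _ _).trans (add_le_add ?_ ?_)
  · rw [abs_mul, abs_of_nonneg (deriv_deriv_softSq_nonneg _), abs_of_nonneg (sq_nonneg _)]
    have h1 : deriv P r ^ 2 ≤ 1 := by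
      rw [← sq_abs]
      exact pow_le_one₀ (abs_nonneg _) (hP1 r)
    exact mul_le_one₀ (deriv_deriv_softSq_le _) (sq_nonneg _) h1
  · rw [abs_mul, abs_of_pos (by positivity : (0 : ℝ) < (k : ℝ) + 1), abs_mul]
    refine mul_le_mul_of_nonneg_left ?_ (by positivity)
    have := mul_le_mul (abs_deriv_softSq_le (P r / ((k : ℝ) + 1))) (hC r) (abs_nonneg _) zero_le_one
    linarith

end Entropy

lemma sub_le_deriv_mul_sub {β : ℝ → ℝ} (hβ : Differentiable ℝ β) (hm : Monotone (deriv β))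
    (x y : ℝ) : β x - β y ≤ deriv β x * (x - y) := by
  rcases lt_trichotomy x y with h | rfl | h
  · obtain ⟨c, hc, e⟩ := exists_deriv_eq_slope β h hβ.continuous.continuousOn hβ.differentiableOn
    rw [eq_div_iff (by linarith)] at e
    nlinarith [hm hc.1.le]
  · simp
  · obtain ⟨c, hc, e⟩ := exists_deriv_eq_slope β h hβ.continuous.continuousOn hβ.differentiableOn
    rw [eq_div_iff (by linarith)] at e
    nlinarith [hm hc.2.le]

/-- A smooth odd nondecreasing function vanishing exactly on `[-m, m]`, convex on `[0, ∞)`. -/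
lemma exists_excess {m : ℝ} (hm : 0 < m) :
    ∃ P : ℝ → ℝ, ContDiff ℝ ((⊤ : ℕ∞) : WithTop ℕ∞) P ∧ (∀ r, |deriv P r| ≤ 1) ∧
      (∃ C, ∀ r, |deriv (deriv P) r| ≤ C) ∧ (∀ r, 0 ≤ P r * deriv (deriv P) r) ∧
      (∀ r, |r| ≤ m → P r = 0) ∧ ∀ r, P r = 0 → |r| ≤ m := by
  set τ : ℝ → ℝ := Real.smoothTransition with hτ
  have hτc : ContDiff ℝ ((⊤ : ℕ∞) : WithTop ℕ∞) τ := Real.smoothTransition.contDiff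
  set Q : ℝ → ℝ := fun x => ∫ r in (0 : ℝ)..x, τ r with hQ
  have hQd : ∀ x, HasDerivAt Q (τ x) x := fun x =>
    intervalIntegral.integral_hasDerivAt_right (hτc.continuous.intervalIntegrable _ _)
      (hτc.continuous.stronglyMeasurableAtFilter _ _) hτc.continuous.continuousAt
  have hQ' : deriv Q = τ := funext fun x => (hQd x).deriv
  have hQc : ContDiff ℝ ((⊤ : ℕ∞) : WithTop ℕ∞) Q :=
    contDiff_infty_iff_deriv.2 ⟨fun x => (hQd x).differentiableAt, by rwa [hQ']⟩
  have hQ0 : ∀ x ≤ 0, Q x = 0 := by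
    intro x hx
    simp only [hQ]
    rw [intervalIntegral.integral_symm, neg_eq_zero]
    refine intervalIntegral.integral_zero_ae (Eventually.of_forall fun r hr => ?_)
    rw [uIoc_of_le hx] at hr
    exact Real.smoothTransition.zero_of_nonpos hr.2
  have hQpos : ∀ x, 0 < x → 0 < Q x := fun x hx =>
    intervalIntegral.intervalIntegral_pos_of_pos_on (hτc.continuous.intervalIntegrable _ _)
      (fun r hr => Real.smoothTransition.pos_of_pos hr.1) hx
  have hτd : ∀ x, HasDerivAt τ (deriv τ x) x := fun x =>
    (hτc.differentiable (by simp) x).hasDerivAt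
  have hτneg : ∀ x < 0, deriv τ x = 0 := by
    intro x hx
    have : τ =ᶠ[𝓝 x] fun _ => 0 := by
      filter_upwards [Iio_mem_nhds hx] with y hy
      exact Real.smoothTransition.zero_of_nonpos hy.le
    rw [this.deriv_eq, deriv_const]
  have hτbig : ∀ x, 1 < x → deriv τ x = 0 := by
    intro x hx
    have : τ =ᶠ[𝓝 x] fun _ => 1 := by
      filter_upwards [Ioi_mem_nhds hx] with y hy
      exact Real.smoothTransition.one_of_one_le hy.le
    rw [this.deriv_eq, deriv_const]
  have hτmono : Monotone τ := Real.smoothTransition.monotone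
  have hτnn : ∀ x, 0 ≤ deriv τ x := fun x => hτmono.deriv_nonneg
  obtain ⟨C, hC⟩ : ∃ C, ∀ x, |deriv τ x| ≤ C := by
    obtain ⟨C, hC⟩ := isCompact_Icc.exists_bound_of_continuousOn (s := Icc (0 : ℝ) 1)
      (hτc.continuous_deriv (by simp)).continuousOn
    have hC0 : 0 ≤ C := (norm_nonneg _).trans (hC 0 (by simp))
    refine ⟨C, fun x => ?_⟩
    rcases lt_or_ge x 0 with h | h
    · rw [hτneg x h, abs_zero]; exact hC0
    rcases lt_or_ge 1 x with h' | h'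
    · rw [hτbig x h', abs_zero]; exact hC0
    · exact hC x ⟨h, h'⟩
  -- Q is a smooth substitute for the positive part. As m > 0, the arguments r - m and -r - m are
  -- never both positive, so at most one of the two pieces is active at each r.
  set P : ℝ → ℝ := fun r => Q (r - m) - Q (-r - m) with hP
  have hPd : deriv P = fun r => τ (r - m) + τ (-r - m) := by
    ext r
    have h1 : HasDerivAt (fun r => Q (r - m)) (τ (r - m) * 1) r :=
      HasDerivAt.comp (h₂ := Q) (h := fun r => r - m) r (hQd (r - m)) ((hasDerivAt_id r).sub_const m)
    have h2 : HasDerivAt (fun r => Q (-r - m)) (τ (-r - m) * (-1)) r :=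
      HasDerivAt.comp (h₂ := Q) (h := fun r => -r - m) r (hQd (-r - m)) ((hasDerivAt_neg r).sub_const m)
    refine (h1.sub h2).deriv.trans (by ring)
  have hPdd : deriv (deriv P) = fun r => deriv τ (r - m) - deriv τ (-r - m) := by
    rw [hPd]
    ext r
    have h1 : HasDerivAt (fun r => τ (r - m)) (deriv τ (r - m) * 1) r :=
      HasDerivAt.comp (h₂ := τ) (h := fun r => r - m) r (hτd (r - m)) ((hasDerivAt_id r).sub_const m)
    have h2 : HasDerivAt (fun r => τ (-r - m)) (deriv τ (-r - m) * (-1)) r :=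
      HasDerivAt.comp (h₂ := τ) (h := fun r => -r - m) r (hτd (-r - m)) ((hasDerivAt_neg r).sub_const m)
    refine (h1.add h2).deriv.trans (by ring)
  refine ⟨P, (hQc.comp (contDiff_id.sub contDiff_const)).sub
    (hQc.comp (contDiff_neg.sub contDiff_const)), fun r => ?_, ⟨2 * C, fun r => ?_⟩, fun r => ?_,
    fun r hr => ?_, fun r hr => ?_⟩
  · rw [hPd]
    have a1 : 0 ≤ τ (r - m) := Real.smoothTransition.nonneg _
    have a2 : 0 ≤ τ (-r - m) := Real.smoothTransition.nonneg _
    simp only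
    rw [abs_of_nonneg (add_nonneg a1 a2)]
    rcases le_total r 0 with h | h
    · have : τ (r - m) = 0 := Real.smoothTransition.zero_of_nonpos (by linarith)
      rw [this, zero_add]
      exact Real.smoothTransition.le_one _
    · have : τ (-r - m) = 0 := Real.smoothTransition.zero_of_nonpos (by linarith)
      rw [this, add_zero]
      exact Real.smoothTransition.le_one _
  · rw [hPdd]
    refine (abs_sub _ _).trans ?_
    linarith [hC (r - m), hC (-r - m)]
  · rw [hPdd]
    simp only [hP]
    rcases le_total r 0 with h | h
    · rw [hQ0 (r - m) (by linarith), hτneg (r - m) (by linarith)]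
      rcases le_or_gt (-r - m) 0 with h' | h'
      · rw [hQ0 _ h']; simp
      · nlinarith [hQpos _ h', hτnn (-r - m)]
    · rw [hQ0 (-r - m) (by linarith), hτneg (-r - m) (by linarith)]
      rcases le_or_gt (r - m) 0 with h' | h'
      · rw [hQ0 _ h']; simp
      · nlinarith [hQpos _ h', hτnn (r - m)]
  · obtain ⟨h1, h2⟩ := abs_le.1 hr
    simp only [hP]
    rw [hQ0 _ (by linarith), hQ0 _ (by linarith), sub_zero]
  · rw [abs_le]
    simp only [hP] at hr
    constructor
    · by_contra! h
      rw [hQ0 (r - m) (by linarith)] at hr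
      linarith [hQpos (-r - m) (by linarith)]
    · by_contra! h
      rw [hQ0 (-r - m) (by linarith)] at hr
      linarith [hQpos (r - m) (by linarith)]

end HeatCylinder

/-! ### The energy inequality for P(θ). -/

namespace HeatCylinder

open Filter Topology Metric

/-- Energy inequality for `P ∘ θ`: the entropy inequality with quadratic entropy `P² / 2`, once the
convective flux is bounded by an integrable function of time. -/
lemma ae_energy_le {φ₀ : E2 → ℝ} {c₀ a : ℝ} (hsec : IsRegularSection φ₀ c₀) (ha : 0 < a) {κ T : ℝ}
    (hκ : 0 ≤ κ) {V G : ℝ × E3 → E3} (hV : MemLp V 2 volume) (hG : MemLp G 2 volume)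
    (hG0 : ∀ r ≤ 0, ∀ x, G (r, x) = 0) {θ : ℝ → E3 → ℝ}
    (hθm : AEStronglyMeasurable (Function.uncurry θ)
      ((volume.restrict (Ioo 0 T)).prod (volume.restrict (cylinder φ₀ c₀ a))))
    {M : ℝ} (hθM : ∀ᵐ s ∂(volume.restrict (Ioo 0 T)), ∫ x in cylinder φ₀ c₀ a, θ s x ^ 2 ≤ M)
    {θ₀ : E3 → ℝ} (hθ₀ : MemLp θ₀ 2 (volume.restrict (cylinder φ₀ c₀ a)))
    (hw : ∀ᵐ s ∂(volume.restrict (Ioo 0 T)),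
      HasWeakGradient (cylinder φ₀ c₀ a) (θ s) fun x => G (s, x))
    (heq : ∀ᵐ s ∂(volume.restrict (Ioo 0 T)), ∀ ψ : E3 → ℝ, IsTest ψ →
      ∫ x in cylinder φ₀ c₀ a, θ s x * ψ x = (∫ x in cylinder φ₀ c₀ a, θ₀ x * ψ x) -
        ∫ r in (0 : ℝ)..s, pairing (volume.restrict (cylinder φ₀ c₀ a)) κ
          (fun z => inner ℝ (V z) (G z)) G ψ (gradient ψ) r)
    {P : ℝ → ℝ} (hP : ContDiff ℝ ((⊤ : ℕ∞) : WithTop ℕ∞) P) (hP0 : P 0 = 0)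
    (hP1 : ∀ r, |deriv P r| ≤ 1) {C : ℝ} (hP2 : ∀ r, |deriv (deriv P) r| ≤ C)
    (hPP : ∀ r, 0 ≤ P r * deriv (deriv P) r) {Fl : ℝ → ℝ} (hFl : IntegrableOn Fl (Ioo 0 T))
    (hflux : ∀ k, ∀ᵐ s ∂(volume.restrict (Ioo 0 T)),
      -∫ x in cylinder φ₀ c₀ a, inner ℝ (V (s, x)) (G (s, x)) * deriv (entropy P k) (θ s x) ≤
        Fl s) :
    ∀ᵐ s ∂(volume.restrict (Ioo 0 T)), (∫ x in cylinder φ₀ c₀ a, P (θ s x) ^ 2) / 2 +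
      κ * (∫ r in Ioo 0 s, ∫ x in cylinder φ₀ c₀ a, deriv P (θ r x) ^ 2 * ‖G (r, x)‖ ^ 2) ≤
      (∫ x in cylinder φ₀ c₀ a, P (θ₀ x) ^ 2) / 2 + ∫ r in Ioo 0 s, Fl r := by
  have hfin : IsFiniteMeasure (volume.restrict (cylinder φ₀ c₀ a)) :=
    ⟨by rw [Measure.restrict_apply_univ]; exact (isBounded_cylinder hsec).measure_lt_top⟩
  set μ := volume.restrict (cylinder φ₀ c₀ a) with hμ
  set F : ℝ × E3 → ℝ := fun z => inner ℝ (V z) (G z) with hFdef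
  have hF : Integrable F volume := integrable_inner_of_memLp hV hG
  have hF0 : ∀ r ≤ 0, ∀ x, F (r, x) = 0 := fun r hr x => by
    simp only [hFdef, hG0 r hr x, inner_zero_right]
  have hPd : Differentiable ℝ P := hP.differentiable (by simp)
  have hP'c : Continuous (deriv P) := hP.continuous_deriv (by simp)
  have hs''c : Continuous (deriv (deriv softSq)) :=
    (contDiff_infty_iff_deriv.1 contDiff_softSq).2.continuous_deriv (by simp)
  have hPabs : ∀ r, P r ^ 2 ≤ r ^ 2 := fun r => by
    have := abs_sub_le_of_abs_deriv_le hPd hP1 r 0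
    rw [hP0, sub_zero, sub_zero, one_mul] at this
    exact sq_le_sq.2 this
  have hPsq : ∀ {w : E3 → ℝ}, MemLp w 2 μ → Integrable (fun x => P (w x) ^ 2 / 2) μ := by
    intro w hw
    refine Integrable.div_const ?_ 2
    refine hw.integrable_sq.mono' ((hP.continuous.comp_aestronglyMeasurable hw.1).pow 2)
      (Eventually.of_forall fun x => ?_)
    rw [Real.norm_of_nonneg (sq_nonneg _)]
    exact hPabs _
  have hent : ∀ {w : E3 → ℝ}, MemLp w 2 μ → ∀ k, Integrable (fun x => entropy P k (w x)) μ := by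
    intro w hw k
    refine (hPsq hw).mono' ((contDiff_entropy k hP).continuous.comp_aestronglyMeasurable hw.1)
      (Eventually.of_forall fun x => ?_)
    rw [Real.norm_of_nonneg (entropy_nonneg k _)]
    exact entropy_le k _
  have hC0 : ∀ k r, 0 ≤ deriv (deriv (entropy P k)) r := fun k r =>
    (mul_nonneg (deriv_deriv_softSq_nonneg _) (sq_nonneg _)).trans
      (le_deriv_deriv_entropy k hP hPP r)
  have hmain := fun k => ae_entropy_le hsec ha hF hG hF0 hG0 hθm hθ₀ hw heq (contDiff_entropy k hP)
    (entropy_zero k hP0) (deriv_entropy_zero k hPd hP0) (abs_deriv_entropy_le k hPd hP1)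
    (abs_deriv_deriv_entropy_le k hP hP1 hP2)
    (sub_le_deriv_mul_sub ((contDiff_entropy k hP).differentiable (by simp))
      (monotone_of_deriv_nonneg
        ((contDiff_infty_iff_deriv.1 (contDiff_entropy k hP)).2.differentiable (by simp)) (hC0 k)))
    (by
      have hmeas : AEStronglyMeasurable (fun s => ∫ x, entropy P k (θ s x) ∂μ)
          (volume.restrict (Ioo 0 T)) :=
        ((contDiff_entropy k hP).continuous.comp_aestronglyMeasurable hθm).integral_prod_right'
      refine Integrable.mono' (integrable_const (M / 2)) hmeas ?_
      filter_upwards [hw, hθM] with s hs hsM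
      rw [Real.norm_of_nonneg (integral_nonneg fun x => entropy_nonneg k _)]
      refine (integral_mono (hent hs.1 k) (hs.1.integrable_sq.div_const 2) fun x =>
        (entropy_le k _).trans (div_le_div_of_nonneg_right (hPabs _) two_pos.le)).trans ?_
      rw [integral_div]
      linarith)
  -- Convection is bounded below by -Fl with Fl independent of k, and diffusion by the part of the
  -- second derivative that converges.
  have hB : ∀ k : ℕ, ∀ᵐ s ∂(volume.restrict (Ioo 0 T)),
      -Fl s + κ * (∫ x, deriv (deriv softSq) (P (θ s x) / ((k : ℝ) + 1)) * deriv P (θ s x) ^ 2 *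
        ‖G (s, x)‖ ^ 2 ∂μ) ≤ pairing μ κ F G (fun x => deriv (entropy P k) (θ s x))
        (fun x => deriv (deriv (entropy P k)) (θ s x) • G (s, x)) s := by
    intro k
    have hle : (volume : Measure ℝ).prod μ ≤ volume :=
      Measure.prod_mono le_rfl Measure.restrict_le_self
    filter_upwards [hw, hflux k, ae_restrict_of_ae (ae_integrable_slices (hF.mono_measure hle)
      (hG.mono_measure hle))] with s hs hfs hsl
    have hβ'c := (contDiff_infty_iff_deriv.1 (contDiff_entropy k hP)).2
    have hm2 : AEStronglyMeasurable (fun x => deriv (deriv (entropy P k)) (θ s x)) μ :=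
      (hβ'c.continuous_deriv (by simp)).comp_aestronglyMeasurable hs.1.1
    have hps : MemLp (fun x => deriv (deriv (entropy P k)) (θ s x) • G (s, x)) 2 μ :=
      hs.2.1.of_le_mul (hm2.smul hs.2.1.1) (c := 1 + ((k : ℝ) + 1) * C)
        (Eventually.of_forall fun x => by
          rw [norm_smul]
          exact mul_le_mul_of_nonneg_right (abs_deriv_deriv_entropy_le k hP hP1 hP2 _)
            (norm_nonneg _))
    obtain ⟨i1, i2⟩ := integrable_pairing_integrand (κ := κ) hsl.1 hsl.2
      (hβ'c.continuous.comp_aestronglyMeasurable hs.1.1)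
      (Eventually.of_forall fun x => abs_deriv_entropy_le k hPd hP1 _) hps
    rw [pairing, integral_add i1 i2, integral_const_mul]
    refine add_le_add (by linarith) (mul_le_mul_of_nonneg_left ?_ hκ)
    have i3 : Integrable (fun x => ‖G (s, x)‖ ^ 2) μ := hsl.2.integrable_norm_pow (by norm_num)
    refine integral_mono_of_nonneg (Eventually.of_forall fun x => ?_)
      (integrable_inner_of_memLp hsl.2 hps) (Eventually.of_forall fun x => ?_)
    · exact mul_nonneg (mul_nonneg (deriv_deriv_softSq_nonneg _) (sq_nonneg _)) (sq_nonneg _)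
    · simp only [inner_smul_right, real_inner_self_eq_norm_sq]
      exact mul_le_mul_of_nonneg_right (le_deriv_deriv_entropy k hP hPP _) (sq_nonneg _)
  -- Let k → ∞ at a time valid for all k: the dissipation converges with majorant |∇θ|², and the
  -- entropy converges with majorant its limit P²/2.
  filter_upwards [ae_all_iff.2 fun k => (hmain k).2, hw, ae_restrict_mem measurableSet_Ioo]
    with s hs hws hsT
  have hleT : volume.restrict (Ioo 0 s) ≤ (volume.restrict (Ioo 0 T) : Measure ℝ) :=
    Measure.restrict_mono (Ioo_subset_Ioo_right hsT.2.le) le_rfl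
  set ν := (volume.restrict (Ioo 0 s)).prod μ with hν
  have hθν : AEStronglyMeasurable (Function.uncurry θ) ν :=
    hθm.mono_measure (Measure.prod_mono hleT le_rfl)
  have hGν : MemLp G 2 ν :=
    hG.mono_measure (Measure.prod_mono Measure.restrict_le_self Measure.restrict_le_self)
  have hG2 : Integrable (fun z => ‖G z‖ ^ 2) ν := hGν.integrable_norm_pow (by norm_num)
  have hP'1 : ∀ r, deriv P r ^ 2 ≤ 1 := fun r => by
    rw [← sq_abs]
    exact pow_le_one₀ (abs_nonneg _) (hP1 r)
  have hmB : ∀ k : ℕ, AEStronglyMeasurable (fun z : ℝ × E3 =>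
      deriv (deriv softSq) (P (θ z.1 z.2) / ((k : ℝ) + 1)) * deriv P (θ z.1 z.2) ^ 2 *
        ‖G z‖ ^ 2) ν := fun k =>
    (((hs''c.comp (hP.continuous.div_const ((k : ℝ) + 1))).comp_aestronglyMeasurable hθν).mul
      ((hP'c.comp_aestronglyMeasurable hθν).pow 2)).mul (hGν.1.norm.pow 2)
  have hbB : ∀ (k : ℕ) (z : ℝ × E3),
      ‖deriv (deriv softSq) (P (θ z.1 z.2) / ((k : ℝ) + 1)) * deriv P (θ z.1 z.2) ^ 2 *
        ‖G z‖ ^ 2‖ ≤ ‖G z‖ ^ 2 := fun k z => by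
    have h1 := mul_nonneg (deriv_deriv_softSq_nonneg (P (θ z.1 z.2) / ((k : ℝ) + 1)))
      (sq_nonneg (deriv P (θ z.1 z.2)))
    rw [Real.norm_of_nonneg (mul_nonneg h1 (sq_nonneg _))]
    exact mul_le_of_le_one_left (sq_nonneg _)
      (mul_le_one₀ (deriv_deriv_softSq_le _) (sq_nonneg _) (hP'1 _))
  have hmB' : AEStronglyMeasurable (fun z : ℝ × E3 => deriv P (θ z.1 z.2) ^ 2 * ‖G z‖ ^ 2) ν :=
    ((hP'c.comp_aestronglyMeasurable hθν).pow 2).mul (hGν.1.norm.pow 2)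
  have hiB' : Integrable (fun z : ℝ × E3 => deriv P (θ z.1 z.2) ^ 2 * ‖G z‖ ^ 2) ν :=
    hG2.mono' hmB' (Eventually.of_forall fun z => by
      rw [Real.norm_of_nonneg (mul_nonneg (sq_nonneg _) (sq_nonneg _))]
      exact mul_le_of_le_one_left (sq_nonneg _) (hP'1 _))
  have hiB : ∀ k : ℕ, Integrable (fun z : ℝ × E3 =>
      deriv (deriv softSq) (P (θ z.1 z.2) / ((k : ℝ) + 1)) * deriv P (θ z.1 z.2) ^ 2 *
        ‖G z‖ ^ 2) ν := fun k => hG2.mono' (hmB k) (Eventually.of_forall (hbB k))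
  have lB : Tendsto (fun k : ℕ => ∫ r in Ioo 0 s, ∫ x,
      deriv (deriv softSq) (P (θ r x) / ((k : ℝ) + 1)) * deriv P (θ r x) ^ 2 * ‖G (r, x)‖ ^ 2 ∂μ)
      atTop (𝓝 (∫ r in Ioo 0 s, ∫ x, deriv P (θ r x) ^ 2 * ‖G (r, x)‖ ^ 2 ∂μ)) := by
    rw [← integral_prod _ hiB']
    simp_rw [fun k => (integral_prod _ (hiB k)).symm]
    refine tendsto_integral_of_dominated_convergence (fun z => ‖G z‖ ^ 2) hmB hG2
      (fun k => Eventually.of_forall (hbB k)) (Eventually.of_forall fun z => ?_)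
    have := ((tendsto_deriv_deriv_softSq (P (θ z.1 z.2))).mul_const
      (deriv P (θ z.1 z.2) ^ 2)).mul_const (‖G z‖ ^ 2)
    rwa [one_mul] at this
  have lA : Tendsto (fun k => ∫ x, entropy P k (θ s x) ∂μ) atTop
      (𝓝 ((∫ x, P (θ s x) ^ 2 ∂μ) / 2)) := by
    rw [← integral_div]
    refine tendsto_integral_of_dominated_convergence (fun x => P (θ s x) ^ 2 / 2)
      (fun k => (hent hws.1 k).1) (hPsq hws.1) (fun k => Eventually.of_forall fun x => ?_)
      (Eventually.of_forall fun x => tendsto_entropy _)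
    rw [Real.norm_of_nonneg (entropy_nonneg k _)]
    exact entropy_le k _
  refine le_of_tendsto' (lA.add (lB.const_mul κ)) fun k => ?_
  have h1 := hs k
  rw [intervalIntegral.integral_of_le hsT.1.le, integral_Ioc_eq_integral_Ioo] at h1
  have h2 : ∫ x, entropy P k (θ₀ x) ∂μ ≤ (∫ x, P (θ₀ x) ^ 2 ∂μ) / 2 := by
    rw [← integral_div]
    exact integral_mono (hent hθ₀ k) (hPsq hθ₀) fun x => entropy_le k _
  have iFl : Integrable Fl (volume.restrict (Ioo 0 s)) := Integrable.mono_measure hFl hleT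
  have iBk := (hiB k).integral_prod_left
  have iFn : Integrable (fun r => -Fl r) (volume.restrict (Ioo 0 s)) := iFl.neg
  have iκB : Integrable (fun r => κ * ∫ x, deriv (deriv softSq) (P (θ r x) / ((k : ℝ) + 1)) *
      deriv P (θ r x) ^ 2 * ‖G (r, x)‖ ^ 2 ∂μ) (volume.restrict (Ioo 0 s)) := iBk.const_mul κ
  have h3 : -(∫ r in Ioo 0 s, Fl r) + κ * (∫ r in Ioo 0 s, ∫ x,
      deriv (deriv softSq) (P (θ r x) / ((k : ℝ) + 1)) * deriv P (θ r x) ^ 2 *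
        ‖G (r, x)‖ ^ 2 ∂μ) ≤ ∫ r in Ioo 0 s, pairing μ κ F G
        (fun x => deriv (entropy P k) (θ r x))
        (fun x => deriv (deriv (entropy P k)) (θ r x) • G (r, x)) r := by
    rw [← integral_neg, ← integral_const_mul, ← integral_add iFn iκB]
    exact integral_mono_ae (iFn.add iκB)
      (Integrable.mono_measure (hmain k).1 hleT) ((ae_mono hleT) (hB k))
  linarith

end HeatCylinder

/-! ### From the data of the problem to the Grönwall estimate. -/

namespace HeatCylinder

open Filter Topology Metric

lemma eLpNorm_two_sq_ennreal {α : Type*} [MeasurableSpace α] {μ : Measure α} (f : α → ℝ≥0∞) :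
    eLpNorm f 2 μ ^ 2 = ∫⁻ x, f x ^ 2 ∂μ := by
  rw [eLpNorm_eq_lintegral_rpow_enorm_toReal (by norm_num) (by norm_num), ← ENNReal.rpow_natCast,
    ← ENNReal.rpow_mul]
  norm_num

lemma mixedNorm_two_two_sq {F : Type*} [NormedAddCommGroup F] {t : ℝ} {Q : Set E3}
    {f : ℝ → E3 → F} (hf : JointlyMeasurable t Q f) :
    mixedNorm 2 2 t Q f ^ 2 = ∫⁻ z, ‖Function.uncurry f z‖ₑ ^ 2
      ∂((volume.restrict (Ioo 0 t)).prod (volume.restrict Q)) := by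
  rw [mixedNorm, eLpNorm_two_sq_ennreal, lintegral_prod _ (hf.enorm.pow_const 2)]
  exact lintegral_congr fun s => eLpNorm_two_sq _

lemma memLp_uncurry_of_mixedNorm {F : Type*} [NormedAddCommGroup F] {t : ℝ} {Q : Set E3}
    {f : ℝ → E3 → F} (hf : JointlyMeasurable t Q f) (h : mixedNorm 2 2 t Q f < ∞) :
    MemLp (Function.uncurry f) 2 ((volume.restrict (Ioo 0 t)).prod (volume.restrict Q)) := by
  refine ⟨hf, ?_⟩
  have h1 := mixedNorm_two_two_sq hf
  rw [← eLpNorm_two_sq] at h1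
  have h2 : eLpNorm (Function.uncurry f) 2
      ((volume.restrict (Ioo 0 t)).prod (volume.restrict Q)) ^ 2 < ∞ := by
    rw [← h1]
    exact ENNReal.pow_lt_top h
  exact (ENNReal.pow_lt_top_iff.1 h2).resolve_right (by norm_num)

lemma memLp_indicator_of_mixedNorm {F : Type*} [NormedAddCommGroup F] {t : ℝ} {Q : Set E3}
    (hQ : MeasurableSet Q) {f : ℝ → E3 → F} (hf : JointlyMeasurable t Q f)
    (h : mixedNorm 2 2 t Q f < ∞) :
    MemLp ((Ioo 0 t ×ˢ Q).indicator (Function.uncurry f)) 2 volume := by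
  refine (memLp_indicator_iff_restrict (measurableSet_Ioo.prod hQ)).2 ?_
  rw [Measure.volume_eq_prod, ← Measure.prod_restrict]
  exact memLp_uncurry_of_mixedNorm hf h

lemma toReal_eLpNorm_two_sq {α F : Type*} [MeasurableSpace α] {μ : Measure α}
    [NormedAddCommGroup F] {f : α → F} (hf : AEStronglyMeasurable f μ) :
    (eLpNorm f 2 μ ^ 2).toReal = ∫ x, ‖f x‖ ^ 2 ∂μ := by
  rw [eLpNorm_two_sq, integral_eq_lintegral_of_nonneg_ae
    (Eventually.of_forall fun x => by positivity)
    (show AEStronglyMeasurable (fun x => ‖f x‖ ^ 2) μ from hf.norm.pow 2)]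
  congr 1
  refine lintegral_congr fun x => ?_
  rw [ENNReal.ofReal_pow (norm_nonneg _), ofReal_norm]

variable {φ₀ : E2 → ℝ} {c₀ a κ t : ℝ} {d₁ d₂ : ℝ → E2 → ℝ} {v : ℝ → E3 → E3} {θ₀ : E3 → ℝ}
  {θ : ℝ → E3 → ℝ} {g : ℝ → E3 → E3}

lemma IsWeakSolution.mixedNorm_grad_lt_top {Ω : Set E3} (hθ : IsWeakSolution Ω κ t v θ₀ θ g) :
    mixedNorm 2 2 t Ω g < ∞ :=
  le_add_self.trans_lt hθ.finite_energy

lemma IsWeakSolution.ae_eLpNorm_le {Ω : Set E3} :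
    ∀ᵐ s ∂(volume.restrict (Ioo 0 t)),
      eLpNorm (θ s) 2 (volume.restrict Ω) ≤ mixedNorm ∞ 2 t Ω θ := by
  have := ae_le_eLpNormEssSup (f := fun s => eLpNorm (θ s) 2 (volume.restrict Ω))
    (μ := volume.restrict (Ioo 0 t))
  rw [mixedNorm, eLpNorm_exponent_top]
  exact this

lemma IsWeakSolution.exists_integral_sq_le {Ω : Set E3} (hθ : IsWeakSolution Ω κ t v θ₀ θ g) :
    ∃ M : ℝ, ∀ᵐ s ∂(volume.restrict (Ioo 0 t)), ∫ x in Ω, θ s x ^ 2 ≤ M := by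
  refine ⟨(mixedNorm ∞ 2 t Ω θ ^ 2).toReal, ?_⟩
  have hfin : mixedNorm ∞ 2 t Ω θ ≠ ∞ := (le_self_add.trans_lt hθ.finite_energy).ne
  filter_upwards [IsWeakSolution.ae_eLpNorm_le (θ := θ) (Ω := Ω) (t := t), hθ.weak_grad] with s h hs
  have e : ∫ x in Ω, θ s x ^ 2 = ∫ x in Ω, ‖θ s x‖ ^ 2 := by simp
  rw [e, ← toReal_eLpNorm_two_sq hs.1.1]
  exact ENNReal.toReal_mono (ENNReal.pow_ne_top hfin) (pow_le_pow_left₀ zero_le h 2)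

/-- Energy inequality for `P ∘ θ` in terms of the data of the problem. -/
lemma IsWeakSolution.ae_energy_le (hsec : IsRegularSection φ₀ c₀) (ha : 0 < a) (hκ : 0 ≤ κ)
    (hv : IsVelocity φ₀ c₀ a t d₁ d₂ v) (hθ : IsWeakSolution (cylinder φ₀ c₀ a) κ t v θ₀ θ g)
    (hθ₀ : MemLp θ₀ 2 (volume.restrict (cylinder φ₀ c₀ a)))
    {P : ℝ → ℝ} (hP : ContDiff ℝ ((⊤ : ℕ∞) : WithTop ℕ∞) P) (hP0 : P 0 = 0)
    (hP1 : ∀ r, |deriv P r| ≤ 1) {C : ℝ} (hP2 : ∀ r, |deriv (deriv P) r| ≤ C)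
    (hPP : ∀ r, 0 ≤ P r * deriv (deriv P) r) {Fl : ℝ → ℝ} (hFl : IntegrableOn Fl (Ioo 0 t))
    (hflux : ∀ k, ∀ᵐ s ∂(volume.restrict (Ioo 0 t)),
      -∫ x in cylinder φ₀ c₀ a, inner ℝ (v s x) (g s x) * deriv (entropy P k) (θ s x) ≤ Fl s) :
    ∀ᵐ s ∂(volume.restrict (Ioo 0 t)), (∫ x in cylinder φ₀ c₀ a, P (θ s x) ^ 2) / 2 +
      κ * (∫ r in Ioo 0 s, ∫ x in cylinder φ₀ c₀ a, deriv P (θ r x) ^ 2 * ‖g r x‖ ^ 2) ≤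
      (∫ x in cylinder φ₀ c₀ a, P (θ₀ x) ^ 2) / 2 + ∫ r in Ioo 0 s, Fl r := by
  have hfin : IsFiniteMeasure (volume.restrict (cylinder φ₀ c₀ a)) :=
    ⟨by rw [Measure.restrict_apply_univ]; exact (isBounded_cylinder hsec).measure_lt_top⟩
  set Ω := cylinder φ₀ c₀ a with hΩdef
  have hΩ : MeasurableSet Ω := (isOpen_cylinder hsec.smooth.continuous).measurableSet
  -- Extension by zero outside (0, t) × Ω makes the fields global, so that translations in time are
  -- available; inside nothing changes.
  set V : ℝ × E3 → E3 := (Ioo 0 t ×ˢ Ω).indicator (Function.uncurry v) with hV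
  set G : ℝ × E3 → E3 := (Ioo 0 t ×ˢ Ω).indicator (Function.uncurry g) with hG
  have hV2 : MemLp V 2 volume := memLp_indicator_of_mixedNorm hΩ hv.measurable hv.square_integrable
  have hG2 : MemLp G 2 volume :=
    memLp_indicator_of_mixedNorm hΩ hθ.measurable_grad hθ.mixedNorm_grad_lt_top
  have eV : ∀ s ∈ Ioo 0 t, ∀ x ∈ Ω, V (s, x) = v s x := fun s hs x hx =>
    indicator_of_mem (show (s, x) ∈ Ioo 0 t ×ˢ Ω from ⟨hs, hx⟩) _
  have eG : ∀ s ∈ Ioo 0 t, ∀ x ∈ Ω, G (s, x) = g s x := fun s hs x hx =>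
    indicator_of_mem (show (s, x) ∈ Ioo 0 t ×ˢ Ω from ⟨hs, hx⟩) _
  have hG0 : ∀ r ≤ 0, ∀ x, G (r, x) = 0 := fun r hr x =>
    indicator_of_notMem (fun h => absurd h.1.1 (not_lt.2 hr)) _
  have hle : (volume : Measure ℝ).prod (volume.restrict Ω) ≤ volume :=
    Measure.prod_mono le_rfl Measure.restrict_le_self
  have heq : ∀ᵐ s ∂(volume.restrict (Ioo 0 t)), ∀ ψ : E3 → ℝ, IsTest ψ →
      ∫ x in Ω, θ s x * ψ x = (∫ x in Ω, θ₀ x * ψ x) - ∫ r in (0 : ℝ)..s,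
        pairing (volume.restrict Ω) κ (fun z => inner ℝ (V z) (G z)) G ψ (gradient ψ) r := by
    refine ae_forall_test (isBounded_cylinder hsec)
      ((integrable_inner_of_memLp hV2 hG2).mono_measure hle) (hG2.mono_measure hle) ?_
      (hθ₀.integrable (by norm_num)) fun ψ hψ => ?_
    · filter_upwards [hθ.weak_grad] with s hs
      exact hs.1.integrable (by norm_num)
    · filter_upwards [hθ.equation ψ hψ, ae_restrict_mem measurableSet_Ioo] with s hs hst
      rw [hs]
      congr 1
      refine intervalIntegral.integral_congr_ae (Eventually.of_forall fun r hr => ?_)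
      rw [uIoc_of_le hst.1.le] at hr
      refine setIntegral_congr_fun hΩ fun x hx => ?_
      simp only [eV r ⟨hr.1, hr.2.trans_lt hst.2⟩ x hx, eG r ⟨hr.1, hr.2.trans_lt hst.2⟩ x hx]
  have hw : ∀ᵐ s ∂(volume.restrict (Ioo 0 t)), HasWeakGradient Ω (θ s) fun x => G (s, x) := by
    filter_upwards [hθ.weak_grad, ae_restrict_mem measurableSet_Ioo] with s hs hst
    have e : (fun x => G (s, x)) =ᵐ[volume.restrict Ω] g s := by
      filter_upwards [ae_restrict_mem hΩ] with x hx
      exact eG s hst x hx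
    refine ⟨hs.1, (memLp_congr_ae e).2 hs.2.1, fun ψ hψ hψs => ?_⟩
    rw [hs.2.2 ψ hψ hψs]
    congr 1
    refine integral_congr_ae ?_
    filter_upwards [e] with x hx
    rw [hx]
  obtain ⟨M, hM⟩ := hθ.exists_integral_sq_le
  have h := HeatCylinder.ae_energy_le hsec ha hκ hV2 hG2 hG0 hθ.measurable hM hθ₀ hw heq hP hP0 hP1
    hP2 hPP hFl (fun k => by
      filter_upwards [hflux k, ae_restrict_mem measurableSet_Ioo] with s hs hst
      refine le_trans (le_of_eq ?_) hs
      congr 1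
      refine setIntegral_congr_fun hΩ fun x hx => ?_
      simp only [eV s hst x hx, eG s hst x hx])
  filter_upwards [h, ae_restrict_mem measurableSet_Ioo] with s hs hst
  have e : ∫ r in Ioo 0 s, ∫ x in Ω, deriv P (θ r x) ^ 2 * ‖g r x‖ ^ 2 =
      ∫ r in Ioo 0 s, ∫ x in Ω, deriv P (θ r x) ^ 2 * ‖G (r, x)‖ ^ 2 := by
    refine setIntegral_congr_fun measurableSet_Ioo fun r hr => ?_
    refine setIntegral_congr_fun hΩ fun x hx => ?_
    simp only [eG r ⟨hr.1, hr.2.trans hst.2⟩ x hx]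
  rw [e]
  exact hs

lemma IsVelocity.ae_memLp (hv : IsVelocity φ₀ c₀ a t d₁ d₂ v) :
    ∀ᵐ s ∂(volume.restrict (Ioo 0 t)), MemLp (v s) 2 (volume.restrict (cylinder φ₀ c₀ a)) := by
  have h := memLp_uncurry_of_mixedNorm hv.measurable hv.square_integrable
  have h1 := h.1.prodMk_left
  have h2 : Integrable (fun z => ‖Function.uncurry v z‖ ^ 2)
    ((volume.restrict (Ioo 0 t)).prod (volume.restrict (cylinder φ₀ c₀ a))) :=
    h.integrable_norm_pow (by norm_num)
  filter_upwards [h1, h2.prod_right_ae] with s hs1 hs2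
  exact (memLp_two_iff_integrable_sq_norm hs1).2 hs2

/-- The time dependent weight that controls the inflow. -/
noncomputable def inflowWeight (φ₀ : E2 → ℝ) (c₀ : ℝ) (d₁ : ℝ → E2 → ℝ) (s : ℝ) : ℝ≥0∞ :=
  (∫⁻ y in crossSection φ₀ c₀, ‖d₁ s y‖ₑ ^ 3) ^ 2 + ∫⁻ y in crossSection φ₀ c₀, ‖d₁ s y‖ₑ

lemma aemeasurable_lintegral_enorm_pow (hd : JointlyMeasurable t (crossSection φ₀ c₀) d₁) (n : ℕ) :
    AEMeasurable (fun s => ∫⁻ y in crossSection φ₀ c₀, ‖d₁ s y‖ₑ ^ n)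
      (volume.restrict (Ioo 0 t)) :=
  (hd.enorm.pow_const n).lintegral_prod_right'

lemma aemeasurable_inflowWeight (hd : JointlyMeasurable t (crossSection φ₀ c₀) d₁) :
    AEMeasurable (inflowWeight φ₀ c₀ d₁) (volume.restrict (Ioo 0 t)) :=
  ((aemeasurable_lintegral_enorm_pow hd 3).pow_const 2).add
    (by simpa using aemeasurable_lintegral_enorm_pow hd 1)

/-- Grönwall's inequality for `P ∘ θ`. -/
lemma IsWeakSolution.ae_gronwall (hsec : IsRegularSection φ₀ c₀) (ha : 0 < a) (hκ : 0 < κ)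
    {K : ℝ≥0∞} (hK : K ≠ ∞)
    (htrace : ∀ w : E3 → ℝ, ContDiff ℝ 1 w → ∀ d : E2 → ℝ≥0∞,
      AEMeasurable d (volume.restrict (crossSection φ₀ c₀)) →
      ∫⁻ y in crossSection φ₀ c₀, d y * ‖w (lift y (-a))‖ₑ ^ 2 ≤
        ENNReal.ofReal κ * (∫⁻ x in cylinder φ₀ c₀ a, ‖fderiv ℝ w x‖ₑ ^ 2) +
        K * (((∫⁻ y in crossSection φ₀ c₀, d y ^ 3) ^ 2 + ∫⁻ y in crossSection φ₀ c₀, d y) *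
          ∫⁻ x in cylinder φ₀ c₀ a, ‖w x‖ₑ ^ 2))
    (hdm : JointlyMeasurable t (crossSection φ₀ c₀) d₁)
    (hd : ∀ᵐ s ∂(volume.restrict (Ioo 0 t)),
      ∀ᵐ y ∂(volume.restrict (crossSection φ₀ c₀)), 0 ≤ d₁ s y ∧ 0 ≤ d₂ s y)
    (hD : ∫⁻ s in Ioo 0 t, inflowWeight φ₀ c₀ d₁ s ≠ ∞)
    (hv : IsVelocity φ₀ c₀ a t d₁ d₂ v) (hθ : IsWeakSolution (cylinder φ₀ c₀ a) κ t v θ₀ θ g)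
    (hθ₀ : MemLp θ₀ 2 (volume.restrict (cylinder φ₀ c₀ a)))
    {P : ℝ → ℝ} (hP : ContDiff ℝ ((⊤ : ℕ∞) : WithTop ℕ∞) P) (hP0 : P 0 = 0)
    (hP1 : ∀ r, |deriv P r| ≤ 1) {C : ℝ} (hP2 : ∀ r, |deriv (deriv P) r| ≤ C)
    (hPP : ∀ r, 0 ≤ P r * deriv (deriv P) r) :
    ∀ᵐ s ∂(volume.restrict (Ioo 0 t)), (∫ x in cylinder φ₀ c₀ a, P (θ s x) ^ 2) +
      κ * (∫ r in Ioo 0 s, ∫ x in cylinder φ₀ c₀ a, deriv P (θ r x) ^ 2 * ‖g r x‖ ^ 2) ≤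
      (∫ x in cylinder φ₀ c₀ a, P (θ₀ x) ^ 2) *
        Real.exp (K.toReal * (∫⁻ s in Ioo 0 t, inflowWeight φ₀ c₀ d₁ s).toReal) := by
  have hPd : Differentiable ℝ P := hP.differentiable (by simp)
  have hP'c : Continuous (deriv P) := hP.continuous_deriv (by simp)
  have hPabs : ∀ r, P r ^ 2 ≤ r ^ 2 := fun r => by
    have := abs_sub_le_of_abs_deriv_le hPd hP1 r 0
    rw [hP0, sub_zero, sub_zero, one_mul] at this
    exact sq_le_sq.2 this
  have hP'1 : ∀ r, deriv P r ^ 2 ≤ 1 := fun r => by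
    rw [← sq_abs]
    exact pow_le_one₀ (abs_nonneg _) (hP1 r)
  set Ω := cylinder φ₀ c₀ a with hΩdef
  set ν := (volume.restrict (Ioo 0 t) : Measure ℝ) with hν
  set D : ℝ → ℝ≥0∞ := inflowWeight φ₀ c₀ d₁ with hDdef
  have hDm : AEMeasurable D ν := aemeasurable_inflowWeight hdm
  have hDfin : ∀ᵐ s ∂ν, D s < ∞ := ae_lt_top' hDm hD
  have hDi : Integrable (fun s => (D s).toReal) ν := integrable_toReal_of_lintegral_ne_top hDm hD
  set y : ℝ → ℝ := fun s => ∫ x in Ω, P (θ s x) ^ 2 with hy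
  set z : ℝ → ℝ := fun r => ∫ x in Ω, deriv P (θ r x) ^ 2 * ‖g r x‖ ^ 2 with hz
  have hy0 : ∀ s, 0 ≤ y s := fun s => integral_nonneg fun x => sq_nonneg _
  have hz0 : ∀ s, 0 ≤ z s := fun s => integral_nonneg fun x =>
    mul_nonneg (sq_nonneg _) (sq_nonneg _)
  obtain ⟨M, hM⟩ := hθ.exists_integral_sq_le
  have hyM : ∀ᵐ s ∂ν, |y s| ≤ M := by
    filter_upwards [hM, hθ.weak_grad] with s hs hws
    rw [abs_of_nonneg (hy0 s)]
    refine (integral_mono_of_nonneg (Eventually.of_forall fun x => sq_nonneg _)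
      hws.1.integrable_sq (Eventually.of_forall fun x => hPabs _)).trans hs
  have hym : AEStronglyMeasurable y ν :=
    ((hP.continuous.comp_aestronglyMeasurable hθ.measurable).pow 2).integral_prod_right'
  have hDy : Integrable (fun s => (D s).toReal * y s) ν := hDi.mul_bdd hym hyM
  have hzi : Integrable z ν := by
    have hg2 := memLp_uncurry_of_mixedNorm hθ.measurable_grad hθ.mixedNorm_grad_lt_top
    have hg3 : Integrable (fun w => ‖Function.uncurry g w‖ ^ 2) (ν.prod (volume.restrict Ω)) :=
      hg2.integrable_norm_pow (by norm_num)
    have : Integrable (fun w : ℝ × E3 => deriv P (Function.uncurry θ w) ^ 2 *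
        ‖Function.uncurry g w‖ ^ 2) (ν.prod (volume.restrict Ω)) :=
      hg3.mono' (((hP'c.comp_aestronglyMeasurable hθ.measurable).pow 2).mul (hg2.1.norm.pow 2))
        (Eventually.of_forall fun w => by
          rw [Real.norm_of_nonneg (mul_nonneg (sq_nonneg _) (sq_nonneg _))]
          exact mul_le_of_le_one_left (sq_nonneg _) (hP'1 _))
    exact this.integral_prod_left
  -- The trace inequality with δ = κ: because entropies are at most P²/2, the flux consumes only κ/2
  -- of the dissipation.
  have hflux : ∀ k, ∀ᵐ s ∂ν, -∫ x in Ω, inner ℝ (v s x) (g s x) * deriv (entropy P k) (θ s x) ≤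
      κ / 2 * z s + K.toReal / 2 * ((D s).toReal * y s) := by
    intro k
    filter_upwards [hd, hDfin, hv.flux, hv.ae_memLp, hθ.weak_grad, hdm.prodMk_left]
      with s hds hDs hfs hvs hws hdms
    refine (flux_le_of_trace hsec ha ENNReal.ofReal_ne_top hK htrace hds hdms.enorm hDs.ne le_rfl hvs
      hfs hws hP hP0 hP1 (contDiff_entropy k hP) (entropy_zero k hP0) (entropy_nonneg k)
      (entropy_le k) (abs_deriv_entropy_le k hPd hP1)).trans (le_of_eq ?_)
    have hm1 : AEStronglyMeasurable (fun x => deriv P (θ s x) • g s x) (volume.restrict Ω) :=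
      (hP'c.comp_aestronglyMeasurable hws.1.1).smul hws.2.1.1
    have hm2 : AEStronglyMeasurable (fun x => P (θ s x)) (volume.restrict Ω) :=
      hP.continuous.comp_aestronglyMeasurable hws.1.1
    have f1 : eLpNorm (fun x => deriv P (θ s x) • g s x) 2 (volume.restrict Ω) ≠ ∞ :=
      (hws.2.1.of_le_mul hm1 (c := 1) (Eventually.of_forall fun x => by
        rw [norm_smul]; exact mul_le_mul_of_nonneg_right (hP1 _) (norm_nonneg _))).eLpNorm_ne_top
    have f2 : eLpNorm (fun x => P (θ s x)) 2 (volume.restrict Ω) ≠ ∞ :=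
      (hws.1.of_le_mul hm2 (c := 1) (Eventually.of_forall fun x => by
        simpa [hP0] using abs_sub_le_of_abs_deriv_le hPd hP1 (θ s x) 0)).eLpNorm_ne_top
    rw [ENNReal.toReal_mul, ENNReal.toReal_add
      (ENNReal.mul_ne_top ENNReal.ofReal_ne_top (ENNReal.pow_ne_top f1))
      (ENNReal.mul_ne_top hK (ENNReal.mul_ne_top hDs.ne (ENNReal.pow_ne_top f2))),
      ENNReal.toReal_mul, ENNReal.toReal_mul, ENNReal.toReal_mul, toReal_eLpNorm_two_sq hm1,
      toReal_eLpNorm_two_sq hm2, ENNReal.toReal_ofReal hκ.le]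
    have e1 : ∫ x in Ω, ‖deriv P (θ s x) • g s x‖ ^ 2 = z s := by
      refine integral_congr_ae (Eventually.of_forall fun x => ?_)
      simp only [norm_smul, mul_pow, Real.norm_eq_abs, sq_abs]
    have e2 : ∫ x in Ω, ‖P (θ s x)‖ ^ 2 = y s := by
      refine integral_congr_ae (Eventually.of_forall fun x => ?_)
      simp only [Real.norm_eq_abs, sq_abs]
    rw [e1, e2]
    simp only [ENNReal.toReal_inv, ENNReal.toReal_ofNat]
    ring
  have hen := hθ.ae_energy_le hsec ha hκ.le hv hθ₀ hP hP0 hP1 hP2 hPP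
    ((hzi.const_mul (κ / 2)).add (hDy.const_mul (K.toReal / 2))) hflux
  set k : ℝ → ℝ := fun s => K.toReal * (D s).toReal with hk
  have hk0 : ∀ s, 0 ≤ k s := fun s => mul_nonneg ENNReal.toReal_nonneg ENNReal.toReal_nonneg
  -- Absorb κ/2 of the dissipation and multiply the energy inequality by 2.
  have hmain : ∀ᵐ s ∂ν, y s + κ * (∫ r in Ioo 0 s, z r) ≤
      (∫ x in Ω, P (θ₀ x) ^ 2) + ∫ r in (0 : ℝ)..s, k r * y r := by
    filter_upwards [hen, ae_restrict_mem measurableSet_Ioo] with s hs hst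
    have hle : volume.restrict (Ioo 0 s) ≤ ν :=
      Measure.restrict_mono (Ioo_subset_Ioo_right hst.2.le) le_rfl
    rw [intervalIntegral.integral_of_le hst.1.le, integral_Ioc_eq_integral_Ioo]
    have e : ∫ r in Ioo 0 s, ((fun s => κ / 2 * z s) + fun s => K.toReal / 2 * ((D s).toReal * y s)) r
        = κ / 2 * (∫ r in Ioo 0 s, z r) + (∫ r in Ioo 0 s, k r * y r) / 2 := by
      simp only [Pi.add_apply]
      rw [integral_add ((hzi.const_mul _).mono_measure hle) ((hDy.const_mul _).mono_measure hle),
        integral_const_mul, ← integral_div]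
      congr 1
      refine integral_congr_ae (Eventually.of_forall fun r => ?_)
      simp only [hk]
      ring
    rw [e] at hs
    linarith
  filter_upwards [hmain, ae_restrict_mem measurableSet_Ioo] with s hs hst
  have ht : 0 ≤ t := (hst.1.trans hst.2).le
  have hki : IntervalIntegrable k volume 0 t := by
    rw [intervalIntegrable_iff_integrableOn_Ioo_of_le ht]
    exact hDi.const_mul _
  have hkyi : IntervalIntegrable (fun s => k s * y s) volume 0 t := by
    rw [intervalIntegrable_iff_integrableOn_Ioo_of_le ht]
    have := hDy.const_mul K.toReal
    refine this.congr (Eventually.of_forall fun s => ?_)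
    simp only [hk]
    ring
  have hgr := gronwall_integral hki hk0 hkyi (by
    filter_upwards [hmain, ae_restrict_mem measurableSet_Ioo] with s' hs' hst'
    refine le_trans ?_ hs'
    have : 0 ≤ κ * ∫ r in Ioo 0 s', z r :=
      mul_nonneg hκ.le (integral_nonneg fun r => hz0 r)
    linarith) (Ioo_subset_Icc_self hst)
  refine hs.trans (hgr.trans ?_)
  refine mul_le_mul_of_nonneg_left (Real.exp_le_exp.2 ?_) (integral_nonneg fun x => sq_nonneg _)
  rw [intervalIntegral.integral_of_le hst.1.le, integral_Ioc_eq_integral_Ioo,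
    ← integral_toReal hDm hDfin, ← integral_const_mul]
  exact setIntegral_mono_set (hDi.const_mul _) (Eventually.of_forall hk0)
    (Ioo_subset_Ioo_right hst.2.le).eventuallyLE

end HeatCylinder

/-! ### The energy norm, the maximum principle and the estimate for bounded solutions. -/

namespace HeatCylinder

open Filter Topology Metric

/-- The primitive of h is continuous up to t, so a strict violation at t would persist on an
interval to the left of t, which has positive measure. -/
lemma setIntegral_Ioo_le_of_ae {h : ℝ → ℝ} {t B : ℝ} (ht : 0 < t) (hi : IntegrableOn h (Ioo 0 t))
    (hB : ∀ᵐ s ∂(volume.restrict (Ioo 0 t)), ∫ r in Ioo 0 s, h r ≤ B) :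
    ∫ r in Ioo 0 t, h r ≤ B := by
  by_contra! hlt
  have hc : ContinuousOn (fun s => ∫ r in (0 : ℝ)..s, h r) (uIcc 0 t) := by
    refine intervalIntegral.continuousOn_primitive_interval ?_
    rw [uIcc_of_le ht.le, integrableOn_Icc_iff_integrableOn_Ioo]
    exact hi
  rw [uIcc_of_le ht.le] at hc
  have e : ∀ s, 0 ≤ s → ∫ r in (0 : ℝ)..s, h r = ∫ r in Ioo 0 s, h r := fun s hs => by
    rw [intervalIntegral.integral_of_le hs, integral_Ioc_eq_integral_Ioo]
  have h1 : ∀ᶠ s in 𝓝[Icc 0 t] t, B < ∫ r in (0 : ℝ)..s, h r :=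
    (hc t ⟨ht.le, le_rfl⟩).eventually (lt_mem_nhds (by
      simp only [e t ht.le]
      exact hlt))
  have h2 : 𝓝[<] t ≤ 𝓝[Icc 0 t] t := by
    rw [← nhdsWithin_Ioo_eq_nhdsLT ht]
    exact nhdsWithin_mono _ Ioo_subset_Icc_self
  obtain ⟨l, hl, hls⟩ := (mem_nhdsLT_iff_exists_Ioo_subset' ht).1 (h2 h1)
  have hl' : max l 0 < t := max_lt hl ht
  have h3 : ∀ᵐ s ∂(volume.restrict (Ioo (max l 0) t)), False := by
    filter_upwards [ae_mono (Measure.restrict_mono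
      (Ioo_subset_Ioo_left (le_max_right l 0)) le_rfl) hB, ae_restrict_mem measurableSet_Ioo]
      with s hs hst
    have h4 : B < ∫ r in (0 : ℝ)..s, h r := hls ⟨(le_max_left l 0).trans_lt hst.1, hst.2⟩
    rw [e s ((le_max_right l 0).trans hst.1.le)] at h4
    linarith
  rw [Filter.eventually_false_iff_eq_bot, ae_eq_bot, Measure.restrict_eq_zero, Real.volume_Ioo,
    ENNReal.ofReal_eq_zero] at h3
  linarith

variable {φ₀ : E2 → ℝ} {c₀ a κ t : ℝ} {d₁ d₂ : ℝ → E2 → ℝ} {v : ℝ → E3 → E3} {θ₀ : E3 → ℝ}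
  {θ : ℝ → E3 → ℝ} {g : ℝ → E3 → E3}

/-- The energy norm is controlled by bounds valid for almost every time. -/
lemma IsWeakSolution.energyNorm_sq_le {Ω : Set E3} (hθ : IsWeakSolution Ω κ t v θ₀ θ g)
    (ht : 0 < t) {A B : ℝ} (hA0 : 0 ≤ A) (hB0 : 0 ≤ B)
    (hA : ∀ᵐ s ∂(volume.restrict (Ioo 0 t)), ∫ x in Ω, θ s x ^ 2 ≤ A)
    (hB : ∀ᵐ s ∂(volume.restrict (Ioo 0 t)), ∫ r in Ioo 0 s, ∫ x in Ω, ‖g r x‖ ^ 2 ≤ B) :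
    energyNorm t Ω θ g ^ 2 ≤ ENNReal.ofReal (2 * A + 2 * B) := by
  have h1 : mixedNorm ∞ 2 t Ω θ ≤ ENNReal.ofReal √A := by
    rw [mixedNorm, eLpNorm_exponent_top]
    refine essSup_le_of_ae_le _ ?_
    filter_upwards [hA, hθ.weak_grad] with s hs hws
    have e : ∫ x in Ω, θ s x ^ 2 = ∫ x in Ω, ‖θ s x‖ ^ 2 := by simp
    rw [e, ← toReal_eLpNorm_two_sq hws.1.1, ENNReal.toReal_pow] at hs
    rw [enorm_eq_self, ← ENNReal.ofReal_toReal hws.1.eLpNorm_ne_top]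
    exact ENNReal.ofReal_le_ofReal (Real.le_sqrt_of_sq_le hs)
  have hg2 := memLp_uncurry_of_mixedNorm hθ.measurable_grad hθ.mixedNorm_grad_lt_top
  have hg3 : Integrable (fun w => ‖Function.uncurry g w‖ ^ 2)
      ((volume.restrict (Ioo 0 t)).prod (volume.restrict Ω)) :=
    hg2.integrable_norm_pow (by norm_num)
  have h2 : mixedNorm 2 2 t Ω g ≤ ENNReal.ofReal √B := by
    rw [← ENNReal.ofReal_toReal hθ.mixedNorm_grad_lt_top.ne]
    refine ENNReal.ofReal_le_ofReal (Real.le_sqrt_of_sq_le ?_)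
    rw [← ENNReal.toReal_pow, mixedNorm_two_two_sq hθ.measurable_grad, ← eLpNorm_two_sq,
      toReal_eLpNorm_two_sq hg2.1, integral_prod _ hg3]
    exact setIntegral_Ioo_le_of_ae ht hg3.integral_prod_left hB
  calc energyNorm t Ω θ g ^ 2 ≤ (ENNReal.ofReal √A + ENNReal.ofReal √B) ^ 2 :=
        pow_le_pow_left₀ zero_le (add_le_add h1 h2) 2
    _ = ENNReal.ofReal ((√A + √B) ^ 2) := by
        rw [← ENNReal.ofReal_add (Real.sqrt_nonneg _) (Real.sqrt_nonneg _),
          ENNReal.ofReal_pow (by positivity)]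
    _ ≤ _ := by
        refine ENNReal.ofReal_le_ofReal ?_
        nlinarith [Real.sq_sqrt hA0, Real.sq_sqrt hB0, sq_nonneg (√A - √B)]

lemma ennreal_le_one_add_pow (x : ℝ≥0∞) {n : ℕ} (hn : n ≠ 0) : x ≤ 1 + x ^ n := by
  rcases le_total x 1 with h | h
  · exact h.trans le_self_add
  · exact (le_self_pow h hn).trans le_add_self

lemma mixedNorm_one_one : mixedNorm 1 1 t (crossSection φ₀ c₀) d₁ =
    ∫⁻ s in Ioo 0 t, ∫⁻ y in crossSection φ₀ c₀, ‖d₁ s y‖ₑ := by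
  rw [mixedNorm, eLpNorm_one_eq_lintegral_enorm]
  refine lintegral_congr fun s => ?_
  rw [enorm_eq_self, eLpNorm_one_eq_lintegral_enorm]

lemma mixedNorm_six_three_pow : mixedNorm 6 3 t (crossSection φ₀ c₀) d₁ ^ 6 =
    ∫⁻ s in Ioo 0 t, (∫⁻ y in crossSection φ₀ c₀, ‖d₁ s y‖ₑ ^ 3) ^ 2 := by
  rw [mixedNorm, eLpNorm_eq_lintegral_rpow_enorm_toReal (by norm_num) (by norm_num),
    ← ENNReal.rpow_natCast, ← ENNReal.rpow_mul]
  norm_num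
  refine lintegral_congr fun s => ?_
  rw [eLpNorm_eq_lintegral_rpow_enorm_toReal (by norm_num) (by norm_num),
    ← ENNReal.rpow_natCast, ← ENNReal.rpow_mul, ← ENNReal.rpow_natCast]
  norm_num

lemma lintegral_inflowWeight (hdm : JointlyMeasurable t (crossSection φ₀ c₀) d₁) :
    ∫⁻ s in Ioo 0 t, inflowWeight φ₀ c₀ d₁ s = mixedNorm 6 3 t (crossSection φ₀ c₀) d₁ ^ 6 +
      mixedNorm 1 1 t (crossSection φ₀ c₀) d₁ := by
  rw [mixedNorm_six_three_pow, mixedNorm_one_one]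
  exact lintegral_add_left' ((aemeasurable_lintegral_enorm_pow hdm 3).pow_const 2) _

/-- The section and the time interval have finite measure; x ≤ 1 + x³ in space and x ≤ 1 + x² in
time replace Hölder's inequality, since only finiteness is wanted. -/
lemma mixedNorm_one_one_lt_top (hsec : IsRegularSection φ₀ c₀)
    (h : mixedNorm 6 3 t (crossSection φ₀ c₀) d₁ < ∞) :
    mixedNorm 1 1 t (crossSection φ₀ c₀) d₁ < ∞ := by
  rw [mixedNorm_one_one]
  have hvol : volume (crossSection φ₀ c₀) < ∞ := hsec.bounded.measure_lt_top
  calc ∫⁻ s in Ioo 0 t, ∫⁻ y in crossSection φ₀ c₀, ‖d₁ s y‖ₑ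
      ≤ ∫⁻ s in Ioo 0 t, ((volume (crossSection φ₀ c₀) + 1) +
          (∫⁻ y in crossSection φ₀ c₀, ‖d₁ s y‖ₑ ^ 3) ^ 2) := by
        refine lintegral_mono fun s => ?_
        calc ∫⁻ y in crossSection φ₀ c₀, ‖d₁ s y‖ₑ
            ≤ ∫⁻ y in crossSection φ₀ c₀, (1 + ‖d₁ s y‖ₑ ^ 3) :=
              lintegral_mono fun y => ennreal_le_one_add_pow _ (by norm_num)
          _ = volume (crossSection φ₀ c₀) + ∫⁻ y in crossSection φ₀ c₀, ‖d₁ s y‖ₑ ^ 3 := by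
              rw [lintegral_add_left measurable_const]; simp
          _ ≤ _ := by
              rw [add_assoc]
              exact add_le_add le_rfl (ennreal_le_one_add_pow _ (by norm_num))
    _ = (volume (crossSection φ₀ c₀) + 1) * volume (Ioo (0 : ℝ) t) +
          mixedNorm 6 3 t (crossSection φ₀ c₀) d₁ ^ 6 := by
        rw [lintegral_add_left measurable_const, mixedNorm_six_three_pow]
        simp
    _ < ∞ := by
        refine ENNReal.add_lt_top.2 ⟨ENNReal.mul_lt_top (ENNReal.add_lt_top.2 ⟨hvol, by simp⟩) ?_,
          ENNReal.pow_lt_top h⟩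
        rw [Real.volume_Ioo]
        exact ENNReal.ofReal_lt_top

/-- Two-sided maximum principle. -/
lemma IsWeakSolution.ae_abs_le (hsec : IsRegularSection φ₀ c₀) (ha : 0 < a) (hκ : 0 < κ)
    {K : ℝ≥0∞} (hK : K ≠ ∞)
    (htrace : ∀ w : E3 → ℝ, ContDiff ℝ 1 w → ∀ d : E2 → ℝ≥0∞,
      AEMeasurable d (volume.restrict (crossSection φ₀ c₀)) →
      ∫⁻ y in crossSection φ₀ c₀, d y * ‖w (lift y (-a))‖ₑ ^ 2 ≤
        ENNReal.ofReal κ * (∫⁻ x in cylinder φ₀ c₀ a, ‖fderiv ℝ w x‖ₑ ^ 2) +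
        K * (((∫⁻ y in crossSection φ₀ c₀, d y ^ 3) ^ 2 + ∫⁻ y in crossSection φ₀ c₀, d y) *
          ∫⁻ x in cylinder φ₀ c₀ a, ‖w x‖ₑ ^ 2))
    (hdm : JointlyMeasurable t (crossSection φ₀ c₀) d₁)
    (hd : ∀ᵐ s ∂(volume.restrict (Ioo 0 t)),
      ∀ᵐ y ∂(volume.restrict (crossSection φ₀ c₀)), 0 ≤ d₁ s y ∧ 0 ≤ d₂ s y)
    (hD : ∫⁻ s in Ioo 0 t, inflowWeight φ₀ c₀ d₁ s ≠ ∞)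
    (hv : IsVelocity φ₀ c₀ a t d₁ d₂ v) (hθ : IsWeakSolution (cylinder φ₀ c₀ a) κ t v θ₀ θ g)
    (hθ₀ : MemLp θ₀ 2 (volume.restrict (cylinder φ₀ c₀ a))) {m : ℝ} (hm : 0 < m)
    (hθm : ∀ᵐ x ∂(volume.restrict (cylinder φ₀ c₀ a)), |θ₀ x| ≤ m) :
    ∀ᵐ s ∂(volume.restrict (Ioo 0 t)), ∀ᵐ x ∂(volume.restrict (cylinder φ₀ c₀ a)),
      |θ s x| ≤ m := by
  -- P vanishes exactly on [-m, m], so P(θ₀) = 0 almost everywhere. The Grönwall bound is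
  -- proportional to ∫P(θ₀)², which forces P(θ) = 0.
  obtain ⟨P, hP, hP1, ⟨C, hP2⟩, hPP, hPz, hPm⟩ := exists_excess hm
  have hP0 : P 0 = 0 := hPz 0 (by rw [abs_zero]; exact hm.le)
  have hPd : Differentiable ℝ P := hP.differentiable (by simp)
  have h0 : ∫ x in cylinder φ₀ c₀ a, P (θ₀ x) ^ 2 = 0 := by
    refine integral_eq_zero_of_ae ?_
    filter_upwards [hθm] with x hx
    simp [hPz _ hx]
  filter_upwards [hθ.ae_gronwall hsec ha hκ hK htrace hdm hd hD hv hθ₀ hP hP0 hP1 hP2 hPP,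
    hθ.weak_grad] with s hs hws
  rw [h0, zero_mul] at hs
  have h1 : 0 ≤ κ * ∫ r in Ioo 0 s, ∫ x in cylinder φ₀ c₀ a,
      deriv P (θ r x) ^ 2 * ‖g r x‖ ^ 2 :=
    mul_nonneg hκ.le (integral_nonneg fun r => integral_nonneg fun x =>
      mul_nonneg (sq_nonneg _) (sq_nonneg _))
  have h2 : 0 ≤ ∫ x in cylinder φ₀ c₀ a, P (θ s x) ^ 2 := integral_nonneg fun x => sq_nonneg _
  have hi : Integrable (fun x => P (θ s x) ^ 2) (volume.restrict (cylinder φ₀ c₀ a)) :=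
    (hws.1.of_le_mul (hP.continuous.comp_aestronglyMeasurable hws.1.1) (c := 1)
      (Eventually.of_forall fun x => by
        simpa [hP0] using abs_sub_le_of_abs_deriv_le hPd hP1 (θ s x) 0)).integrable_sq
  have h3 := (integral_eq_zero_iff_of_nonneg (fun x => sq_nonneg _) hi).1
    (le_antisymm (by linarith) h2)
  filter_upwards [h3] with x hx
  exact hPm _ (pow_eq_zero_iff two_ne_zero |>.1 hx)

/-- Energy inequality for solutions bounded by `m`. -/
lemma IsWeakSolution.ae_energy_le_of_abs_le (hsec : IsRegularSection φ₀ c₀) (ha : 0 < a)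
    (hκ : 0 < κ) (hdm : JointlyMeasurable t (crossSection φ₀ c₀) d₁)
    (hd : ∀ᵐ s ∂(volume.restrict (Ioo 0 t)),
      ∀ᵐ y ∂(volume.restrict (crossSection φ₀ c₀)), 0 ≤ d₁ s y ∧ 0 ≤ d₂ s y)
    (hX : mixedNorm 1 1 t (crossSection φ₀ c₀) d₁ < ∞)
    (hv : IsVelocity φ₀ c₀ a t d₁ d₂ v) (hθ : IsWeakSolution (cylinder φ₀ c₀ a) κ t v θ₀ θ g)
    (hθ₀ : MemLp θ₀ 2 (volume.restrict (cylinder φ₀ c₀ a))) {m : ℝ} (hm : 0 ≤ m)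
    (hθm : ∀ᵐ s ∂(volume.restrict (Ioo 0 t)), ∀ᵐ x ∂(volume.restrict (cylinder φ₀ c₀ a)),
      |θ s x| ≤ m) :
    ∀ᵐ s ∂(volume.restrict (Ioo 0 t)), κ * (∫ r in Ioo 0 s, ∫ x in cylinder φ₀ c₀ a,
      ‖g r x‖ ^ 2) ≤ (∫ x in cylinder φ₀ c₀ a, θ₀ x ^ 2) / 2 +
        m ^ 2 / 2 * (mixedNorm 1 1 t (crossSection φ₀ c₀) d₁).toReal := by
  rw [mixedNorm_one_one] at hX ⊢
  set D : ℝ → ℝ≥0∞ := fun s => ∫⁻ y in crossSection φ₀ c₀, ‖d₁ s y‖ₑ with hD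
  have hDm : AEMeasurable D (volume.restrict (Ioo 0 t)) := by
    simpa using aemeasurable_lintegral_enorm_pow hdm 1
  have hDfin := ae_lt_top' hDm hX.ne
  have hDi := integrable_toReal_of_lintegral_ne_top hDm hX.ne
  have hid : ContDiff ℝ ((⊤ : ℕ∞) : WithTop ℕ∞) fun r : ℝ => r := contDiff_id
  have hid1 : deriv (fun r : ℝ => r) = fun _ => 1 := by ext r; simp
  -- The energy inequality with P the identity and with the flux bounded through the sup bound
  -- instead of the trace inequality, so no Grönwall factor arises.
  have hen := hθ.ae_energy_le hsec ha hκ.le hv hθ₀ hid rfl (fun r => by simp [hid1]) (C := 0)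
    (fun r => by simp) (fun r => by simp)
    (Fl := fun s => m ^ 2 / 2 * (D s).toReal) (hDi.const_mul _) (fun k => by
      filter_upwards [hd, hDfin, hv.flux, hv.ae_memLp, hθ.weak_grad, hθm]
        with s hds hDs hfs hvs hws hms
      exact flux_le_of_bounded hsec ha hds hDs.ne hvs hfs hws hm hms (contDiff_entropy k hid)
        (entropy_zero k rfl) (entropy_nonneg k) (entropy_le k)
        (abs_deriv_entropy_le k (differentiable_id) fun r => by simp [hid1]))
  filter_upwards [hen, ae_restrict_mem measurableSet_Ioo] with s hs hst
  simp only [hid1, one_pow, one_mul] at hs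
  have h1 : 0 ≤ ∫ x in cylinder φ₀ c₀ a, θ s x ^ 2 := integral_nonneg fun x => sq_nonneg _
  have h2 : ∫ r in Ioo 0 s, m ^ 2 / 2 * (D r).toReal ≤
      m ^ 2 / 2 * (∫⁻ r in Ioo 0 t, D r).toReal := by
    rw [integral_const_mul, ← integral_toReal hDm hDfin]
    exact mul_le_mul_of_nonneg_left (setIntegral_mono_set hDi
      (Eventually.of_forall fun _ => ENNReal.toReal_nonneg)
      (Ioo_subset_Ioo_right hst.2.le).eventuallyLE) (by positivity)
  linarith

end HeatCylinder
-- Conclusion: comparison of the total inflow with a threshold.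
theorem theorem3p7 (φ₀ : HeatCylinder.E2 → ℝ) (c₀ a κ : ℝ)
    (hsec : HeatCylinder.IsRegularSection φ₀ c₀) (ha : 0 < a) (hκ : 0 < κ) :
    ∃ c : ℝ, 0 < c ∧
      ∀ (t θsup : ℝ) (d₁ d₂ : ℝ → HeatCylinder.E2 → ℝ)
        (v : ℝ → HeatCylinder.E3 → HeatCylinder.E3) (θ₀ : HeatCylinder.E3 → ℝ)
        (θ : ℝ → HeatCylinder.E3 → ℝ) (g : ℝ → HeatCylinder.E3 → HeatCylinder.E3),
        0 < t → 0 < θsup →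
        -- inflow and outflow
        HeatCylinder.JointlyMeasurable t (HeatCylinder.crossSection φ₀ c₀) d₁ →
        HeatCylinder.JointlyMeasurable t (HeatCylinder.crossSection φ₀ c₀) d₂ →
        (∀ᵐ s ∂(volume.restrict (Ioo 0 t)),
          ∀ᵐ y ∂(volume.restrict (HeatCylinder.crossSection φ₀ c₀)), 0 ≤ d₁ s y ∧ 0 ≤ d₂ s y) →
        HeatCylinder.mixedNorm 6 3 t (HeatCylinder.crossSection φ₀ c₀) d₁ < ∞ →
        HeatCylinder.mixedNorm 2 ∞ t (HeatCylinder.crossSection φ₀ c₀) d₁ < ∞ →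
        HeatCylinder.mixedNorm 1 1 t (HeatCylinder.crossSection φ₀ c₀) d₂ < ∞ →
        -- initial temperature
        MemLp θ₀ 2 (volume.restrict (HeatCylinder.cylinder φ₀ c₀ a)) →
        (∀ᵐ x ∂(volume.restrict (HeatCylinder.cylinder φ₀ c₀ a)), 0 ≤ θ₀ x ∧ θ₀ x ≤ θsup) →
        -- the advection-diffusion problem
        HeatCylinder.IsVelocity φ₀ c₀ a t d₁ d₂ v →
        HeatCylinder.IsWeakSolution (HeatCylinder.cylinder φ₀ c₀ a) κ t v θ₀ θ g →
        (∀ᵐ s ∂(volume.restrict (Ioo 0 t)),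
          ∀ᵐ x ∂(volume.restrict (HeatCylinder.cylinder φ₀ c₀ a)), θ s x ≤ θsup) ∧
        HeatCylinder.energyNorm t (HeatCylinder.cylinder φ₀ c₀ a) θ g ^ 2 ≤
          ENNReal.ofReal (c * Real.exp (c *
              (HeatCylinder.mixedNorm 6 3 t (HeatCylinder.crossSection φ₀ c₀) d₁).toReal ^ 6)) *
            eLpNorm θ₀ 2 (volume.restrict (HeatCylinder.cylinder φ₀ c₀ a)) ^ 2 +
          HeatCylinder.mixedNorm 1 1 t (HeatCylinder.crossSection φ₀ c₀) d₁ ^ 2 *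
            ENNReal.ofReal θsup ^ 2 +
          eLpNorm θ₀ 1 (volume.restrict (HeatCylinder.cylinder φ₀ c₀ a)) ^ 2 := by
  have hvol : volume (HeatCylinder.cylinder φ₀ c₀ a) ≠ ∞ :=
    (HeatCylinder.isBounded_cylinder hsec).measure_lt_top.ne
  obtain ⟨K, hK, htrace⟩ := HeatCylinder.exists_trace hsec ha
    (δ := ENNReal.ofReal κ) (ENNReal.ofReal_pos.2 hκ).ne' ENNReal.ofReal_ne_top
  set W : ℝ := (volume (HeatCylinder.cylinder φ₀ c₀ a)).toReal with hW
  have hW0 : 0 ≤ W := ENNReal.toReal_nonneg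
  -- The threshold for X = ‖d₁‖_{L₁}: if X ≥ M then X ≥ 1 and X² ≥ MX ≥ 2W + X/κ, which gives the
  -- coefficient 1 in front of X²θ*².
  set M : ℝ := 2 * W + 1 / κ + 1 with hM
  have hK0 : 0 ≤ K.toReal := ENNReal.toReal_nonneg
  -- One summand for each requirement: 1/κ for strong inflow, (2 + 2/κ)exp(KM) for weak inflow, and
  -- K for the exponent.
  set c : ℝ := 1 / κ + (2 + 2 / κ) * Real.exp (K.toReal * M) + K.toReal with hc
  have hκ1 : 0 < 1 / κ := by positivity
  have hM1 : 1 ≤ M := by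
    rw [hM]
    linarith
  have hcM : 0 < (2 + 2 / κ) * Real.exp (K.toReal * M) := by positivity
  refine ⟨c, by positivity, ?_⟩
  intro t θsup d₁ d₂ v θ₀ θ g ht hθsup hd₁m _ hd h63 _ _ hθ₀ hθ₀b hv hθ
  have hfin : IsFiniteMeasure (volume.restrict (HeatCylinder.cylinder φ₀ c₀ a)) :=
    ⟨by rw [Measure.restrict_apply_univ]; exact hvol.lt_top⟩
  set μ := volume.restrict (HeatCylinder.cylinder φ₀ c₀ a) with hμ
  have hX := HeatCylinder.mixedNorm_one_one_lt_top hsec h63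
  set N := HeatCylinder.mixedNorm 6 3 t (HeatCylinder.crossSection φ₀ c₀) d₁ with hN
  set X := HeatCylinder.mixedNorm 1 1 t (HeatCylinder.crossSection φ₀ c₀) d₁ with hXdef
  have hDint := HeatCylinder.lintegral_inflowWeight hd₁m
  have hD : ∫⁻ s in Ioo 0 t, HeatCylinder.inflowWeight φ₀ c₀ d₁ s ≠ ∞ := by
    rw [hDint]
    exact ENNReal.add_ne_top.2 ⟨ENNReal.pow_ne_top h63.ne, hX.ne⟩
  have habs := hθ.ae_abs_le hsec ha hκ hK htrace hd₁m hd hD hv hθ₀ hθsup (by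
    filter_upwards [hθ₀b] with x hx
    rw [abs_of_nonneg hx.1]
    exact hx.2)
  refine ⟨?_, ?_⟩
  · filter_upwards [habs] with s hs
    filter_upwards [hs] with x hx
    exact le_of_abs_le hx
  set y₀ : ℝ := ∫ x, θ₀ x ^ 2 ∂μ with hy₀
  have hy₀0 : 0 ≤ y₀ := integral_nonneg fun x => sq_nonneg _
  have hy₀e : eLpNorm θ₀ 2 μ ^ 2 = ENNReal.ofReal y₀ := by
    rw [← ENNReal.ofReal_toReal (ENNReal.pow_ne_top hθ₀.eLpNorm_ne_top (n := 2)),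
      HeatCylinder.toReal_eLpNorm_two_sq hθ₀.1]
    simp [hy₀]
  -- The bound already holds without the L₁ norm of θ₀, which only enlarges the right-hand side.
  suffices h : HeatCylinder.energyNorm t (HeatCylinder.cylinder φ₀ c₀ a) θ g ^ 2 ≤
      ENNReal.ofReal (c * Real.exp (c * N.toReal ^ 6) * y₀ + X.toReal ^ 2 * θsup ^ 2) by
    refine h.trans (le_trans (le_of_eq ?_) le_self_add)
    rw [hy₀e, ENNReal.ofReal_add (by positivity) (by positivity),
      ENNReal.ofReal_mul (p := c * Real.exp (c * N.toReal ^ 6)) (by positivity),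
      ENNReal.ofReal_mul (p := X.toReal ^ 2) (by positivity),
      ENNReal.ofReal_pow ENNReal.toReal_nonneg, ENNReal.ofReal_toReal hX.ne,
      ENNReal.ofReal_pow hθsup.le]
  have hX0 : 0 ≤ X.toReal := ENNReal.toReal_nonneg
  have hexp : 1 ≤ Real.exp (c * N.toReal ^ 6) := Real.one_le_exp (by positivity)
  rcases le_or_gt M X.toReal with hMX | hMX
  · -- strong inflow: the maximum principle absorbs the supremum of the `L₂` norm
    have hg := hθ.ae_energy_le_of_abs_le hsec ha hκ hd₁m hd hX hv hθ₀ hθsup.le habs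
    refine (hθ.energyNorm_sq_le ht (A := θsup ^ 2 * W)
      (B := (y₀ / 2 + θsup ^ 2 / 2 * X.toReal) / κ) (by positivity) (by positivity) ?_ ?_).trans
      (ENNReal.ofReal_le_ofReal ?_)
    · filter_upwards [habs] with s hs
      calc ∫ x in HeatCylinder.cylinder φ₀ c₀ a, θ s x ^ 2 ≤ ∫ _, θsup ^ 2 ∂μ := by
            refine integral_mono_of_nonneg (Filter.Eventually.of_forall fun x => sq_nonneg _)
              (integrable_const _) ?_
            filter_upwards [hs] with x hx
            exact sq_le_sq' (neg_le_of_abs_le hx) (le_of_abs_le hx)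
        _ = θsup ^ 2 * W := by
            rw [integral_const, smul_eq_mul, mul_comm, hW, Measure.real,
              Measure.restrict_apply_univ]
    · filter_upwards [hg] with s hs
      rw [le_div_iff₀ hκ, mul_comm]
      exact hs
    · have h1 : 1 / κ * y₀ ≤ c * Real.exp (c * N.toReal ^ 6) * y₀ := by
        refine mul_le_mul_of_nonneg_right ?_ hy₀0
        have : 1 / κ ≤ c := by rw [hc]; linarith
        nlinarith
      have h2 : 2 * W + 1 / κ * X.toReal ≤ X.toReal ^ 2 := by nlinarith
      have h3 := mul_le_mul_of_nonneg_right h2 (sq_nonneg θsup)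
      have e : 2 * (θsup ^ 2 * W) + 2 * ((y₀ / 2 + θsup ^ 2 / 2 * X.toReal) / κ) =
          1 / κ * y₀ + (2 * W + 1 / κ * X.toReal) * θsup ^ 2 := by
        field_simp
        ring
      rw [e]
      exact add_le_add h1 h3
  · -- weak inflow: Grönwall's inequality
    have hid : ContDiff ℝ ((⊤ : ℕ∞) : WithTop ℕ∞) fun r : ℝ => r := contDiff_id
    have hid1 : deriv (fun r : ℝ => r) = fun _ => 1 := by ext r; simp
    have hgr := hθ.ae_gronwall hsec ha hκ hK htrace hd₁m hd hD hv hθ₀ hid rfl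
      (fun r => by simp [hid1]) (C := 0) (fun r => by simp) (fun r => by simp)
    simp only [hid1, one_pow, one_mul] at hgr
    set Y : ℝ := y₀ * Real.exp (K.toReal *
      (∫⁻ s in Ioo 0 t, HeatCylinder.inflowWeight φ₀ c₀ d₁ s).toReal) with hY
    have hY0 : 0 ≤ Y := by positivity
    have hYle : (2 + 2 / κ) * Y ≤ c * Real.exp (c * N.toReal ^ 6) * y₀ := by
      have h1 : Real.exp (K.toReal *
          (∫⁻ s in Ioo 0 t, HeatCylinder.inflowWeight φ₀ c₀ d₁ s).toReal) ≤
          Real.exp (K.toReal * M) * Real.exp (c * N.toReal ^ 6) := by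
        -- The integrated weight is N⁶ + X: the part X < M goes into the constant, the part N⁶ into
        -- the exponential of the statement.
        rw [← Real.exp_add, hDint, ENNReal.toReal_add (ENNReal.pow_ne_top h63.ne) hX.ne,
          ENNReal.toReal_pow]
        refine Real.exp_le_exp.2 ?_
        have h2 : K.toReal * X.toReal ≤ K.toReal * M := mul_le_mul_of_nonneg_left hMX.le hK0
        have h3 : K.toReal * N.toReal ^ 6 ≤ c * N.toReal ^ 6 := by
          refine mul_le_mul_of_nonneg_right ?_ (by positivity)
          rw [hc]; linarith
        linarith
      have h2 : (2 + 2 / κ) * Real.exp (K.toReal * M) ≤ c := by rw [hc]; linarith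
      calc (2 + 2 / κ) * Y ≤ (2 + 2 / κ) *
            (y₀ * (Real.exp (K.toReal * M) * Real.exp (c * N.toReal ^ 6))) :=
            mul_le_mul_of_nonneg_left (mul_le_mul_of_nonneg_left h1 hy₀0) (by positivity)
        _ = (2 + 2 / κ) * Real.exp (K.toReal * M) * (Real.exp (c * N.toReal ^ 6) * y₀) := by ring
        _ ≤ c * (Real.exp (c * N.toReal ^ 6) * y₀) :=
            mul_le_mul_of_nonneg_right h2 (by positivity)
        _ = _ := by ring
    refine (hθ.energyNorm_sq_le ht (A := Y) (B := Y / κ) hY0 (by positivity) ?_ ?_).trans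
      (ENNReal.ofReal_le_ofReal ?_)
    · filter_upwards [hgr] with s hs
      have : 0 ≤ κ * ∫ r in Ioo 0 s, ∫ x in HeatCylinder.cylinder φ₀ c₀ a, ‖g r x‖ ^ 2 :=
        mul_nonneg hκ.le (integral_nonneg fun r => integral_nonneg fun x => sq_nonneg _)
      linarith
    · filter_upwards [hgr] with s hs
      have : 0 ≤ ∫ x in HeatCylinder.cylinder φ₀ c₀ a, θ s x ^ 2 :=
        integral_nonneg fun x => sq_nonneg _
      rw [le_div_iff₀ hκ, mul_comm]
      linarith
    · have h1 : 2 * Y + 2 * (Y / κ) = (2 + 2 / κ) * Y := by ring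
      rw [h1]
      have : 0 ≤ X.toReal ^ 2 * θsup ^ 2 := by positivity
      linarith
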